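/- Fix a finite input alphabet $\Sigma$. Both models below have a finite control and a finite tape alphabet $\Gamma\supset\Sigma\sqcup\{b\}$, where $b$ is the blank; they have a one-way infinite address tape $T_A$ with a head, whose contents are read as a number in a fixed radix, and a classical tape $T_C$. A classical step sees the state, the symbol of $T_A$ under the head and the symbol $T_C(T_A)$ at the current address. It may rewrite both symbols, move the head of $T_A$ by at most one cell and change the state. *Quantum RAM machine.* It has in addition a quantum tape $T_Q$ and a one-cell quantum register $R_Q$, every cell having the Hilbert space $\mathbb C[\Gamma]$. In one step it either performs a (possibly probabilistic) classical step, or applies a trace-preserving completely positive operation jointly to $R_Q$ and the cell $T_Q(T_A)$, or measures $R_Q$ in the basis $\Gamma$ and chooses its next state by the outcome. A run ends with the answer yes or no. The input is initially written on $T_C$ or on $T_Q$ (either convention); everything else is blank. The computation time is the maximal number of steps over inputs of length $n$ and branches of nonzero probability. *Classically uniform family of quantum circuits.* The circuits are generated by a deterministic classical RAM machine of the above kind, which starts with $1^n$ on $T_C$, where $n$ is the input length. Each step of the generator is a classical step, or names the next operand of the gate in preparation (one of finitely many ancilla wires, or the wire whose number is on $T_A$), or appends a gate to the circuit. A gate is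 a quantum operation on a tuple of distinct wires with state space $\mathbb C[\Gamma]$; each family uses only finitely many operations (so gates of bounded arity), and they may be unitary operators, measurements or general quantum operations. The generation may be adaptive: the next state of the generator may depend on measurement outcomes. The input is initially on the numbered wires $0,\dots,n-1$, and all other wires are blank. At the end the generator gives the answer yes or no. The family is uniform if the generator always finishes, in a number of steps that is $O(1+g)$ on each branch of nonzero probability, where $g$ is the number of gates of the circuit generated on that branch. The gate complexity is the maximal number of gates over inputs of length $n$ and branches of nonzero probability. Proposition. Let $p:\Sigma^*\to\mathbb R$ and $T:\mathbb N\to\mathbb N$ with $T(n)\ge 1$ for all $n$. There is a classically uniform family of quantum circuits with gate complexity $O(T(n))$ that answers yes with probability $p(x)$ on every input $x$ if and only if there is a quantum RAM machine with computation time $O(T(n))$ that answers yes with probability $p(x)$ on every input $x$. This holds both for machines whose input is written on $T_C$ and for machines whose input is written on $T_Q$. (Here $O(T(n))$ means at most $c\,T(n)$ for all $n$, with a constant $c$ independent of $n$.) -/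

import Mathlib

noncomputable section

namespace QComp

/-! ### Quantum memories and local quantum operations -/

/-- A pure state (not necessarily normalised) of a quantum memory whose cells are labelled by `W`
and have the Hilbert space `ℂ[Γ]`: a finite linear combination of basis states, a basis state being
an assignment of a symbol of `Γ` to every cell. -/
abbrev QState (W Γ : Type) : Type := (W → Γ) →₀ ℂ

/-- The squared norm.  All runs below are followed branch by branch with unnormalised states, so
that this is the probability of the branch. -/
def QState.weight {W Γ : Type} (ψ : QState W Γ) : ℝ := ψ.sum fun _ a => ‖a‖ ^ 2

/-- The operator `K` on `k` cells, applied to the distinct cells `w 0, …, w (k - 1)` and tensored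
with the identity on all other cells:
`|c⟩ ↦ ∑ t, K t (c ∘ w) |c with the cells w overwritten by t⟩`. -/
def applyAt {W Γ : Type} [Fintype Γ] {k : ℕ}
    (K : Matrix (Fin k → Γ) (Fin k → Γ) ℂ) (w : Fin k ↪ W) (ψ : QState W Γ) : QState W Γ :=
  ψ.sum fun c a => ∑ t : Fin k → Γ, Finsupp.single (Function.extend w t c) (a * K t (c ∘ w))

/-- A trace preserving completely positive operation on `k` cells, in operator-sum (Kraus) form.
A unitary is the case of one Kraus operator. -/
structure QOp (Γ : Type) [Fintype Γ] [DecidableEq Γ] (k : ℕ) where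
  /-- number of Kraus operators -/
  r : ℕ
  K : Fin r → Matrix (Fin k → Γ) (Fin k → Γ) ℂ
  complete : ∑ i, (K i).conjTranspose * K i = 1

/-! ### Branching runs -/

/-- All branches of a computation after `t` steps, if `next c` lists the successors of `c`. -/
def after {C : Type} (next : C → Multiset C) (c₀ : C) : ℕ → Multiset C
  | 0 => {c₀}
  | t + 1 => (after next c₀ t).bind next

/-- The probability that the computation has answered `b` after `t` steps. -/
def answerProb {C : Type} (next : C → Multiset C) (answer : C → Option Bool) (weight : C → ℝ)
    (b : Bool) (c₀ : C) (t : ℕ) : ℝ :=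
  ((after next c₀ t).map fun c => if answer c = some b then weight c else 0).sum

/-! ### The classical part: finite control, linear address tape, randomly accessed tape -/

inductive Dir
  | left | stay | right

instance : Fintype Dir where
  elems := {val := {Dir.left, Dir.stay, Dir.right}, nodup := by simp}
  complete d := by cases d <;> simp

/-- New head position on a tape that is infinite to the right; a left move in cell `0` stays. -/
def Dir.move : Dir → ℕ → ℕ
  | .left, h => h - 1
  | .stay, h => h
  | .right, h => h + 1

/-- Finite data common to the machines below: a set of states, a tape alphabet that contains the
input alphabet `σ` and a blank, and the way in which symbols are read as digits of an address. -/
structure Core (σ : Type) where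
  S : Type
  [fintypeS : Fintype S]
  Γ : Type
  [fintypeΓ : Fintype Γ]
  [decEqΓ : DecidableEq Γ]
  blank : Γ
  letter : σ ↪ Γ
  letter_ne_blank : ∀ a, letter a ≠ blank
  radix : ℕ
  two_le_radix : 2 ≤ radix
  digit : Γ → ℕ
  digit_lt : ∀ a, digit a < radix
  digit_blank : digit blank = 0
  start : S

attribute [instance] Core.fintypeS Core.fintypeΓ Core.decEqΓ

namespace Core

variable {σ : Type} (P : Core σ)

/-- The contents of a tape on which the word `x` is written from cell `0` on. -/
def wordTape (x : List σ) (i : ℕ) : P.Γ := (x[i]?).elim P.blank P.letter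

/-- Classical configuration: state, address tape `T_A` with its head, work tape `T_C`. -/
structure Cfg where
  state : P.S
  tA : ℕ → P.Γ
  head : ℕ
  tC : ℕ → P.Γ

/-- What one classical step does: new state, symbol written on `T_A` under the head, symbol
written on `T_C` at the current address, and move of the head of `T_A`. -/
abbrev Action : Type := P.S × P.Γ × P.Γ × Dir

variable {P}

/-- The number written on the address tape, least significant digit in cell `0`.  (Only finitely
many cells of the address tape are ever nonblank, and blanks count as zeros.) -/
def Cfg.address (c : P.Cfg) : ℕ := ∑ᶠ i : ℕ, P.digit (c.tA i) * P.radix ^ i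

def Cfg.goto (c : P.Cfg) (s : P.S) : P.Cfg := { c with state := s }

/-- The effect of an action; the address is the one before the action. -/
def Cfg.act (c : P.Cfg) (a : P.Action) : P.Cfg where
  state := a.1
  tA := Function.update c.tA c.head a.2.1
  head := a.2.2.2.move c.head
  tC := Function.update c.tC c.address a.2.2.1

/-- The symbol on `T_A` under the head. -/
def Cfg.readA (c : P.Cfg) : P.Γ := c.tA c.head

/-- The symbol on `T_C` at the current address. -/
def Cfg.readC (c : P.Cfg) : P.Γ := c.tC c.address

end Core

/-! ### The quantum RAM machine -/

/-- The instruction attached to a state of a quantum RAM machine. -/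
inductive RAMInstr {σ : Type} (P : Core σ) : Type
  /-- a probabilistic classical step, depending on `T_A` under the head and on `T_C(T_A)` -/
  | classical (δ : P.Γ → P.Γ → PMF P.Action)
  /-- apply a quantum operation jointly to `R_Q` and `T_Q(T_A)` -/
  | quantum (E : QOp P.Γ 2) (next : P.S)
  /-- measure `R_Q` in the basis `Γ` and choose the next state by the outcome -/
  | measure (next : P.Γ → P.S)
  | halt (answer : Bool)

/-- A RAM machine with a classical address tape `T_A`, a one-cell quantum register `R_Q`, a
classical tape `T_C` and a quantum tape `T_Q`. -/
structure QRAM (σ : Type) extends Core σ where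
  prog : S → RAMInstr toCore

/-- The tape on which a quantum RAM machine finds its input. -/
inductive InputTape
  | classical | quantum

namespace QRAM

variable {σ : Type} (M : QRAM σ)

/-- The cells of the quantum memory: `none` is `R_Q` and `some n` is cell `n` of `T_Q`. -/
abbrev Cell : Type := Option ℕ

/-- A branch of a run; its probability is the squared norm of `psi`. -/
structure Cfg where
  cl : M.toCore.Cfg
  psi : QState Cell M.Γ

variable {M}

def Cfg.weight (c : M.Cfg) : ℝ := QState.weight c.psi

def Cfg.answer (c : M.Cfg) : Option Bool :=
  match M.prog c.cl.state with
  | .halt b => some b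
  | _ => none

/-- `R_Q` and cell `n` of `T_Q`. -/
def regAndCell (n : ℕ) : Fin 2 ↪ Cell :=
  ⟨![none, some n], by intro i j; fin_cases i <;> fin_cases j <;> simp⟩

/-- One step; a halted branch stays as it is. -/
def Cfg.next (c : M.Cfg) : Multiset M.Cfg :=
  match M.prog c.cl.state with
  | .classical δ => Finset.univ.val.map fun a : M.toCore.Action =>
      ⟨c.cl.act a, (Real.sqrt (δ c.cl.readA c.cl.readC a).toReal : ℂ) • c.psi⟩
  | .quantum E s => Finset.univ.val.map fun i : Fin E.r =>
      ⟨c.cl.goto s, applyAt (E.K i) (regAndCell c.cl.address) c.psi⟩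
  | .measure f => Finset.univ.val.map fun a : M.Γ =>
      ⟨c.cl.goto (f a), c.psi.filter fun z => z none = a⟩
  | .halt _ => {c}

variable (M)

/-- Everything is blank, except that the input is written on `T_C` or, as a basis state,
on `T_Q`. -/
def init : InputTape → List σ → M.Cfg
  | .classical, x =>
      ⟨⟨M.start, fun _ => M.blank, 0, M.wordTape x⟩, Finsupp.single (fun _ => M.blank) 1⟩
  | .quantum, x =>
      ⟨⟨M.start, fun _ => M.blank, 0, fun _ => M.blank⟩,
        Finsupp.single (fun w : Cell => w.elim M.blank (M.wordTape x)) 1⟩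

/-- On every input `x` the machine halts within `T |x|` steps, on all branches of nonzero
probability, and answers "yes" with probability `p x`. -/
def ComputesInTime (tape : InputTape) (p : List σ → ℝ) (T : ℕ → ℕ) : Prop :=
  ∀ x : List σ,
    (∀ c ∈ after Cfg.next (M.init tape x) (T x.length), c.weight ≠ 0 → c.answer ≠ none) ∧
    answerProb Cfg.next Cfg.answer Cfg.weight true (M.init tape x) (T x.length) = p x

end QRAM

/-! ### Quantum circuits generated by a classical machine -/

/-- A gate of a circuit on wires labelled by `W`: a quantum operation on `k` distinct wires,
together with the Kraus operator that has occurred on the branch under consideration. -/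
structure Gate (W Γ : Type) [Fintype Γ] [DecidableEq Γ] where
  k : ℕ
  U : QOp Γ k
  wires : Fin k ↪ W
  branch : Fin U.r

/-- A circuit, first gate first. -/
abbrev Circuit (W Γ : Type) [Fintype Γ] [DecidableEq Γ] : Type := List (Gate W Γ)

/-- The unnormalised state that results from running a circuit. -/
def Circuit.run {W Γ : Type} [Fintype Γ] [DecidableEq Γ] (C : Circuit W Γ) (ψ : QState W Γ) :
    QState W Γ :=
  C.foldl (fun φ g => applyAt (g.U.K g.branch) g.wires φ) ψ

/-- The instruction attached to a state of a circuit generator with `m` ancilla wires. -/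
inductive GenInstr {σ : Type} (P : Core σ) (m : ℕ) : Type
  /-- a deterministic classical step -/
  | classical (δ : P.Γ → P.Γ → P.Action)
  /-- let ancilla wire `i` be the next operand of the gate in preparation -/
  | ancilla (i : Fin m) (next : P.S)
  /-- let the wire whose number is on the address tape be the next operand -/
  | wire (next : P.S)
  /-- append the gate `U` on the chosen operands to the circuit.  Kraus operator number `i` sends
  the generator to state `next i`, which is all that it learns: `next` is constant for a gate
  without measured outcome, and tells apart the outcomes of a measurement. -/
  | emit (k : ℕ) (U : QOp P.Γ k) (next : Fin U.r → P.S)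
  /-- the circuit is complete, and its outcomes amount to this answer -/
  | halt (answer : Bool)

/-- A family of quantum circuits, given by a deterministic classical RAM machine that generates
the circuit for inputs of length `n` from `n` in unary, possibly adaptively.  The wires are a
fixed number of ancilla wires and wires numbered `0, 1, 2, …`.  As there are finitely many
states, only finitely many different operations are used as gates. -/
structure CircuitFamily (σ : Type) extends Core σ where
  tally : Γ
  tally_ne_blank : tally ≠ blank
  numAncilla : ℕ
  prog : S → GenInstr toCore numAncilla

namespace CircuitFamily

variable {σ : Type} (F : CircuitFamily σ)

abbrev Wire : Type := Fin F.numAncilla ⊕ ℕ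

/-- A branch of the generation: the generator, the operands chosen for the next gate, the circuit
generated so far, and the number of steps of the generator. -/
structure Cfg where
  cl : F.toCore.Cfg
  operands : List F.Wire
  circuit : Circuit F.Wire F.Γ
  clock : ℕ

variable {F}

def Cfg.answer (c : F.Cfg) : Option Bool :=
  match F.prog c.cl.state with
  | .halt b => some b
  | _ => none

open Classical in
/-- One step of the generator.  A complete circuit stays as it is; a generator that attempts to
emit a gate on a wrong number of wires, or on the same wire twice, hangs forever. -/
def Cfg.next (c : F.Cfg) : Multiset F.Cfg :=
  match F.prog c.cl.state with
  | .classical δ =>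
      {⟨c.cl.act (δ c.cl.readA c.cl.readC), c.operands, c.circuit, c.clock + 1⟩}
  | .ancilla i s => {⟨c.cl.goto s, c.operands ++ [Sum.inl i], c.circuit, c.clock + 1⟩}
  | .wire s => {⟨c.cl.goto s, c.operands ++ [Sum.inr c.cl.address], c.circuit, c.clock + 1⟩}
  | .emit k U f =>
      if h : c.operands.length = k ∧ c.operands.Nodup then
        Finset.univ.val.map fun i : Fin U.r =>
          ⟨c.cl.goto (f i), [],
            c.circuit ++ [⟨k, U, ⟨fun j => c.operands.get (j.cast h.1.symm),
              (List.nodup_iff_injective_get.mp h.2).comp (Fin.cast_injective _)⟩, i⟩],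
            c.clock + 1⟩
      else {c}
  | .halt _ => {c}

variable (F)

/-- The generator starts with the length of the input in unary on `T_C`. -/
def init (n : ℕ) : F.Cfg :=
  ⟨⟨F.start, fun _ => F.blank, 0, fun i => if i < n then F.tally else F.blank⟩, [], [], 0⟩

/-- The numbered wires carry the input, followed by blanks; the ancilla wires are blank. -/
def inputState (x : List σ) : QState F.Wire F.Γ :=
  Finsupp.single (Sum.elim (fun _ => F.blank) (F.wordTape x)) 1

variable {F}

/-- The probability, on input `x`, of the measured outcomes that lead to this branch. -/
def Cfg.weight (x : List σ) (c : F.Cfg) : ℝ := QState.weight (c.circuit.run (F.inputState x))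

variable (F)

/-- Classical uniformity: the generator always completes its circuit, in a number of steps linear
in the number of gates. -/
def Uniform : Prop :=
  ∃ κ : ℕ, ∀ x : List σ, ∃ t : ℕ, ∀ c ∈ after Cfg.next (F.init x.length) t, c.weight x ≠ 0 →
    c.answer ≠ none ∧ c.clock ≤ κ * (c.circuit.length + 1)

/-- On every input `x` the circuit has at most `G |x|` gates, on all branches of nonzero
probability, and the answer is "yes" with probability `p x`. -/
def ComputesWithGates (p : List σ → ℝ) (G : ℕ → ℕ) : Prop :=
  ∀ x : List σ, ∃ t : ℕ,
    (∀ c ∈ after Cfg.next (F.init x.length) t, c.weight x ≠ 0 →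
      c.answer ≠ none ∧ c.circuit.length ≤ G x.length) ∧
    answerProb Cfg.next Cfg.answer (Cfg.weight x) true (F.init x.length) t = p x

end CircuitFamily

end QComp

end

/-! From a machine to a family. The generator can follow the control, `T_A` and the head of the
machine on its own tapes, but not `T_C`, because it does not know the input. So wire `a` carries the
pair of symbols in cell `a` of `T_C` and of `T_Q`, and one ancilla wire carries `R_Q`. A step
touches this memory only in `R_Q` and in the current cells of `T_C` and `T_Q`; it is therefore one
gate on two wires (`localStep`, `QOp.transfer`). Reading `T_C` and random choices become Kraus
operators, and the index of the Kraus operator tells the generator the new state, the symbol to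
write on `T_A` and the move. Each step costs one gate and five steps of the generator
(`GenSim.outcome`).

From a family to a machine there are three obstacles. A gate acts on several wires, while the
machine reaches `R_Q` and one cell of `T_Q`. So `R_Q` holds a whole register: all ancillas, and as
many slots as the largest arity. Naming an operand swaps it into the next slot, and the gate acts on
the slots. Afterwards the operands must return, but their addresses do not fit into the finite
control. Therefore the generator is run a second time from the last gate on, with the same swaps;
for distinct operands the product of the swaps is an involution (`gather_mul_self`). To make this
possible the tapes keep their contents as of the last gate. The cells visited on `T_A` form an
interval of length linear in the number of steps, so restoring it by sweeps is cheap
(`outcome_mark`); `T_C` keeps two versions of every cell.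

The control learns an outcome only by measuring `R_Q`, which holds the register. So a quantum
operation parks the register in the current cell of `T_Q` and leaves only the outcome in `R_Q`;
after the measurement the register is fetched back (`outcome_apply`).

Finally, the generator expects `1^n`, whereas the tapes hold the input. In a cell not yet visited,
exchanging the blank with the symbol on `T_C` turns the symbol on `T_Q` into the input letter,
whichever tape the input is on. This is done at the first visit, together with a measurement of the
letter; the measurement is harmless, since no gate has touched that wire (`outcome_of_unknown`).

Every step of the generator costs a bounded number of machine steps, so the time is linear in the
clock, and by uniformity in the number of gates (`Ready.outcome`, `Uniform.simulator`). Both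
simulations are followed branch by branch: encodings of memories are injective on basis states and
preserve weights, and superfluous branches have weight zero. -/

noncomputable section

namespace QComp

open Function

/-! ### Local operators and weights -/

section Local

variable {W Γ : Type}

theorem extend_extend {α β γ : Type} {w : α → β} (hw : Injective w) (t t' : α → γ) (c : β → γ) :
    extend w t' (extend w t c) = extend w t' c := by
  funext b
  by_cases hb : ∃ a, w a = b
  · obtain ⟨a, rfl⟩ := hb
    rw [hw.extend_apply, hw.extend_apply]
  · rw [extend_apply' _ _ _ hb, extend_apply' _ _ _ hb, extend_apply' _ _ _ hb]

theorem extend_self_comp {α β γ : Type} {w : α → β} (hw : Injective w) (c : β → γ) :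
    extend w (c ∘ w) c = c := by
  funext b
  by_cases hb : ∃ a, w a = b
  · obtain ⟨a, rfl⟩ := hb
    rw [hw.extend_apply, comp_apply]
  · rw [extend_apply' _ _ _ hb]

variable [Fintype Γ] {k : ℕ}

theorem applyAt_zero (K : Matrix (Fin k → Γ) (Fin k → Γ) ℂ) (w : Fin k ↪ W) :
    applyAt K w (0 : QState W Γ) = 0 := by
  simp [applyAt]

theorem applyAt_single (K : Matrix (Fin k → Γ) (Fin k → Γ) ℂ) (w : Fin k ↪ W)
    (c : W → Γ) (a : ℂ) :
    applyAt K w (Finsupp.single c a) =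
      ∑ t : Fin k → Γ, Finsupp.single (extend w t c) (a * K t (c ∘ w)) := by
  simp [applyAt, Finsupp.sum_single_index]

theorem applyAt_add (K : Matrix (Fin k → Γ) (Fin k → Γ) ℂ) (w : Fin k ↪ W) (ψ φ : QState W Γ) :
    applyAt K w (ψ + φ) = applyAt K w ψ + applyAt K w φ := by
  classical
  refine Finsupp.sum_add_index' (fun c => by simp) fun c a b => ?_
  simp [add_mul, Finset.sum_add_distrib]

theorem applyAt_sum {ι : Type} (s : Finset ι) (K : Matrix (Fin k → Γ) (Fin k → Γ) ℂ)
    (w : Fin k ↪ W) (ψ : ι → QState W Γ) :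
    applyAt K w (∑ i ∈ s, ψ i) = ∑ i ∈ s, applyAt K w (ψ i) :=
  map_sum (AddMonoidHom.mk' (applyAt K w) (applyAt_add K w)) ψ s

theorem applyAt_matrix_sum {ι : Type} (s : Finset ι)
    (K : ι → Matrix (Fin k → Γ) (Fin k → Γ) ℂ) (w : Fin k ↪ W) (ψ : QState W Γ) :
    applyAt (∑ i ∈ s, K i) w ψ = ∑ i ∈ s, applyAt (K i) w ψ := by
  induction ψ using Finsupp.induction_linear with
  | zero => simp [applyAt_zero]
  | add f g hf hg => simp only [applyAt_add, hf, hg, Finset.sum_add_distrib]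
  | single c a =>
    simp only [applyAt_single, Matrix.sum_apply, Finset.mul_sum]
    rw [Finset.sum_comm]
    exact Finset.sum_congr rfl fun t _ => Finsupp.single_finsetSum _ _ _

theorem applyAt_mul (A B : Matrix (Fin k → Γ) (Fin k → Γ) ℂ) (w : Fin k ↪ W) (ψ : QState W Γ) :
    applyAt (A * B) w ψ = applyAt A w (applyAt B w ψ) := by
  induction ψ using Finsupp.induction_linear with
  | zero => simp [applyAt_zero]
  | add f g hf hg => simp only [applyAt_add, hf, hg]
  | single c a =>
    simp only [applyAt_single, applyAt_sum, extend_extend w.injective, extend_comp w.injective,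
      Matrix.mul_apply, Finset.mul_sum]
    rw [Finset.sum_comm]
    refine Finset.sum_congr rfl fun t _ => ?_
    rw [Finsupp.single_finsetSum]
    exact Finset.sum_congr rfl fun t' _ => by ring_nf

theorem applyAt_one [DecidableEq Γ] (w : Fin k ↪ W) (ψ : QState W Γ) :
    applyAt (1 : Matrix (Fin k → Γ) (Fin k → Γ) ℂ) w ψ = ψ := by
  induction ψ using Finsupp.induction_linear with
  | zero => simp [applyAt_zero]
  | add f g hf hg => simp only [applyAt_add, hf, hg]
  | single c a =>
    rw [applyAt_single, Finset.sum_eq_single (c ∘ w)]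
    · simp [extend_self_comp w.injective]
    · intro t _ ht
      simp [Matrix.one_apply_ne ht]
    · simp

/-- If every outcome annihilated `ψ`, then `ψ = ∑ Kᵢ†Kᵢ ψ = 0`. Hence a live branch survives each
gate in at least one outcome, which `Outcome.clock_le` uses to compare the present clock with a
bound at the leaves. -/
theorem QOp.exists_applyAt_ne_zero [DecidableEq Γ] (U : QOp Γ k) (w : Fin k ↪ W)
    {ψ : QState W Γ} (hψ : ψ ≠ 0) : ∃ i, applyAt (U.K i) w ψ ≠ 0 := by
  by_contra! h
  apply hψ
  rw [← applyAt_one w ψ, ← U.complete, applyAt_matrix_sum]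
  exact Finset.sum_eq_zero fun i _ => by rw [applyAt_mul, h i, applyAt_zero]

/-- Off the cells `w` the basis states are unchanged; this shows that wires not yet used by any gate
still carry their input letters. -/
theorem mem_support_applyAt {K : Matrix (Fin k → Γ) (Fin k → Γ) ℂ} {w : Fin k ↪ W}
    {ψ : QState W Γ} {c : W → Γ} (hc : c ∈ (applyAt K w ψ).support) :
    ∃ c₀ ∈ ψ.support, ∃ t, c = extend w t c₀ := by
  classical
  obtain ⟨c₀, h₀, h⟩ := Finset.mem_biUnion.mp (Finsupp.support_sum hc)
  obtain ⟨t, -, ht⟩ := Finset.mem_biUnion.mp (Finsupp.support_finsetSum h)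
  exact ⟨c₀, h₀, t, Finset.mem_singleton.mp (Finsupp.support_single_subset ht)⟩

end Local

section Weight

variable {W W' Γ Γ' : Type}

theorem QState.weight_zero : QState.weight (0 : QState W Γ) = 0 := by
  simp [QState.weight]

theorem QState.weight_eq_zero {ψ : QState W Γ} : ψ.weight = 0 ↔ ψ = 0 := by
  refine ⟨fun h => ?_, fun h => h ▸ QState.weight_zero⟩
  rw [QState.weight, Finsupp.sum, Finset.sum_eq_zero_iff_of_nonneg fun _ _ => by positivity] at h
  ext c
  by_contra hc
  exact hc (by simpa using h c (Finsupp.mem_support_iff.mpr hc))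

/-- Every encoding of one memory in another below is an injective relabelling of basis states, so
simulated and simulating branches have equal probabilities. -/
theorem QState.weight_mapDomain {f : (W → Γ) → (W' → Γ')} (hf : Injective f) (ψ : QState W Γ) :
    QState.weight (Finsupp.mapDomain f ψ) = ψ.weight :=
  Finsupp.sum_mapDomain_index_inj hf

end Weight

/-! ### Instruments: measuring a function of the basis state -/

namespace QOp

variable {Γ : Type} [Fintype Γ] [DecidableEq Γ] {J : Type} [Fintype J] {k : ℕ}

/-- A quantum operation with Kraus operators labelled by an arbitrary finite type. -/
def ofKraus (K : J → Matrix (Fin k → Γ) (Fin k → Γ) ℂ)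
    (h : ∑ j, (K j).conjTranspose * K j = 1) : QOp Γ k where
  r := Fintype.card J
  K i := K ((Fintype.equivFin J).symm i)
  complete := by
    rw [← h]
    exact Equiv.sum_comp (Fintype.equivFin J).symm fun j => (K j).conjTranspose * K j

variable [DecidableEq J]

/-- The restriction of the basis permutation `e` to the basis states with `φ = j`. -/
def instrumentMatrix (e : Equiv.Perm (Fin k → Γ)) (φ : (Fin k → Γ) → J) (j : J) :
    Matrix (Fin k → Γ) (Fin k → Γ) ℂ :=
  Matrix.of fun t s => if t = e s ∧ φ s = j then 1 else 0

/-- Measure the function `φ` of the basis states, then permute the basis by `e`. -/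
def instrument (e : Equiv.Perm (Fin k → Γ)) (φ : (Fin k → Γ) → J) : QOp Γ k :=
  ofKraus (instrumentMatrix e φ) (by
    ext s₁ s₂
    simp only [Matrix.sum_apply, Matrix.mul_apply, Matrix.conjTranspose_apply, Matrix.one_apply,
      instrumentMatrix, Matrix.of_apply]
    rw [Finset.sum_eq_single (φ s₂), Finset.sum_eq_single (e s₂)]
    · by_cases h : s₁ = s₂
      · simp [h]
      · simp [h, Ne.symm h]
    · intro t _ ht; simp [ht]
    · simp
    · intro j _ hj
      exact Finset.sum_eq_zero fun t _ => by simp [hj.symm]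
    · simp)

/-- The outcome that belongs to a Kraus operator of `instrument`. -/
def instrumentOutcome (e : Equiv.Perm (Fin k → Γ)) (φ : (Fin k → Γ) → J)
    (i : Fin (instrument e φ).r) : J := (Fintype.equivFin J).symm i

theorem applyAt_instrument {W : Type} (e : Equiv.Perm (Fin k → Γ))
    (φ : (Fin k → Γ) → J) (i : Fin (instrument e φ).r) (w : Fin k ↪ W) (ψ : QState W Γ) :
    applyAt ((instrument e φ).K i) w ψ =
      Finsupp.mapDomain (fun z => extend w (e (z ∘ w)) z)
        (Finsupp.filter (fun z => φ (z ∘ w) = instrumentOutcome e φ i) ψ) := by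
  have hK : (instrument e φ).K i = instrumentMatrix e φ (instrumentOutcome e φ i) := rfl
  rw [hK]
  generalize instrumentOutcome e φ i = j
  induction ψ using Finsupp.induction_linear with
  | zero => rw [Finsupp.filter_zero, Finsupp.mapDomain_zero, applyAt_zero]
  | add f g hf hg => simp only [applyAt_add, hf, hg, Finsupp.filter_add, Finsupp.mapDomain_add]
  | single c a =>
    rw [applyAt_single, Finset.sum_eq_single (e (c ∘ w))]
    · by_cases h : φ (c ∘ w) = j
      · rw [Finsupp.filter_single_of_pos (fun z => φ (z ∘ w) = j) h, Finsupp.mapDomain_single]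
        simp [instrumentMatrix, h]
      · rw [Finsupp.filter_single_of_neg (fun z => φ (z ∘ w) = j) h, Finsupp.mapDomain_zero]
        simp [instrumentMatrix, h]
    · intro t _ ht
      simp [instrumentMatrix, ht]
    · simp

end QOp

/-! ### Transporting operations along embeddings of basis states -/

section Transfer

variable {V Γ Y : Type} [Fintype V] [DecidableEq V] [Fintype Γ] [DecidableEq Γ] [Fintype Y]
  [DecidableEq Y] {k : ℕ}

/-- A local operator on a finite memory with cells `V`, transported to the space with basis `Y`
along an embedding `ι` of the basis states before, and `ι'` of the basis states after it. -/
def transferMatrix (K : Matrix (Fin k → Γ) (Fin k → Γ) ℂ) (w : Fin k ↪ V)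
    (ι ι' : (V → Γ) ↪ Y) : Matrix Y Y ℂ :=
  Matrix.of fun y' y =>
    ∑ d : V → Γ, ∑ t, if y = ι d ∧ y' = ι' (extend w t d) then K t (d ∘ w) else 0

omit [DecidableEq Γ] [Fintype Y] in
theorem transferMatrix_apply (K : Matrix (Fin k → Γ) (Fin k → Γ) ℂ) (w : Fin k ↪ V)
    (ι ι' : (V → Γ) ↪ Y) (y' : Y) (d : V → Γ) :
    transferMatrix K w ι ι' y' (ι d) =
      ∑ t, if y' = ι' (extend w t d) then K t (d ∘ w) else 0 := by
  rw [transferMatrix, Matrix.of_apply, Finset.sum_eq_single d]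
  · simp
  · intro d' _ hd
    exact Finset.sum_eq_zero fun t _ => by simp [ι.injective.eq_iff, hd.symm]
  · simp

omit [DecidableEq Γ] [Fintype Y] in
theorem transferMatrix_of_notMem (K : Matrix (Fin k → Γ) (Fin k → Γ) ℂ) (w : Fin k ↪ V)
    (ι ι' : (V → Γ) ↪ Y) (y' y : Y) (hy : ∀ d, ι d ≠ y) :
    transferMatrix K w ι ι' y' y = 0 :=
  Finset.sum_eq_zero fun d _ => Finset.sum_eq_zero fun t _ => by simp [(hy d).symm]

omit [Fintype V] [DecidableEq V] [Fintype Γ] [DecidableEq Γ] in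
theorem extend_eq_extend_iff {α : Type} {w : α → V} (hw : Injective w) {t₁ t₂ : α → Γ}
    {d₁ d₂ : V → Γ} :
    extend w t₁ d₁ = extend w t₂ d₂ ↔ t₁ = t₂ ∧ ∀ v, (¬ ∃ a, w a = v) → d₁ v = d₂ v := by
  constructor
  · intro h
    refine ⟨?_, fun v hv => ?_⟩
    · rw [← extend_comp hw t₁ d₁, h, extend_comp hw]
    · have := congrFun h v
      rwa [extend_apply' _ _ _ hv, extend_apply' _ _ _ hv] at this
  · rintro ⟨rfl, h⟩
    funext v
    by_cases hv : ∃ a, w a = v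
    · obtain ⟨a, rfl⟩ := hv
      rw [hw.extend_apply, hw.extend_apply]
    · rw [extend_apply' _ _ _ hv, extend_apply' _ _ _ hv, h v hv]

/-- As `ι' i` is injective, the inner product of two image columns is that of the original ones: it
vanishes unless `d₁` and `d₂` agree off the cells `w`, and is then an entry of `Kᵢ†Kᵢ`. Only columns
with the same `i` are multiplied, so the final embedding may depend on the branch. Summing over `i`
uses the completeness of `U`. -/
theorem sum_transferMatrix (U : QOp Γ k) (w : Fin k ↪ V) (ι : (V → Γ) ↪ Y)
    (ι' : Fin U.r → ((V → Γ) ↪ Y)) (d₁ d₂ : V → Γ) :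
    ∑ i, ∑ y, star (transferMatrix (U.K i) w ι (ι' i) y (ι d₁)) *
      transferMatrix (U.K i) w ι (ι' i) y (ι d₂) = if d₁ = d₂ then 1 else 0 := by
  have key : ∀ i, ∑ y, star (transferMatrix (U.K i) w ι (ι' i) y (ι d₁)) *
      transferMatrix (U.K i) w ι (ι' i) y (ι d₂) =
      if ∀ v, (¬ ∃ a, w a = v) → d₁ v = d₂ v then
        ((U.K i).conjTranspose * U.K i) (d₁ ∘ w) (d₂ ∘ w) else 0 := by
    intro i
    simp only [transferMatrix_apply, star_sum, Finset.sum_mul_sum, Matrix.mul_apply,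
      Matrix.conjTranspose_apply]
    rw [Finset.sum_comm]
    simp_rw [Finset.sum_comm (s := (Finset.univ : Finset Y))]
    have : ∀ t₁ t₂, ∑ y, star (if y = ι' i (extend w t₁ d₁) then U.K i t₁ (d₁ ∘ w) else 0) *
        (if y = ι' i (extend w t₂ d₂) then U.K i t₂ (d₂ ∘ w) else 0) =
        if t₁ = t₂ ∧ ∀ v, (¬ ∃ a, w a = v) → d₁ v = d₂ v then
          star (U.K i t₁ (d₁ ∘ w)) * U.K i t₂ (d₂ ∘ w) else 0 := by
      intro t₁ t₂
      rw [Finset.sum_eq_single (ι' i (extend w t₁ d₁))]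
      · simp only [(ι' i).injective.eq_iff, extend_eq_extend_iff w.injective, if_true]
        split_ifs <;> simp
      · intro y _ hy; simp [hy]
      · simp
    simp_rw [this]
    split_ifs with h
    · refine Finset.sum_congr rfl fun t _ => ?_
      rw [Finset.sum_eq_single t]
      · exact if_pos ⟨rfl, h⟩
      · intro t' _ ht
        exact if_neg fun h' => ht h'.1.symm
      · simp
    · exact Finset.sum_eq_zero fun t _ => Finset.sum_eq_zero fun t' _ => if_neg fun h' => h h'.2
  simp_rw [key]
  have h1 : ∑ i, ((U.K i).conjTranspose * U.K i) (d₁ ∘ w) (d₂ ∘ w) =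
      if d₁ ∘ w = d₂ ∘ w then 1 else 0 := by
    rw [← Matrix.sum_apply, U.complete, Matrix.one_apply]
  by_cases h : ∀ v, (¬ ∃ a, w a = v) → d₁ v = d₂ v
  · rw [Finset.sum_congr rfl fun i _ => if_pos h, h1]
    congr 1
    refine propext ⟨fun hw => ?_, fun hd => hd ▸ rfl⟩
    funext v
    by_cases hv : ∃ a, w a = v
    · obtain ⟨a, rfl⟩ := hv
      exact congrFun hw a
    · exact h v hv
  · rw [Finset.sum_congr rfl fun i _ => if_neg h, Finset.sum_const_zero,
      if_neg fun hd : d₁ = d₂ => h fun v _ => hd ▸ rfl]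

end Transfer

namespace QOp

variable {V Γ Γ' : Type} [Fintype V] [DecidableEq V] [Fintype Γ] [DecidableEq Γ] [Fintype Γ']
  [DecidableEq Γ'] {k l : ℕ}

/-- The operation `U` on a finite memory with cells `V`, transported to `l` cells with another
alphabet; the embedding of the basis states may be changed according to the branch.  Kraus operator
`0` is the projection onto the complement of the encoded states. -/
def transfer (U : QOp Γ k) (w : Fin k ↪ V) (ι : (V → Γ) ↪ (Fin l → Γ'))
    (ι' : Fin U.r → ((V → Γ) ↪ (Fin l → Γ'))) : QOp Γ' l where
  r := U.r + 1
  K := Fin.cons (Matrix.diagonal fun y => if ∀ d, ι d ≠ y then 1 else 0)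
    fun i => transferMatrix (U.K i) w ι (ι' i)
  complete := by
    rw [Fin.sum_univ_succ]
    simp only [Fin.cons_zero, Fin.cons_succ]
    ext y₁ y₂
    rw [Matrix.add_apply, Matrix.diagonal_conjTranspose, Matrix.diagonal_mul_diagonal,
      Matrix.sum_apply, Matrix.one_apply]
    simp only [Matrix.mul_apply, Matrix.conjTranspose_apply, Matrix.diagonal_apply]
    by_cases h₁ : ∀ d, ι d ≠ y₁
    · simp only [transferMatrix_of_notMem _ _ _ _ _ y₁ h₁]
      split_ifs <;> simp_all
    · by_cases h₂ : ∀ d, ι d ≠ y₂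
      · simp only [transferMatrix_of_notMem _ _ _ _ _ y₂ h₂]
        split_ifs <;> simp_all
      · push Not at h₁ h₂
        obtain ⟨d₁, rfl⟩ := h₁
        obtain ⟨d₂, rfl⟩ := h₂
        rw [sum_transferMatrix]
        simp [ι.injective.eq_iff]

variable {W W' : Type} (U : QOp Γ k) (w : Fin k ↪ V) (ι : (V → Γ) ↪ (Fin l → Γ'))
  (ι' : Fin U.r → ((V → Γ) ↪ (Fin l → Γ'))) (loc : V ↪ W) (emb : Fin l ↪ W')
  (pack : (W → Γ) → (W' → Γ')) (hpack : ∀ z, pack z ∘ emb = ι (z ∘ loc))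

-- Kraus operator `0` is there only to make the operation trace preserving; encoded states have no
-- component in its range, so this branch is dead in all applications.
include hpack in
theorem applyAt_transfer_zero (Φ : QState W Γ) :
    applyAt ((transfer U w ι ι').K (0 : Fin (U.r + 1))) emb (Finsupp.mapDomain pack Φ) = 0 := by
  induction Φ using Finsupp.induction_linear with
  | zero => rw [Finsupp.mapDomain_zero, applyAt_zero]
  | add f g hf hg => rw [Finsupp.mapDomain_add, applyAt_add, hf, hg, add_zero]
  | single c a =>
    rw [Finsupp.mapDomain_single, applyAt_single, hpack]
    refine Finset.sum_eq_zero fun t _ => ?_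
    have : (transfer U w ι ι').K (0 : Fin (U.r + 1)) t (ι (c ∘ loc)) = 0 := by
      change Matrix.diagonal _ t (ι (c ∘ loc)) = 0
      rw [Matrix.diagonal_apply]
      split_ifs with h h'
      · exact absurd h.symm (h' _)
      · rfl
      · rfl
    rw [this, mul_zero, Finsupp.single_zero]

-- The hypotheses say that the encoding of the cells `loc` of the large memory is located in the
-- cells `emb`. That `pack'` may differ from `pack` allows an operation to re-encode the memory
-- while acting on it; this is how the register is parked and fetched back.
include hpack in
theorem applyAt_transfer_succ (i : Fin U.r) (pack' : (W → Γ) → (W' → Γ'))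
    (hpack' : ∀ z d, pack' (extend loc d z) = extend emb (ι' i d) (pack z)) (Φ : QState W Γ) :
    applyAt ((transfer U w ι ι').K i.succ) emb (Finsupp.mapDomain pack Φ) =
      Finsupp.mapDomain pack' (applyAt (U.K i) (w.trans loc) Φ) := by
  induction Φ using Finsupp.induction_linear with
  | zero => rw [Finsupp.mapDomain_zero, applyAt_zero, applyAt_zero, Finsupp.mapDomain_zero]
  | add f g hf hg =>
    rw [Finsupp.mapDomain_add, applyAt_add, hf, hg, applyAt_add, Finsupp.mapDomain_add]
  | single c a =>
    rw [Finsupp.mapDomain_single, applyAt_single, applyAt_single, hpack,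
      Finsupp.mapDomain_finsetSum]
    have hK : ∀ t, (transfer U w ι ι').K i.succ t (ι (c ∘ loc)) =
        ∑ s, if t = ι' i (extend w s (c ∘ loc)) then U.K i s (c ∘ loc ∘ w) else 0 :=
      fun t => transferMatrix_apply (U.K i) w ι (ι' i) t (c ∘ loc)
    simp only [hK, Finset.mul_sum, Finsupp.single_finsetSum, Finsupp.mapDomain_single]
    rw [Finset.sum_comm]
    refine Finset.sum_congr rfl fun s _ => ?_
    rw [Finset.sum_eq_single (ι' i (extend w s (c ∘ loc)))]
    · rw [← hpack']
      have : extend loc (extend w s (c ∘ loc)) c = extend (w.trans loc) s c := by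
        funext v
        by_cases hv : ∃ b, loc b = v
        · obtain ⟨b, rfl⟩ := hv
          rw [loc.injective.extend_apply]
          by_cases hb : ∃ a, w a = b
          · obtain ⟨a, rfl⟩ := hb
            rw [w.injective.extend_apply]
            exact ((w.trans loc).injective.extend_apply s c a).symm
          · rw [extend_apply' _ _ _ hb, extend_apply']
            · rfl
            · rintro ⟨a, ha⟩
              exact hb ⟨a, loc.injective ha⟩
        · rw [extend_apply' _ _ _ hv, extend_apply']
          rintro ⟨a, ha⟩
          exact hv ⟨w a, ha⟩
      simp only [this, if_true]
      rfl
    · intro t _ ht; simp [ht]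
    · simp

end QOp

/-! ### Branching runs and their outcomes -/

section Branching

variable {C : Type} {next : C → Multiset C} {answer : C → Option Bool} {weight : C → ℝ}
  {φ : C → Prop}

/-- `after` adds new steps at the end, whereas the simulations proceed by splitting off the first
step. -/
theorem after_succ' (next : C → Multiset C) (c : C) (t : ℕ) :
    after next c (t + 1) = (next c).bind fun c' => after next c' t := by
  induction t with
  | zero => simpa [after] using (Multiset.bind_singleton (next c) id).symm
  | succ t ih =>
    rw [after, ih, Multiset.bind_assoc]
    rfl

/-- After `t` steps from `c`, all branches of nonzero weight have answered and satisfy `φ`, and the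
answer is "yes" with probability `q`. -/
def Outcome (next : C → Multiset C) (answer : C → Option Bool) (weight : C → ℝ) (φ : C → Prop)
    (c : C) (q : ℝ) (t : ℕ) : Prop :=
  (∀ c' ∈ after next c t, weight c' ≠ 0 → answer c' ≠ none ∧ φ c') ∧
    answerProb next answer weight true c t = q

/-- Halted branches stay as they are, and branches of weight zero remain of weight zero. -/
structure Persistent (next : C → Multiset C) (answer : C → Option Bool) (weight : C → ℝ) :
    Prop where
  halted : ∀ c, answer c ≠ none → next c = {c}
  zero : ∀ c, weight c = 0 → ∀ c' ∈ next c, weight c' = 0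

theorem Persistent.after_zero (h : Persistent next answer weight) {c : C} (hc : weight c = 0)
    (t : ℕ) : ∀ c' ∈ after next c t, weight c' = 0 := by
  induction t with
  | zero => simp [after, hc]
  | succ t ih =>
    intro c' hc'
    obtain ⟨d, hd, hd'⟩ := Multiset.mem_bind.mp hc'
    exact h.zero d (ih d hd) c' hd'

namespace Outcome

theorem of_weight_zero (h : Persistent next answer weight) {c : C} (hc : weight c = 0) (t : ℕ) :
    Outcome next answer weight φ c 0 t := by
  refine ⟨fun c' hc' hw => absurd (h.after_zero hc t c' hc') hw, ?_⟩
  refine Multiset.sum_eq_zero fun x hx => ?_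
  obtain ⟨c', hc', rfl⟩ := Multiset.mem_map.mp hx
  rw [h.after_zero hc t c' hc', ite_self]

theorem succ (h : Persistent next answer weight) {c : C} {q : ℝ} {t : ℕ}
    (ho : Outcome next answer weight φ c q t) : Outcome next answer weight φ c q (t + 1) := by
  have key : ∀ d ∈ after next c t, weight d ≠ 0 → next d = {d} :=
    fun d hd hw => h.halted d (ho.1 d hd hw).1
  constructor
  · intro c' hc' hw
    obtain ⟨d, hd, hd'⟩ := Multiset.mem_bind.mp hc'
    have hdw : weight d ≠ 0 := fun h0 => hw (h.zero d h0 c' hd')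
    rw [key d hd hdw, Multiset.mem_singleton] at hd'
    subst hd'
    exact ho.1 c' hd hw
  · rw [← ho.2, answerProb, answerProb, after, Multiset.map_bind, Multiset.sum_bind]
    refine congrArg _ (Multiset.map_congr rfl fun d hd => ?_)
    by_cases hdw : weight d = 0
    · rw [hdw, ite_self]
      refine Multiset.sum_eq_zero fun x hx => ?_
      obtain ⟨c', hc', rfl⟩ := Multiset.mem_map.mp hx
      rw [h.zero d hdw c' hc', ite_self]
    · rw [key d hd hdw, Multiset.map_singleton, Multiset.sum_singleton]

/-- Once all live branches have answered nothing changes, so running times need only be estimated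
from above. -/
theorem mono (h : Persistent next answer weight) {c : C} {q : ℝ} {t t' : ℕ} (ht : t ≤ t')
    (ho : Outcome next answer weight φ c q t) : Outcome next answer weight φ c q t' := by
  induction ht with
  | refl => exact ho
  | step _ ih => exact ih.succ h

theorem imp {φ' : C → Prop} {c : C} {q : ℝ} {t : ℕ}
    (ho : Outcome next answer weight φ c q t) (hφ : ∀ c, φ c → φ' c) :
    Outcome next answer weight φ' c q t :=
  ⟨fun c' hc' hw => ⟨(ho.1 c' hc' hw).1, hφ c' (ho.1 c' hc' hw).2⟩, ho.2⟩

variable {ι : Type} [Fintype ι] {g : ι → C} {c : C} {t : ℕ}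

theorem of_next (hn : next c = Finset.univ.val.map g) {q : ι → ℝ}
    (ho : ∀ i, Outcome next answer weight φ (g i) (q i) t) :
    Outcome next answer weight φ c (∑ i, q i) (t + 1) := by
  constructor
  · intro c' hc'
    rw [after_succ', hn] at hc'
    obtain ⟨d, hd, hd'⟩ := Multiset.mem_bind.mp hc'
    obtain ⟨i, -, rfl⟩ := Multiset.mem_map.mp hd
    exact (ho i).1 c' hd'
  · rw [answerProb, after_succ', hn, Multiset.map_bind, Multiset.sum_bind, Multiset.map_map]
    exact congrArg _ (Multiset.map_congr rfl fun i _ => (ho i).2)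

theorem next_inv (hn : next c = Finset.univ.val.map g) {q : ℝ}
    (ho : Outcome next answer weight φ c q (t + 1)) :
    ∃ q' : ι → ℝ, (∀ i, Outcome next answer weight φ (g i) (q' i) t) ∧ q = ∑ i, q' i := by
  refine ⟨fun i => answerProb next answer weight true (g i) t, fun i => ⟨fun c' hc' => ?_, rfl⟩, ?_⟩
  · refine ho.1 c' ?_
    rw [after_succ', hn]
    exact Multiset.mem_bind.mpr ⟨g i, Multiset.mem_map_of_mem g (Finset.mem_univ_val i), hc'⟩
  · rw [← ho.2, answerProb, after_succ', hn, Multiset.map_bind, Multiset.sum_bind,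
      Multiset.map_map]
    rfl

/-- This treats steps that are deterministic in effect although the instruction branches: Dirac
distributions, and measurements of a definite symbol. -/
theorem of_next_single (h : Persistent next answer weight)
    (hn : next c = Finset.univ.val.map g) (i : ι) {q : ℝ}
    (ho : Outcome next answer weight φ (g i) q t) (h0 : ∀ j, j ≠ i → weight (g j) = 0) :
    Outcome next answer weight φ c q (t + 1) := by
  classical
  have hq : ∀ j, Outcome next answer weight φ (g j) (if j = i then q else 0) t := by
    intro j
    split_ifs with hj
    · exact hj ▸ ho
    · exact of_weight_zero h (h0 j hj) t
  have := of_next hn hq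
  rwa [Finset.sum_ite_eq' Finset.univ i fun _ => q, if_pos (Finset.mem_univ i)] at this

theorem of_next_eq {c' : C} (hn : next c = {c'}) {q : ℝ}
    (ho : Outcome next answer weight φ c' q t) : Outcome next answer weight φ c q (t + 1) := by
  have := of_next (g := fun _ : Unit => c') (c := c) (by rw [hn]; rfl) (fun _ => ho)
  simpa using this

theorem next_eq_inv {c' : C} (hn : next c = {c'}) {q : ℝ}
    (ho : Outcome next answer weight φ c q (t + 1)) : Outcome next answer weight φ c' q t := by
  obtain ⟨q', h1, h2⟩ := next_inv (g := fun _ : Unit => c') (c := c) (by rw [hn]; rfl) ho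
  rw [Fintype.sum_unique] at h2
  exact h2 ▸ h1 ()

theorem of_halted (h : Persistent next answer weight) {b : Bool} (hb : answer c = some b)
    (hφ : φ c) (t : ℕ) : Outcome next answer weight φ c (if b then weight c else 0) t := by
  refine mono h (Nat.zero_le t) ⟨fun c' hc' _ => ?_, ?_⟩
  · rw [Multiset.mem_singleton.mp hc', hb]
    exact ⟨by simp, hφ⟩
  · simp [answerProb, after, hb]

theorem after_eq_of_fixed (hn : next c = {c}) (t : ℕ) : after next c t = {c} := by
  induction t with
  | zero => rfl
  | succ t ih => rw [after, ih, Multiset.singleton_bind, hn]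

/-- A configuration that never moves is its own leaf. This serves halted configurations, and also
generators that hang: these have not answered, so they can occur only with weight zero. -/
theorem fixed_inv (hn : next c = {c}) (hw : weight c ≠ 0) {q : ℝ}
    (ho : Outcome next answer weight φ c q t) :
    φ c ∧ ∃ b, answer c = some b ∧ q = if b then weight c else 0 := by
  have hc : c ∈ after next c t := by rw [after_eq_of_fixed hn]; exact Multiset.mem_singleton_self c
  obtain ⟨h1, h2⟩ := ho.1 c hc hw
  obtain ⟨b, hb⟩ := Option.ne_none_iff_exists'.mp h1
  refine ⟨h2, b, hb, ?_⟩
  rw [← ho.2, answerProb, after_eq_of_fixed hn]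
  simp [hb]

end Outcome

end Branching

/-! ### Steps of the two models -/

namespace QRAM

variable {σ : Type} {M : QRAM σ} {c : M.Cfg}

theorem Cfg.next_of_classical {δ : M.Γ → M.Γ → PMF M.toCore.Action}
    (h : M.prog c.cl.state = .classical δ) :
    c.next = Finset.univ.val.map fun a : M.toCore.Action =>
      (⟨c.cl.act a, (Real.sqrt (δ c.cl.readA c.cl.readC a).toReal : ℂ) • c.psi⟩ : M.Cfg) := by
  rw [Cfg.next, h]

theorem Cfg.next_of_quantum {E : QOp M.Γ 2} {s : M.S} (h : M.prog c.cl.state = .quantum E s) :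
    c.next = Finset.univ.val.map fun i : Fin E.r =>
      (⟨c.cl.goto s, applyAt (E.K i) (regAndCell c.cl.address) c.psi⟩ : M.Cfg) := by
  rw [Cfg.next, h]

theorem Cfg.next_of_measure {f : M.Γ → M.S} (h : M.prog c.cl.state = .measure f) :
    c.next = Finset.univ.val.map fun a : M.Γ =>
      (⟨c.cl.goto (f a), c.psi.filter fun z => z none = a⟩ : M.Cfg) := by
  rw [Cfg.next, h]

theorem Cfg.next_of_halt {b : Bool} (h : M.prog c.cl.state = .halt b) : c.next = {c} := by
  rw [Cfg.next, h]

theorem Cfg.answer_eq_some {b : Bool} : c.answer = some b ↔ M.prog c.cl.state = .halt b := by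
  rw [Cfg.answer]
  cases M.prog c.cl.state <;> simp

theorem Cfg.weight_eq_zero : c.weight = 0 ↔ c.psi = 0 := QState.weight_eq_zero

theorem persistent (M : QRAM σ) :
    Persistent (Cfg.next (M := M)) Cfg.answer Cfg.weight where
  halted c h := by
    obtain ⟨b, hb⟩ := Option.ne_none_iff_exists'.mp h
    exact Cfg.next_of_halt (Cfg.answer_eq_some.mp hb)
  zero c h c' hc' := by
    rw [Cfg.weight_eq_zero] at h ⊢
    cases hp : M.prog c.cl.state with
    | classical δ =>
      rw [Cfg.next_of_classical hp] at hc'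
      obtain ⟨a, -, rfl⟩ := Multiset.mem_map.mp hc'
      exact (congrArg _ h).trans (smul_zero _)
    | quantum E s =>
      rw [Cfg.next_of_quantum hp] at hc'
      obtain ⟨a, -, rfl⟩ := Multiset.mem_map.mp hc'
      exact (congrArg _ h).trans (applyAt_zero _ _)
    | measure f =>
      rw [Cfg.next_of_measure hp] at hc'
      obtain ⟨a, -, rfl⟩ := Multiset.mem_map.mp hc'
      exact (congrArg _ h).trans (Finsupp.filter_zero _)
    | halt b =>
      rw [Cfg.next_of_halt hp, Multiset.mem_singleton] at hc'
      exact hc' ▸ h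

/-- `Outcome` for runs of a quantum RAM machine. -/
abbrev Outcome (c : M.Cfg) (q : ℝ) (t : ℕ) : Prop :=
  QComp.Outcome Cfg.next Cfg.answer Cfg.weight (fun _ => True) c q t

theorem computesInTime_iff {tape : InputTape} {p : List σ → ℝ} {T : ℕ → ℕ} :
    M.ComputesInTime tape p T ↔ ∀ x, Outcome (M.init tape x) (p x) (T x.length) := by
  simp [ComputesInTime, QComp.Outcome]

end QRAM

theorem Circuit.run_append_singleton {W Γ : Type} [Fintype Γ] [DecidableEq Γ] (C : Circuit W Γ)
    (g : Gate W Γ) (ψ : QState W Γ) :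
    Circuit.run (C ++ [g]) ψ = applyAt (g.U.K g.branch) g.wires (C.run ψ) := by
  simp [Circuit.run]

namespace CircuitFamily

variable {σ : Type} {F : CircuitFamily σ} {c : F.Cfg}

/-- The state of the wires on this branch of the run on input `x`. -/
def Cfg.psi (x : List σ) (c : F.Cfg) : QState F.Wire F.Γ := c.circuit.run (F.inputState x)

theorem Cfg.next_of_classical {δ : F.Γ → F.Γ → F.toCore.Action}
    (h : F.prog c.cl.state = .classical δ) :
    c.next =
      {⟨c.cl.act (δ c.cl.readA c.cl.readC), c.operands, c.circuit, c.clock + 1⟩} := by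
  rw [Cfg.next, h]

theorem Cfg.next_of_ancilla {i : Fin F.numAncilla} {s : F.S}
    (h : F.prog c.cl.state = .ancilla i s) :
    c.next = {⟨c.cl.goto s, c.operands ++ [Sum.inl i], c.circuit, c.clock + 1⟩} := by
  rw [Cfg.next, h]

theorem Cfg.next_of_wire {s : F.S} (h : F.prog c.cl.state = .wire s) :
    c.next = {⟨c.cl.goto s, c.operands ++ [Sum.inr c.cl.address], c.circuit, c.clock + 1⟩} := by
  rw [Cfg.next, h]

theorem Cfg.next_of_halt {b : Bool} (h : F.prog c.cl.state = .halt b) : c.next = {c} := by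
  rw [Cfg.next, h]

theorem Cfg.next_of_emit {k : ℕ} {U : QOp F.Γ k} {f : Fin U.r → F.S}
    (h : F.prog c.cl.state = .emit k U f) (w : Fin k ↪ F.Wire) (hw : c.operands = List.ofFn w) :
    c.next = Finset.univ.val.map fun i : Fin U.r =>
      (⟨c.cl.goto (f i), [], c.circuit ++ [⟨k, U, w, i⟩], c.clock + 1⟩ : F.Cfg) := by
  have hc : c.operands.length = k ∧ c.operands.Nodup := by
    rw [hw, List.length_ofFn]
    exact ⟨rfl, List.nodup_ofFn.mpr w.injective⟩
  rw [Cfg.next, h]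
  simp only [dif_pos hc]
  congr! 6
  ext j : 1
  simp [hw]

theorem Cfg.next_of_emit_of_not {k : ℕ} {U : QOp F.Γ k} {f : Fin U.r → F.S}
    (h : F.prog c.cl.state = .emit k U f)
    (hc : ¬ (c.operands.length = k ∧ c.operands.Nodup)) : c.next = {c} := by
  rw [Cfg.next, h]
  simp only [dif_neg hc]

theorem Cfg.answer_eq_some {b : Bool} : c.answer = some b ↔ F.prog c.cl.state = .halt b := by
  rw [Cfg.answer]
  cases F.prog c.cl.state <;> simp

theorem Cfg.weight_eq_zero {x : List σ} : c.weight x = 0 ↔ c.psi x = 0 := QState.weight_eq_zero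

theorem exists_embedding_of_nodup {α : Type} {l : List α} {k : ℕ} (h : l.length = k ∧ l.Nodup) :
    ∃ w : Fin k ↪ α, l = List.ofFn w := by
  obtain ⟨rfl, h⟩ := h
  exact ⟨⟨l.get, List.nodup_iff_injective_get.mp h⟩, by simp⟩

theorem persistent (F : CircuitFamily σ) (x : List σ) :
    Persistent (Cfg.next (F := F)) Cfg.answer (Cfg.weight x) where
  halted c h := by
    obtain ⟨b, hb⟩ := Option.ne_none_iff_exists'.mp h
    exact Cfg.next_of_halt (Cfg.answer_eq_some.mp hb)
  zero c h c' hc' := by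
    cases hp : F.prog c.cl.state with
    | classical δ =>
      rw [Cfg.next_of_classical hp, Multiset.mem_singleton] at hc'
      exact hc' ▸ h
    | ancilla i s =>
      rw [Cfg.next_of_ancilla hp, Multiset.mem_singleton] at hc'
      exact hc' ▸ h
    | wire s =>
      rw [Cfg.next_of_wire hp, Multiset.mem_singleton] at hc'
      exact hc' ▸ h
    | emit k U f =>
      by_cases hc : c.operands.length = k ∧ c.operands.Nodup
      · obtain ⟨w, hw⟩ := exists_embedding_of_nodup hc
        rw [Cfg.next_of_emit hp w hw] at hc'
        obtain ⟨i, -, rfl⟩ := Multiset.mem_map.mp hc'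
        rw [Cfg.weight_eq_zero, Cfg.psi] at h ⊢
        rw [Circuit.run_append_singleton, h, applyAt_zero]
      · rw [Cfg.next_of_emit_of_not hp hc, Multiset.mem_singleton] at hc'
        exact hc' ▸ h
    | halt b =>
      rw [Cfg.next_of_halt hp, Multiset.mem_singleton] at hc'
      exact hc' ▸ h

/-- `Outcome` for the generation of a circuit. -/
abbrev Outcome (x : List σ) (φ : F.Cfg → Prop) (c : F.Cfg) (q : ℝ) (t : ℕ) : Prop :=
  QComp.Outcome Cfg.next Cfg.answer (Cfg.weight x) φ c q t

end CircuitFamily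

namespace QRAM

/-! ### Generating the steps of a quantum RAM machine as gates -/

/-- The states of the generator that simulates `M`. -/
inductive GenState (S Γ : Type) : Type
  | read (s : S)
  | prepare (s : S) (u : Γ)
  | operand (s : S) (u : Γ)
  | emit (s : S) (u : Γ)
  | update (a : S × Γ × Dir)
  deriving Fintype

variable {σ : Type} (M : QRAM σ)

/-- A wire carries a symbol of `T_C` and a symbol of `T_Q`; the third component is for the tally. -/
abbrev wireSymbol (u v : M.Γ) : M.Γ × M.Γ × Bool := (u, v, false)

/-- The symbol on an input wire. -/
def inputSymbol : InputTape → M.Γ → M.Γ × M.Γ × Bool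
  | .classical, a => M.wireSymbol a M.blank
  | .quantum, a => M.wireSymbol M.blank a

theorem inputSymbol_injective (tape : InputTape) : Injective (M.inputSymbol tape) := by
  intro a b h
  cases tape <;> simpa [inputSymbol] using h

theorem inputSymbol_blank (tape : InputTape) :
    M.inputSymbol tape M.blank = M.wireSymbol M.blank M.blank := by
  cases tape <;> rfl

/-- The finite data of the simulating generator. -/
abbrev genCore (tape : InputTape) : Core σ where
  S := GenState M.S M.Γ
  Γ := M.Γ × M.Γ × Bool
  blank := M.wireSymbol M.blank M.blank
  letter := M.letter.trans ⟨M.inputSymbol tape, M.inputSymbol_injective tape⟩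
  letter_ne_blank a h := M.letter_ne_blank a
    (M.inputSymbol_injective tape (h.trans (M.inputSymbol_blank tape).symm))
  radix := M.radix
  two_le_radix := M.two_le_radix
  digit g := M.digit g.1
  digit_lt g := M.digit_lt g.1
  digit_blank := M.digit_blank
  start := .read M.start

/-- The effect of a step on the quantum memory and `T_C`, as an operation on the three cells `R_Q`,
`T_C(T_A)` and `T_Q(T_A)` (in this order). -/
structure LocalStep where
  k : ℕ
  U : QOp M.Γ k
  cells : Fin k ↪ Fin 3
  out : Fin U.r → M.S × M.Γ × Dir

/-- A probabilistic classical step as a quantum operation on `T_C(T_A)`. -/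
def classicalMatrix (δ : M.Γ → PMF M.toCore.Action) (j : M.Γ × M.toCore.Action) :
    Matrix (Fin 1 → M.Γ) (Fin 1 → M.Γ) ℂ :=
  Matrix.of fun t s => if s 0 = j.1 ∧ t 0 = j.2.2.2.1 then
    (Real.sqrt (δ j.1 j.2).toReal : ℂ) else 0

/-- The label `(v, a)` stands for reading `v` on `T_C` and choosing the action `a`. Completeness
holds because for each `v` the probabilities of the actions sum to one. -/
def classicalOp (δ : M.Γ → PMF M.toCore.Action) : QOp M.Γ 1 :=
  QOp.ofKraus (M.classicalMatrix δ) (by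
    ext s₁ s₂
    simp only [Matrix.sum_apply, Matrix.mul_apply, Matrix.conjTranspose_apply, Matrix.one_apply,
      classicalMatrix, Matrix.of_apply]
    have key : ∀ j : M.Γ × M.toCore.Action,
        ∑ t : Fin 1 → M.Γ,
          star (if s₁ 0 = j.1 ∧ t 0 = j.2.2.2.1 then (Real.sqrt (δ j.1 j.2).toReal : ℂ) else 0) *
          (if s₂ 0 = j.1 ∧ t 0 = j.2.2.2.1 then (Real.sqrt (δ j.1 j.2).toReal : ℂ) else 0) =
        if s₁ = s₂ then (if j.1 = s₁ 0 then ((δ (s₁ 0) j.2).toReal : ℂ) else 0) else 0 := by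
      intro j
      rw [Finset.sum_eq_single fun _ => j.2.2.2.1]
      · by_cases hs : s₁ = s₂
        · subst hs
          by_cases hj : j.1 = s₁ 0
          · simp only [hj, and_self, if_true, Complex.star_def, Complex.conj_ofReal]
            rw [← Complex.ofReal_mul, Real.mul_self_sqrt ENNReal.toReal_nonneg]
          · simp [hj, Ne.symm hj]
        · have h0 : s₁ 0 ≠ s₂ 0 := fun h => hs (funext fun i => by
            rw [Subsingleton.elim i 0, h])
          by_cases h1 : s₁ 0 = j.1
          · simp [hs, h1 ▸ h0.symm]
          · simp [hs, h1]
      · intro t _ ht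
        have : t 0 ≠ j.2.2.2.1 := fun h => ht (funext fun i => by rw [Subsingleton.elim i 0, h])
        simp [this]
      · simp
    simp_rw [key]
    by_cases hs : s₁ = s₂
    · rw [Fintype.sum_prod_type]
      simp only [hs, if_true]
      rw [Finset.sum_eq_single (s₂ 0)]
      · simp only [if_true]
        rw [← Complex.ofReal_sum, ← ENNReal.toReal_sum fun a _ => (δ (s₂ 0)).apply_ne_top a,
          ← tsum_fintype (L := .unconditional _), PMF.tsum_coe]
        simp
      · intro v _ hv
        simp [hv]
      · simp
    · simp [hs])

def classicalOutcome (δ : M.Γ → PMF M.toCore.Action) (i : Fin (M.classicalOp δ).r) :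
    M.Γ × M.toCore.Action := (Fintype.equivFin _).symm i

/-- The symbol `u` of `T_A` is known to the generator, so it is a parameter and not a cell; the
symbol of `T_C` has to be measured. The halting case is a placeholder, since the generator halts
before emitting a gate for it. -/
def localStep (s : M.S) (u : M.Γ) : M.LocalStep :=
  match M.prog s with
  | .classical δ => ⟨1, M.classicalOp (δ u), ⟨![1], injective_of_subsingleton _⟩, fun i =>
      let a := (M.classicalOutcome (δ u) i).2
      (a.1, a.2.1, a.2.2.2)⟩
  | .quantum E s' => ⟨2, E, ⟨![0, 2], by decide⟩, fun _ => (s', u, .stay)⟩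
  | .measure f => ⟨1, QOp.instrument 1 fun z => z 0, ⟨![0], injective_of_subsingleton _⟩,
      fun i => (f (QOp.instrumentOutcome 1 (fun z : Fin 1 → M.Γ => z 0) i), u, .stay)⟩
  | .halt _ => ⟨0, QOp.instrument 1 fun _ => (), ⟨![], injective_of_subsingleton _⟩,
      fun _ => (s, u, .stay)⟩

variable (tape : InputTape)

/-- The three cells on the two wires that carry them. -/
def wirePack : (Fin 3 → M.Γ) ↪ (Fin 2 → (genCore M tape).Γ) where
  toFun d := ![M.wireSymbol (d 0) M.blank, M.wireSymbol (d 1) (d 2)]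
  inj' d d' h := by
    have h0 := congrFun h 0
    have h1 := congrFun h 1
    simp at h0 h1
    funext i
    fin_cases i <;> simp [h0, h1]

/-- The circuit family that simulates `M`: every step of `M` is one gate on the ancilla wire, which
is `R_Q`, and on the wire whose number is the address. -/
abbrev toFamily : CircuitFamily σ where
  toCore := genCore M tape
  tally := (M.blank, M.blank, true)
  tally_ne_blank h := by simpa using congrArg (fun g => g.2.2) h
  numAncilla := 1
  prog
    | .read s => match M.prog s with
      | .halt b => .halt b
      -- This changes no tape; it only records the symbol under the head.
      | _ => .classical fun u v => (.prepare s u.1, u, v, .stay)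
    | .prepare s u => .ancilla 0 (.operand s u)
    | .operand s u => .wire (.emit s u)
    | .emit s u => .emit 2
        (QOp.transfer (M.localStep s u).U (M.localStep s u).cells (M.wirePack tape)
          fun _ => M.wirePack tape)
        -- Kraus operator `0` of `transfer` never occurs on encoded states, so its successor state
        -- is arbitrary.
        (Fin.cons (.read s) fun i => .update ((M.localStep s u).out i))
    | .update a => .classical fun _ v => (.read a.1, M.wireSymbol a.2.1 M.blank, v, a.2.2)

/-- The cells of `R_Q`, `T_C` and `T_Q` as one memory. -/
abbrev Memory : Type := Option (ℕ ⊕ ℕ)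

variable {M}

/-- The classical tape becomes a part of the quantum memory that is always in a basis state. -/
def joinMemory (tC : ℕ → M.Γ) (z : Cell → M.Γ) : Memory → M.Γ
  | none => z none
  | some (.inl n) => tC n
  | some (.inr n) => z (some n)

def packMemory (z : Memory → M.Γ) : Fin 1 ⊕ ℕ → (genCore M tape).Γ
  | .inl _ => M.wireSymbol (z none) M.blank
  | .inr n => M.wireSymbol (z (some (.inl n))) (z (some (.inr n)))

def localCells (n : ℕ) : Fin 3 ↪ Memory :=
  ⟨![none, some (.inl n), some (.inr n)], by intro i j; fin_cases i <;> fin_cases j <;> simp⟩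

def localWires (n : ℕ) : Fin 2 ↪ Fin 1 ⊕ ℕ :=
  ⟨![.inl 0, .inr n], by intro i j; fin_cases i <;> fin_cases j <;> simp⟩

theorem coe_localCells (n : ℕ) :
    ⇑(localCells n) = ![none, some (Sum.inl n), some (Sum.inr n)] := rfl

theorem coe_localWires (n : ℕ) : ⇑(localWires n) = ![Sum.inl 0, Sum.inr n] := rfl

theorem coe_wirePack (d : Fin 3 → M.Γ) :
    M.wirePack tape d = ![M.wireSymbol (d 0) M.blank, M.wireSymbol (d 1) (d 2)] := rfl

theorem packMemory_comp (n : ℕ) (z : Memory → M.Γ) :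
    packMemory tape z ∘ localWires n = M.wirePack tape (z ∘ localCells n) := by
  funext i
  fin_cases i <;> rfl

theorem packMemory_extend (n : ℕ) (z : Memory → M.Γ) (d : Fin 3 → M.Γ) :
    packMemory tape (extend (localCells n) d z) =
      extend (localWires n) (M.wirePack tape d) (packMemory tape z) := by
  have h0 : extend (localCells n) d z none = d 0 := (localCells n).injective.extend_apply d z 0
  have h1 : extend (localCells n) d z (some (.inl n)) = d 1 :=
    (localCells n).injective.extend_apply d z 1
  have h2 : extend (localCells n) d z (some (.inr n)) = d 2 :=
    (localCells n).injective.extend_apply d z 2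
  funext i
  rcases i with i | m
  · obtain rfl : i = 0 := Subsingleton.elim _ _
    refine Eq.trans ?_ ((localWires n).injective.extend_apply _ _ 0).symm
    simp [packMemory, h0, coe_wirePack]
  · by_cases hm : m = n
    · subst hm
      refine Eq.trans ?_ ((localWires m).injective.extend_apply _ _ 1).symm
      simp [packMemory, h1, h2, coe_wirePack]
    · have hc : ∀ v, (v = some (Sum.inl m) ∨ v = some (Sum.inr m)) → ¬ ∃ a, localCells n a = v := by
        rintro v hv ⟨a, rfl⟩
        fin_cases a <;> simp [coe_localCells, Ne.symm hm] at hv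
      rw [extend_apply']
      · simp only [packMemory]
        rw [extend_apply' _ _ _ (hc _ (.inl rfl)), extend_apply' _ _ _ (hc _ (.inr rfl))]
      · rintro ⟨a, ha⟩
        fin_cases a <;> simp [coe_localWires, Ne.symm hm] at ha

end QRAM

/-- A relabelling of basis states that carries the cells `w` to `w'` and leaves their contents alone
intertwines the local operators there. It need not be injective. -/
theorem applyAt_mapDomain {W W' Γ : Type} [Fintype Γ] {k : ℕ}
    (K : Matrix (Fin k → Γ) (Fin k → Γ) ℂ) (w : Fin k ↪ W) (w' : Fin k ↪ W')
    (f : (W → Γ) → (W' → Γ)) (h : ∀ z, f z ∘ w' = z ∘ w)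
    (h' : ∀ z t, f (extend w t z) = extend w' t (f z)) (ψ : QState W Γ) :
    applyAt K w' (Finsupp.mapDomain f ψ) = Finsupp.mapDomain f (applyAt K w ψ) := by
  induction ψ using Finsupp.induction_linear with
  | zero => simp only [Finsupp.mapDomain_zero, applyAt_zero]
  | add f g hf hg => simp only [Finsupp.mapDomain_add, applyAt_add, hf, hg]
  | single c a =>
    rw [Finsupp.mapDomain_single, applyAt_single, applyAt_single, Finsupp.mapDomain_finsetSum, h]
    exact Finset.sum_congr rfl fun t _ => by rw [Finsupp.mapDomain_single, h']

theorem filter_mapDomain {α β : Type} (p : β → Prop) [DecidablePred p] (f : α → β) (ψ : α →₀ ℂ) :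
    Finsupp.filter p (Finsupp.mapDomain f ψ) =
      Finsupp.mapDomain f (Finsupp.filter (fun a => p (f a)) ψ) := by
  induction ψ using Finsupp.induction_linear with
  | zero => simp only [Finsupp.mapDomain_zero, Finsupp.filter_zero]
  | add f g hf hg => simp only [Finsupp.mapDomain_add, Finsupp.filter_add, hf, hg]
  | single c a =>
    rw [Finsupp.mapDomain_single]
    by_cases h : p (f c)
    · rw [Finsupp.filter_single_of_pos _ h, Finsupp.filter_single_of_pos (fun a => p (f a)) h,
        Finsupp.mapDomain_single]
    · rw [Finsupp.filter_single_of_neg _ h, Finsupp.filter_single_of_neg (fun a => p (f a)) h,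
        Finsupp.mapDomain_zero]

/-! ### Branches of a machine step as Kraus operators of a gate -/

namespace QRAM

variable {σ : Type} {M : QRAM σ}

theorem joinMemory_injective (tC : ℕ → M.Γ) : Injective (joinMemory tC) := by
  intro z z' h
  funext v
  rcases v with _ | n
  · exact congrFun h none
  · exact congrFun h (some (.inr n))

theorem packMemory_injective (tape : InputTape) : Injective (packMemory (M := M) tape) := by
  intro z z' h
  funext v
  rcases v with _ | n | n
  · exact congrArg Prod.fst (congrFun h (.inl 0))
  · exact congrArg Prod.fst (congrFun h (.inr n))
  · exact congrArg (fun g => g.2.1) (congrFun h (.inr n))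

theorem joinMemory_update (tC : ℕ → M.Γ) (n : ℕ) (a : M.Γ) (z : Cell → M.Γ) :
    joinMemory (update tC n a) z = update (joinMemory tC z) (some (.inl n)) a := by
  funext v
  rcases v with _ | m | m
  · rfl
  · by_cases hm : m = n
    · subst hm; simp [joinMemory]
    · rw [update_of_ne (by simpa using hm)]
      simp [joinMemory, hm]
  · rfl

theorem extend_singleton {W Γ : Type} (w : Fin 1 ↪ W) (t : Fin 1 → Γ) [DecidableEq W] (z : W → Γ) :
    extend w t z = update z (w 0) (t 0) := by
  funext v
  by_cases hv : v = w 0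
  · subst hv
    rw [w.injective.extend_apply, update_self]
  · rw [update_of_ne hv, extend_apply']
    rintro ⟨a, rfl⟩
    exact hv (by rw [Subsingleton.elim a 0])

/-- Since `T_C` is in a basis state, only the labels with the symbol actually present survive. The
remaining ones cause the alternative `φ = 0 ∧ q' i = 0` in `Outcome.localStep`. -/
theorem applyAt_classicalMatrix (δ : M.Γ → PMF M.toCore.Action) (j : M.Γ × M.toCore.Action)
    (w : Fin 1 ↪ Memory) (tC : ℕ → M.Γ) (n : ℕ) (hw : w 0 = some (.inl n))
    (ψ : QState Cell M.Γ) :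
    applyAt (M.classicalMatrix δ j) w (Finsupp.mapDomain (joinMemory tC) ψ) =
      if j.1 = tC n then Finsupp.mapDomain (joinMemory (update tC n j.2.2.2.1))
        ((Real.sqrt (δ (tC n) j.2).toReal : ℂ) • ψ) else 0 := by
  induction ψ using Finsupp.induction_linear with
  | zero =>
    simp only [Finsupp.mapDomain_zero, applyAt_zero, smul_zero, ite_self]
  | add f g hf hg =>
    simp only [Finsupp.mapDomain_add, applyAt_add, hf, hg, smul_add]
    split_ifs <;> simp
  | single c a =>
    have hc : joinMemory tC c (w 0) = tC n := by rw [hw]; rfl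
    rw [Finsupp.mapDomain_single, applyAt_single, Finset.sum_eq_single fun _ => j.2.2.2.1]
    · rw [extend_singleton, hw, ← joinMemory_update]
      by_cases hj : j.1 = tC n
      · rw [if_pos hj, Finsupp.smul_single, Finsupp.mapDomain_single]
        congr 1
        simp [classicalMatrix, hj, hc, mul_comm]
      · simp [classicalMatrix, hj, hc, Ne.symm hj]
    · intro t _ ht
      have : t 0 ≠ j.2.2.2.1 := fun h => ht (funext fun i => by rw [Subsingleton.elim i 0, h])
      simp [classicalMatrix, this]
    · simp

/-- Every branch of a step of `M` is a Kraus operator of the corresponding local step. -/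
theorem Outcome.localStep {c : M.Cfg} {q : ℝ} {t : ℕ} (hc : ∀ b, M.prog c.cl.state ≠ .halt b)
    (ho : Outcome c q (t + 1)) (L : M.LocalStep) (hL : M.localStep c.cl.state c.cl.readA = L) :
    ∃ q' : Fin L.U.r → ℝ, q = ∑ i, q' i ∧ ∀ i, ∃ φ, φ = applyAt (L.U.K i)
        (L.cells.trans (localCells c.cl.address)) (Finsupp.mapDomain (joinMemory c.cl.tC) c.psi) ∧
      ((φ = 0 ∧ q' i = 0) ∨ ∃ c' : M.Cfg, Outcome c' (q' i) t ∧
        φ = Finsupp.mapDomain (joinMemory c'.cl.tC) c'.psi ∧ c'.cl.state = (L.out i).1 ∧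
        c'.cl.tA = update c.cl.tA c.cl.head (L.out i).2.1 ∧
        c'.cl.head = (L.out i).2.2.move c.cl.head) := by
  rw [QRAM.localStep] at hL
  cases hp : M.prog c.cl.state with
  | halt b => exact absurd hp (hc b)
  | classical δ =>
    rw [hp] at hL
    subst hL
    obtain ⟨q', hq', hq⟩ := QComp.Outcome.next_inv (Cfg.next_of_classical hp) ho
    refine ⟨fun i => if (M.classicalOutcome (δ c.cl.readA) i).1 = c.cl.readC then
      q' (M.classicalOutcome (δ c.cl.readA) i).2 else 0, ?_, fun i => ⟨_, rfl, ?_⟩⟩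
    · rw [hq]
      refine Eq.trans ?_ (Equiv.sum_comp (Fintype.equivFin (M.Γ × M.toCore.Action)).symm
        fun j => if j.1 = c.cl.readC then q' j.2 else 0).symm
      refine Eq.symm ((Fintype.sum_prod_type _).trans ?_)
      rw [Finset.sum_eq_single c.cl.readC]
      · simp
      · intro v _ hv; simp [hv]
      · simp
    · have hφ := applyAt_classicalMatrix (δ c.cl.readA) (M.classicalOutcome (δ c.cl.readA) i)
        ((⟨![1], injective_of_subsingleton _⟩ : Fin 1 ↪ Fin 3).trans (localCells c.cl.address))
        c.cl.tC c.cl.address rfl c.psi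
      by_cases hv : (M.classicalOutcome (δ c.cl.readA) i).1 = c.cl.readC
      · right
        refine ⟨⟨c.cl.act (M.classicalOutcome (δ c.cl.readA) i).2, _⟩,
          (by dsimp only; rw [if_pos hv]; exact hq' _), hφ.trans (if_pos hv), rfl, rfl, rfl⟩
      · left
        exact ⟨hφ.trans (if_neg hv), if_neg hv⟩
  | quantum E s =>
    rw [hp] at hL
    subst hL
    obtain ⟨q', hq', hq⟩ := QComp.Outcome.next_inv (Cfg.next_of_quantum hp) ho
    refine ⟨q', hq, fun i => ⟨_, rfl, .inr ⟨_, hq' i, ?_, rfl, ?_, rfl⟩⟩⟩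
    · refine applyAt_mapDomain _ _ _ _ (fun z => ?_) (fun z t => ?_) _
      · funext i
        fin_cases i <;> rfl
      · funext v
        by_cases hv : ∃ i, (Embedding.trans ⟨![0, 2], by decide⟩ (localCells c.cl.address)) i = v
        · obtain ⟨i, rfl⟩ := hv
          rw [Embedding.injective _ |>.extend_apply]
          fin_cases i
          · exact (regAndCell c.cl.address).injective.extend_apply t z 0
          · exact (regAndCell c.cl.address).injective.extend_apply t z 1
        · rw [extend_apply' _ _ _ hv]
          rcases v with _ | n | n
          · exact absurd ⟨0, rfl⟩ hv
          · rfl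
          · simp only [joinMemory]
            rw [extend_apply']
            rintro ⟨i, hi⟩
            fin_cases i
            · exact absurd (show (none : Cell) = some n from hi).symm (Option.some_ne_none n)
            · obtain rfl : c.cl.address = n := Option.some.inj hi
              exact hv ⟨1, rfl⟩
    · exact (update_eq_self _ _).symm
  | measure f =>
    rw [hp] at hL
    subst hL
    obtain ⟨q', hq', hq⟩ := QComp.Outcome.next_inv (Cfg.next_of_measure hp) ho
    refine ⟨fun i => q' (QOp.instrumentOutcome 1 (fun z : Fin 1 → M.Γ => z 0) i), ?_,
      fun i => ⟨_, rfl, .inr ⟨_, hq' _, ?_, rfl, ?_, rfl⟩⟩⟩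
    · rw [hq]
      exact (Equiv.sum_comp (Fintype.equivFin M.Γ).symm q').symm
    · refine (QOp.applyAt_instrument _ _ _ _ _).trans ?_
      simp only [Equiv.Perm.coe_one, id, extend_self_comp (Embedding.injective _),
        filter_mapDomain]
      exact Finsupp.mapDomain_id
    · exact (update_eq_self _ _).symm

end QRAM

theorem Outcome.eq_zero_of_weight {C : Type} {next : C → Multiset C} {answer : C → Option Bool}
    {weight : C → ℝ} {φ : C → Prop} (h : Persistent next answer weight) {c : C} {q : ℝ} {t : ℕ}
    (hc : weight c = 0) (ho : Outcome next answer weight φ c q t) : q = 0 :=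
  ho.2.symm.trans (Outcome.of_weight_zero (φ := φ) h hc t).2

/-- This is the shape of a step made by `QOp.transfer`: outcome `0` is dead, and the others are the
outcomes of the original operation. -/
theorem Outcome.of_next_succ {C : Type} {next : C → Multiset C} {answer : C → Option Bool}
    {weight : C → ℝ} {φ : C → Prop} (h : Persistent next answer weight) {c : C} {r t : ℕ}
    {g : Fin (r + 1) → C} (hn : next c = Finset.univ.val.map g) (h0 : weight (g 0) = 0)
    {q : Fin r → ℝ} (ho : ∀ i, Outcome next answer weight φ (g i.succ) (q i) t) :
    Outcome next answer weight φ c (∑ i, q i) (t + 1) := by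
  have := Outcome.of_next hn (q := Fin.cons (0 : ℝ) q) (t := t) (φ := φ) (answer := answer)
    (weight := weight) (fun i => by
      refine Fin.cases ?_ (fun i => ?_) i
      · exact Outcome.of_weight_zero h h0 t
      · exact ho i)
  rw [Fin.sum_univ_succ] at this
  simpa using this

theorem Core.Cfg.act_stay {σ : Type} {P : Core σ} (c : P.Cfg) (s : P.S) :
    c.act (s, c.readA, c.readC, .stay) = c.goto s := by
  simp [Core.Cfg.act, Core.Cfg.goto, Core.Cfg.readA, Core.Cfg.readC, Dir.move]

/-! ### A family simulates a machine -/

namespace QRAM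

variable {σ : Type} {M : QRAM σ} {tape : InputTape}

/-- The generator `f` is about to simulate the next step of `c`. -/
structure GenSim (x : List σ) (c : M.Cfg) (f : (M.toFamily tape).Cfg) : Prop where
  state : f.cl.state = .read c.cl.state
  tA : f.cl.tA = fun i => M.wireSymbol (c.cl.tA i) M.blank
  head : f.cl.head = c.cl.head
  operands : f.operands = []
  psi : f.psi x =
    Finsupp.mapDomain (packMemory tape) (Finsupp.mapDomain (joinMemory c.cl.tC) c.psi)
  -- A round `read`, `prepare`, `operand`, `emit`, `update` takes five steps and appends one gate.
  clock : f.clock = 5 * f.circuit.length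

theorem GenSim.weight {x : List σ} {c : M.Cfg} {f : (M.toFamily tape).Cfg} (h : GenSim x c f) :
    f.weight x = c.weight := by
  rw [CircuitFamily.Cfg.weight, ← CircuitFamily.Cfg.psi, h.psi,
    QState.weight_mapDomain (packMemory_injective tape),
    QState.weight_mapDomain (joinMemory_injective _), QRAM.Cfg.weight]

/-- The leaves of the simulation of at most `t` steps from `f`. -/
abbrev genLeaf (f : (M.toFamily tape).Cfg) (t : ℕ) (f' : (M.toFamily tape).Cfg) : Prop :=
  f'.circuit.length ≤ f.circuit.length + t ∧ f'.clock ≤ 5 * f'.circuit.length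

theorem GenSim.outcome_of_halted {x : List σ} {t t' : ℕ} {c : M.Cfg} {f : (M.toFamily tape).Cfg}
    {q : ℝ} (h : GenSim x c f) (ho : Outcome c q t) (hc : c.weight ≠ 0 → c.answer ≠ none) :
    CircuitFamily.Outcome x (genLeaf f t) f q t' := by
  by_cases hw : c.weight = 0
  · rw [Outcome.eq_zero_of_weight M.persistent hw ho]
    exact Outcome.of_weight_zero (CircuitFamily.persistent _ x) (h.weight.trans hw) _
  · obtain ⟨b, hb⟩ := Option.ne_none_iff_exists'.mp (hc hw)
    obtain ⟨-, b', hb', rfl⟩ :=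
      QComp.Outcome.fixed_inv (Cfg.next_of_halt (Cfg.answer_eq_some.mp hb)) hw ho
    rw [← h.weight]
    refine Outcome.of_halted (CircuitFamily.persistent _ x) ?_ ⟨Nat.le_add_right _ _, h.clock.le⟩ _
    rw [CircuitFamily.Cfg.answer_eq_some, h.state]
    simp only [Cfg.answer_eq_some.mp hb']

/-- The gate that simulates a step. -/
abbrev stepGate (M : QRAM σ) (tape : InputTape) (s : M.S) (u : M.Γ) :
    QOp (genCore M tape).Γ 2 :=
  QOp.transfer (M.localStep s u).U (M.localStep s u).cells (M.wirePack tape)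
    fun _ => M.wirePack tape

theorem next_of_emit {f : (M.toFamily tape).Cfg} {s : M.S} {u : M.Γ}
    (hs : f.cl.state = .emit s u) {n : ℕ} (hf : f.operands = [Sum.inl 0, Sum.inr n]) :
    f.next = (Finset.univ : Finset (Fin ((M.localStep s u).U.r + 1))).val.map fun i =>
      (⟨f.cl.goto (Fin.cons (α := fun _ => GenState M.S M.Γ) (.read s)
        (fun i => .update ((M.localStep s u).out i)) i), [],
        f.circuit ++ [⟨2, M.stepGate tape s u, localWires n, i⟩], f.clock + 1⟩ :
          (M.toFamily tape).Cfg) := by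
  have hp : (M.toFamily tape).prog f.cl.state = .emit 2 (M.stepGate tape s u)
      (Fin.cons (α := fun _ => GenState M.S M.Γ) (.read s)
        fun i => .update ((M.localStep s u).out i)) := by
    rw [hs]
    rfl
  exact CircuitFamily.Cfg.next_of_emit hp (localWires n) hf

theorem GenSim.address {x : List σ} {c : M.Cfg} {f : (M.toFamily tape).Cfg} (h : GenSim x c f) :
    f.cl.address = c.cl.address := by
  rw [Core.Cfg.address, Core.Cfg.address, h.tA]

theorem GenSim.outcome {x : List σ} {t : ℕ} : ∀ {c : M.Cfg} {f : (M.toFamily tape).Cfg} {q : ℝ},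
    GenSim x c f → Outcome c q t →
      CircuitFamily.Outcome x (genLeaf f t) f q (5 * t) := by
  induction t with
  | zero =>
    intro c f q h ho
    exact h.outcome_of_halted ho fun hw => (ho.1 c (Multiset.mem_singleton_self c) hw).1
  | succ t ih =>
    intro c f q h ho
    by_cases hb : c.answer = none
    · replace hb : ∀ b, M.prog c.cl.state ≠ .halt b := fun b hp => by
        rw [Cfg.answer_eq_some.mpr hp] at hb
        exact absurd hb (Option.some_ne_none b)
      obtain ⟨q', rfl, hL⟩ := ho.localStep hb _ rfl
      have hp₁ : (M.toFamily tape).prog f.cl.state =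
          .classical fun u v => (.prepare c.cl.state u.1, u, v, .stay) := by
        rw [h.state]
        cases hp : M.prog c.cl.state with
        | halt b => exact absurd hp (hb b)
        | _ => simp only [hp]
      have hn₁ := CircuitFamily.Cfg.next_of_classical hp₁
      rw [Core.Cfg.act_stay] at hn₁
      have hu : f.cl.readA.1 = c.cl.readA := by
        rw [Core.Cfg.readA, h.tA, h.head]
        rfl
      rw [hu, h.operands] at hn₁
      refine Outcome.of_next_eq hn₁ ?_
      refine Outcome.of_next_eq (CircuitFamily.Cfg.next_of_ancilla (i := 0) rfl) ?_
      refine Outcome.of_next_eq (CircuitFamily.Cfg.next_of_wire rfl) ?_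
      have ha : ∀ s s', ((f.cl.goto s).goto s').address = c.cl.address := fun _ _ => h.address
      rw [ha]
      -- Outcome `0` of the gate is dead, and outcome `i.succ` is Kraus operator `i` of the local
      -- step.
      refine Outcome.of_next_succ (CircuitFamily.persistent _ x)
        (next_of_emit (s := c.cl.state) (u := c.cl.readA) (n := c.cl.address) rfl rfl)
        ?_ fun i => ?_
      · rw [CircuitFamily.Cfg.weight_eq_zero, CircuitFamily.Cfg.psi,
          Circuit.run_append_singleton]
        refine (congrArg _ h.psi).trans ?_
        exact QOp.applyAt_transfer_zero _ _ _ _ _ _ _ (packMemory_comp tape c.cl.address) _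
      · obtain ⟨φ, hφ, hcase⟩ := hL i
        have hpsi : ∀ cl op k, CircuitFamily.Cfg.psi (F := M.toFamily tape) x ⟨cl, op,
            f.circuit ++ [⟨2, M.stepGate tape c.cl.state c.cl.readA,
              localWires c.cl.address, i.succ⟩], k⟩ =
            Finsupp.mapDomain (packMemory tape) φ := by
          intro cl op k
          rw [CircuitFamily.Cfg.psi, Circuit.run_append_singleton, hφ]
          refine (congrArg _ h.psi).trans ?_
          exact QOp.applyAt_transfer_succ _ _ _ _ _ _ _ (packMemory_comp tape c.cl.address) _ _
            (packMemory_extend tape c.cl.address) _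
        rcases hcase with ⟨rfl, hq⟩ | ⟨c', hc', h₁, h₂, h₃, h₄⟩
        · rw [hq]
          refine Outcome.of_weight_zero (CircuitFamily.persistent _ x) ?_ _
          rw [CircuitFamily.Cfg.weight_eq_zero]
          exact (hpsi _ _ _).trans Finsupp.mapDomain_zero
        · refine Outcome.of_next_eq (CircuitFamily.Cfg.next_of_classical rfl) ?_
          refine (ih (c := c') ?_ hc').imp ?_
          · refine ⟨?_, ?_, ?_, rfl, (hpsi _ _ _).trans (congrArg _ h₁), ?_⟩
            · rw [h₂]
              rfl
            · funext n
              change update f.cl.tA f.cl.head _ n = _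
              rw [h.tA, h.head, h₃]
              by_cases hn : n = c.cl.head
              · subst hn
                simp only [update_self]
              · simp only [update_of_ne hn]
            · rw [h₄, ← h.head]
              rfl
            · simp only [List.length_append, List.length_singleton, h.clock]
              lia
          · rintro f' ⟨hl, hk⟩
            refine ⟨hl.trans ?_, hk⟩
            simp only [List.length_append, List.length_singleton]
            lia
    · exact h.outcome_of_halted ho fun _ => hb

/-- The initial contents of `T_C`. -/
def initWork (M : QRAM σ) : InputTape → List σ → ℕ → M.Γ
  | .classical, x => M.wordTape x
  | .quantum, _ => fun _ => M.blank

/-- The initial contents of `R_Q` and `T_Q`. -/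
def initCells (M : QRAM σ) : InputTape → List σ → Cell → M.Γ
  | .classical, _ => fun _ => M.blank
  | .quantum, x => fun w => w.elim M.blank (M.wordTape x)

theorem init_eq (M : QRAM σ) (tape : InputTape) (x : List σ) :
    M.init tape x = ⟨⟨M.start, fun _ => M.blank, 0, M.initWork tape x⟩,
      Finsupp.single (M.initCells tape x) 1⟩ := by
  cases tape <;> rfl

theorem genSim_init (M : QRAM σ) (tape : InputTape) (x : List σ) :
    GenSim x (M.init tape x) ((M.toFamily tape).init x.length) where
  state := by rw [init_eq]; rfl
  tA := by rw [init_eq]; rfl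
  head := by rw [init_eq]; rfl
  operands := rfl
  clock := rfl
  psi := by
    have hw : ∀ n, (genCore M tape).wordTape x n = M.inputSymbol tape (M.wordTape x n) := by
      intro n
      rw [Core.wordTape, Core.wordTape]
      cases x[n]? with
      | none => exact (M.inputSymbol_blank tape).symm
      | some a => rfl
    rw [init_eq, Finsupp.mapDomain_single, Finsupp.mapDomain_single]
    change Finsupp.single _ _ = _
    congr 1
    funext v
    rcases v with v | n
    · cases tape <;> rfl
    · refine (hw n).trans ?_
      cases tape <;> rfl

/-- A quantum RAM machine is simulated by a uniform family with one gate for every step. -/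
theorem ComputesInTime.toFamily {p : List σ → ℝ} {T : ℕ → ℕ} (h : M.ComputesInTime tape p T) :
    (M.toFamily tape).Uniform ∧ (M.toFamily tape).ComputesWithGates p T := by
  rw [computesInTime_iff] at h
  have key := fun x => (genSim_init M tape x).outcome (h x)
  refine ⟨⟨5, fun x => ⟨_, fun c hc hw => ⟨((key x).1 c hc hw).1, ?_⟩⟩⟩, fun x => ⟨_, ?_, (key x).2⟩⟩
  · exact ((key x).1 c hc hw).2.2.trans (by lia)
  · exact fun c hc hw => ⟨((key x).1 c hc hw).1, ((key x).1 c hc hw).2.1.trans_eq (Nat.zero_add _)⟩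

end QRAM

/-! ### The quantum RAM machine that runs a circuit family -/

/-- Tape symbols of the simulating machine.  On `T_A`: current symbol, symbol at the last gate,
visited since then, position of the head at the last gate.  On `T_C`: symbol at the last gate,
current symbol, known, written since the last gate.  On `T_Q`: the wire, and the register if it is
parked there.  In `R_Q`: the register, or an outcome in `main` or `out`. -/
@[ext] structure Sym (S Γ R : Type) : Type where
  main : Γ
  alt : Γ
  flag₁ : Bool
  flag₂ : Bool
  reg : R → Γ
  out : S

theorem Sym.finite (S Γ R : Type) [Finite S] [Finite Γ] [Finite R] : Finite (Sym S Γ R) :=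
  Finite.of_injective
    (fun y : Sym S Γ R => (y.main, y.alt, y.flag₁, y.flag₂, y.reg, y.out)) fun y z h => by
      simp only [Prod.mk.injEq] at h
      exact Sym.ext h.1 h.2.1 h.2.2.1 h.2.2.2.1 h.2.2.2.2.1 h.2.2.2.2.2

/-- What the control remembers of a pass: whether it is the second pass, the state at the end of
the other pass, the state of the generator, and the number of operands up to `K`. -/
abbrev Pass (S : Type) (K : ℕ) : Type := Bool × S × S × Fin (K + 1)

/-- Quantum operations on `R_Q` and `T_Q(T_A)` that the simulating machine makes use of. -/
inductive Job (S Γ : Type) (m K : ℕ) : Type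
  /-- undo the exchange of `v` and blank and find out what is on the input wire -/
  | probe (v : Γ) (x : Pass S K)
  /-- swap slot `i` with an ancilla or with the wire at the current address -/
  | swap (p : Option (Fin m)) (i : Fin K) (x : Pass S K)
  /-- the gate of the generator state `s`, on the slots -/
  | gate (s₀ s : S)
  deriving Fintype

/-- States of the simulating machine. -/
inductive SimState (S Γ Y : Type) (m K : ℕ) : Type
  | begin (s : S)
  | run (x : Pass S K)
  | apply (o : Job S Γ m K)
  | measure (o : Job S Γ m K)
  | unpark (o : Job S Γ m K) (y : Y)
  | store (a : Γ) (x : Pass S K)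
  | mark (s₀ s₁ : S)
  | right (s₀ s₁ : S)
  | left (s₀ s₁ : S)
  | find (s₀ s₁ : S)
  | halt (b : Bool)
  deriving Fintype

namespace CircuitFamily

variable {σ : Type} (F : CircuitFamily σ)

def arity (s : F.S) : ℕ :=
  match F.prog s with
  | .emit k _ _ => k
  | _ => 0

def maxArity : ℕ := Finset.univ.sup F.arity

theorem arity_le (s : F.S) : F.arity s ≤ F.maxArity := Finset.le_sup (Finset.mem_univ s)

theorem le_maxArity {s : F.S} {k : ℕ} {U : QOp F.Γ k} {f : Fin U.r → F.S}
    (h : F.prog s = .emit k U f) : k ≤ F.maxArity := by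
  have := F.arity_le s
  rwa [arity, h] at this

/-- The cells of the register: the ancillas, and slots for the operands of a gate. -/
abbrev Reg : Type := Fin F.numAncilla ⊕ Fin F.maxArity

abbrev Y : Type := Sym F.S F.Γ F.Reg

instance : Fintype F.Y := @Fintype.ofFinite _ (Sym.finite _ _ _)

instance : DecidableEq F.Y := Classical.decEq _

abbrev blankY : F.Y := ⟨F.blank, F.blank, false, false, fun _ => F.blank, F.start⟩

abbrev regY (g : F.Reg → F.Γ) : F.Y := { F.blankY with reg := g }

abbrev cellY (a : F.Γ) (g : F.Reg → F.Γ) : F.Y := { F.blankY with main := a, reg := g }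

abbrev SimS : Type := SimState F.S F.Γ F.Y F.numAncilla F.maxArity

abbrev simCore : Core σ where
  S := F.SimS
  Γ := F.Y
  blank := F.blankY
  letter := ⟨fun a => { F.blankY with main := F.letter a }, fun _ _ h =>
    F.letter.injective (congrArg Sym.main h)⟩
  letter_ne_blank a h := F.letter_ne_blank a (congrArg Sym.main h)
  radix := F.radix
  two_le_radix := F.two_le_radix
  digit y := F.digit y.main
  digit_lt y := F.digit_lt y.main
  digit_blank := F.digit_blank
  start := .begin F.start

/-- A quantum operation on the register and the current wire, with a symbol for every outcome. -/
structure LocalJob where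
  k : ℕ
  U : QOp F.Γ k
  cells : Fin k ↪ Option F.Reg
  out : Fin U.r → F.Y

/-- The permutation of the states of one cell given by a permutation of the symbols. -/
def cellPerm {Γ : Type} (e : Equiv.Perm Γ) : Equiv.Perm (Fin 1 → Γ) :=
  Equiv.arrowCongr (Equiv.refl _) e

/-- The swap of two cells. -/
def swapPerm (Γ : Type) : Equiv.Perm (Fin 2 → Γ) :=
  Equiv.arrowCongr (Equiv.swap 0 1) (Equiv.refl _)

def slots {k : ℕ} (h : k ≤ F.maxArity) : Fin k ↪ Option F.Reg :=
  ⟨fun i => some (.inr (Fin.castLE h i)), fun i j hij => by simpa using hij⟩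

/-- The cell `none` is the wire at the current address. The swap has a single outcome. The last case
is a placeholder: a gate job is created only in a state that emits a gate. -/
def localJob : Job F.S F.Γ F.numAncilla F.maxArity → F.LocalJob
  | .probe v _ => ⟨1, QOp.instrument (cellPerm (Equiv.swap F.blank v))
      (fun z => Equiv.swap F.blank v (z 0)), ⟨![none], injective_of_subsingleton _⟩, fun i =>
        { F.blankY with main := QOp.instrumentOutcome _ _ i }⟩
  | .swap p i _ => ⟨2, QOp.instrument (swapPerm F.Γ) fun _ => (),
      ⟨![some (.inr i), p.map .inl], by
        intro a b
        fin_cases a <;> fin_cases b <;> cases p <;> simp⟩, fun _ => F.blankY⟩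
  | .gate _ s => match h : F.prog s with
    | .emit k U f => ⟨k, U, F.slots (F.le_maxArity h), fun i => { F.blankY with out := f i }⟩
    | _ => ⟨0, QOp.instrument 1 fun _ => (), F.slots (Nat.zero_le _), fun _ => F.blankY⟩

/-- The state after a job with outcome `y`. -/
def afterJob (y : F.Y) : Job F.S F.Γ F.numAncilla F.maxArity → F.SimS
  | .probe _ x => .store y.main x
  | .swap _ _ x => .run x
  | .gate s₀ _ => .mark s₀ y.out

/-- The register in `R_Q` and the wire in the cell. -/
def regCell : (Option F.Reg → F.Γ) ↪ (Fin 2 → F.Y) where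
  toFun d := ![F.regY fun p => d (some p), F.cellY (d none) fun _ => F.blank]
  inj' d d' h := by
    have h0 := congrArg Sym.reg (congrFun h 0)
    have h1 := congrArg Sym.main (congrFun h 1)
    funext p
    rcases p with _ | p
    · exact h1
    · exact congrFun h0 p

/-- An outcome `y` in `R_Q`, the register parked with the wire. -/
def parkedCell (y : F.Y) : (Option F.Reg → F.Γ) ↪ (Fin 2 → F.Y) where
  toFun d := ![y, F.cellY (d none) fun p => d (some p)]
  inj' d d' h := by
    have h0 := congrArg Sym.reg (congrFun h 1)
    have h1 := congrArg Sym.main (congrFun h 1)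
    funext p
    rcases p with _ | p
    · exact h1
    · exact congrFun h0 p

/-- The identity, as an operation on no cells. -/
def idOp (Γ : Type) [Fintype Γ] [DecidableEq Γ] : QOp Γ 0 where
  r := 1
  K _ := 1
  complete := by simp

/-- Afterwards `R_Q` contains nothing but the outcome, and the register waits next to the wire, out
of reach of the measurement. -/
def jobOp (o : Job F.S F.Γ F.numAncilla F.maxArity) : QOp F.Y 2 :=
  QOp.transfer (F.localJob o).U (F.localJob o).cells F.regCell
    fun i => F.parkedCell ((F.localJob o).out i)

/-- Nothing but the encoding is changed. -/
def unparkOp (y : F.Y) : QOp F.Y 2 :=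
  QOp.transfer (idOp F.Γ) (F.slots (Nat.zero_le _)) (F.parkedCell y) fun _ => F.regCell

/-- A classical step of the generator; naming an operand does not change the tapes. -/
def action (s : F.S) (u v : F.Γ) : F.toCore.Action :=
  match F.prog s with
  | .classical δ => δ u v
  | .ancilla _ s' => (s', u, v, .stay)
  | .wire s' => (s', u, v, .stay)
  | _ => (s, u, v, .stay)

/-- The operand named by a state: `some none` is the wire at the current address. -/
def operandOf (s : F.S) : Option (Option (Fin F.numAncilla)) :=
  match F.prog s with
  | .ancilla i _ => some (some i)
  | .wire _ => some none
  | _ => none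

/-- In the first pass the symbol of the last gate is saved at the first visit only; the second pass
need not save anything. -/
def writeA (redo : Bool) (u : F.Y) (a : F.Γ) : F.Y :=
  if redo then { u with main := a }
  else { u with main := a, alt := if u.flag₁ then u.alt else u.main, flag₁ := true }

/-- Random access rules out restoring `T_C` by a sweep. So the first pass leaves `main` as it was at
the last gate and writes to `alt`, while the second pass works on `main` and clears `flag₂`. Both
passes write in the same cells, so in the end no cell is flagged. -/
def readWork (redo : Bool) (v : F.Y) : F.Γ :=
  if redo then v.main else if v.flag₂ then v.alt else v.main

def writeWork (redo : Bool) (v : F.Y) (a : F.Γ) : F.Y :=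
  if redo then { v with main := a, flag₂ := false } else { v with alt := a, flag₂ := true }

/-- The state after a classical step or the naming of an operand. -/
def afterStep (x : Pass F.S F.maxArity) (s' : F.S) : F.SimS :=
  match F.operandOf x.2.2.1 with
  | none => .run (x.1, x.2.1, s', x.2.2.2)
  | some p =>
    -- With more operands than slots the generator can no longer emit a gate, so surplus operands
    -- may be ignored.
    if h : x.2.2.2.val < F.maxArity then
      .apply (.swap p ⟨x.2.2.2, h⟩ (x.1, x.2.1, s', ⟨x.2.2.2 + 1, by lia⟩))
    else .run (x.1, x.2.1, s', x.2.2.2)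

/-- The current cell must be known before anything else is done. The component `x.2.1` is the state
at the last gate in the first pass, to be returned to, and the state after the new gate in the
second pass, to continue from. -/
def runAction (x : Pass F.S F.maxArity) (u v : F.Y) : F.SimS × F.Y × F.Y × Dir :=
  if v.flag₁ then
    match F.prog x.2.2.1 with
    | .emit _ _ _ => (if x.1 then .begin x.2.1 else .apply (.gate x.2.1 x.2.2.1), u, v, .stay)
    | .halt b => (.halt b, u, v, .stay)
    | _ =>
      let a := F.action x.2.2.1 u.main (F.readWork x.1 v)
      (F.afterStep x a.1, F.writeA x.1 u a.2.1, F.writeWork x.1 v a.2.2.1, a.2.2.2)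
  else (.apply (.probe v.main x), u, v, .stay)

/-- The machine that simulates `F`.  Between two gates it runs the generator twice: first it
collects the operands in the slots, and after the gate it goes back, and returns them. -/
abbrev simulator : QRAM σ where
  toCore := F.simCore
  prog
    | .begin s => .classical fun u v => PMF.pure
        (.run (false, s, s, 0), { u with alt := u.main, flag₁ := true, flag₂ := true }, v, .stay)
    | .run x => .classical fun u v => PMF.pure (F.runAction x u v)
    | .apply o => .quantum (F.jobOp o) (.measure o)
    | .measure o => .measure fun y => .unpark o y
    | .unpark o y => .quantum (F.unparkOp y) (F.afterJob y o)
    | .store a x => .classical fun u v => PMF.pure (.run x, u,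
        -- The generator is to see `1^n`, so a letter is recorded as a tally mark.
        { v with main := if a = F.blank then F.blank else F.tally, flag₁ := true }, .stay)
    | .mark s₀ s₁ => .classical fun u v => PMF.pure (.right s₀ s₁,
        { u with alt := if u.flag₁ then u.alt else u.main, flag₁ := true }, v, .stay)
    | .right s₀ s₁ => .classical fun u v => PMF.pure
        (if u.flag₁ then (.right s₀ s₁, u, v, .right) else (.left s₀ s₁, u, v, .left))
    | .left s₀ s₁ => .classical fun u v => PMF.pure
        (if u.flag₁ then (.left s₀ s₁, { u with main := u.alt, flag₁ := false }, v, .left)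
        else (.find s₀ s₁, u, v, .stay))
    | .find s₀ s₁ => .classical fun u v => PMF.pure
        (if u.flag₂ then (.run (true, s₁, s₀, 0), { u with flag₂ := false }, v, .stay)
        else (.find s₀ s₁, u, v, .right))
    | .halt b => .halt b

end CircuitFamily

theorem QRAM.next_of_pure {σ : Type} {M : QRAM σ} {c : M.Cfg}
    {g : M.Γ → M.Γ → M.toCore.Action}
    (h : M.prog c.cl.state = .classical fun u v => PMF.pure (g u v)) {q : ℝ} {t : ℕ}
    (ho : QRAM.Outcome (M := M) ⟨c.cl.act (g c.cl.readA c.cl.readC), c.psi⟩ q t) :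
    QRAM.Outcome c q (t + 1) := by
  refine Outcome.of_next_single M.persistent (QRAM.Cfg.next_of_classical h)
    (g c.cl.readA c.cl.readC) ?_ fun a ha => ?_
  · simpa using ho
  · rw [QRAM.Cfg.weight_eq_zero]
    simp [PMF.pure_apply, ha]

theorem QRAM.next_of_transfer {σ : Type} {M : QRAM σ} {V Γ : Type} [Fintype V] [DecidableEq V]
    [Fintype Γ] [DecidableEq Γ] {k : ℕ} {U : QOp Γ k} {w : Fin k ↪ V}
    {ι : (V → Γ) ↪ (Fin 2 → M.Γ)} {ι' : Fin U.r → ((V → Γ) ↪ (Fin 2 → M.Γ))}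
    {W : Type} {loc : V ↪ W} {e : M.toCore.Cfg} {s : M.S} {pack : (W → Γ) → QRAM.Cell → M.Γ}
    {pack' : Fin U.r → (W → Γ) → QRAM.Cell → M.Γ}
    (h : M.prog e.state = .quantum (QOp.transfer U w ι ι') s)
    (hpack : ∀ z, pack z ∘ QRAM.regAndCell e.address = ι (z ∘ loc))
    (hpack' : ∀ i z d, pack' i (extend loc d z) =
      extend (QRAM.regAndCell e.address) (ι' i d) (pack z)) {Φ : QState W Γ}
    {q : Fin U.r → ℝ} {t : ℕ} (ho : ∀ i, QRAM.Outcome (M := M)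
      ⟨e.goto s, Finsupp.mapDomain (pack' i) (applyAt (U.K i) (w.trans loc) Φ)⟩ (q i) t) :
    QRAM.Outcome (M := M) ⟨e, Finsupp.mapDomain pack Φ⟩ (∑ i, q i) (t + 1) := by
  have hn : QRAM.Cfg.next (M := M) ⟨e, Finsupp.mapDomain pack Φ⟩ =
      (Finset.univ : Finset (Fin (U.r + 1))).val.map fun i =>
        ⟨e.goto s, applyAt ((QOp.transfer U w ι ι').K i) (QRAM.regAndCell e.address)
          (Finsupp.mapDomain pack Φ)⟩ :=
    QRAM.Cfg.next_of_quantum (c := ⟨e, _⟩) (E := QOp.transfer U w ι ι') h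
  refine Outcome.of_next_succ M.persistent hn ?_ fun i => ?_
  · rw [QRAM.Cfg.weight_eq_zero]
    exact QOp.applyAt_transfer_zero _ _ _ _ _ _ _ hpack _
  · rw [QOp.applyAt_transfer_succ U w ι ι' loc _ pack hpack i (pack' i) (hpack' i)]
    exact ho i

/-! ### Parking the register to measure an outcome -/

namespace CircuitFamily

variable {σ : Type} {F : CircuitFamily σ}

/-- The positions for symbols of `F` in the simulating machine: the register, and the cells of
`T_Q`. -/
abbrev Pos (F : CircuitFamily σ) : Type := F.Reg ⊕ ℕ

def pack (z : F.Pos → F.Γ) : QRAM.Cell → F.Y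
  | none => F.regY fun p => z (.inl p)
  | some n => F.cellY (z (.inr n)) fun _ => F.blank

def packParked (y : F.Y) (a : ℕ) (z : F.Pos → F.Γ) : QRAM.Cell → F.Y
  | none => y
  | some n => F.cellY (z (.inr n)) (if n = a then fun p => z (.inl p) else fun _ => F.blank)

def here (a : ℕ) : Option F.Reg ↪ F.Pos :=
  ⟨fun p => p.elim (.inr a) .inl, by rintro (_ | p) (_ | p') h <;> simp_all⟩

theorem pack_injective : Injective (pack (F := F)) := by
  intro z z' h
  funext p
  rcases p with p | n
  · exact congrFun (congrArg Sym.reg (congrFun h none)) p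
  · exact congrArg Sym.main (congrFun h (some n))

theorem extend_here (a : ℕ) (d : Option F.Reg → F.Γ) (z : F.Pos → F.Γ) :
    (∀ p, extend (here a) d z (.inl p) = d (some p)) ∧ extend (here a) d z (.inr a) = d none ∧
      ∀ n, n ≠ a → extend (here a) d z (.inr n) = z (.inr n) := by
  refine ⟨fun p => (here a).injective.extend_apply d z (some p),
    (here a).injective.extend_apply d z none, fun n hn => extend_apply' _ _ _ ?_⟩
  rintro ⟨_ | p, hp⟩
  · exact hn (Sum.inr.inj hp).symm
  · exact absurd hp Sum.inl_ne_inr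

theorem extend_regAndCell {Y : Type} (a : ℕ) (d : Fin 2 → Y) (z : QRAM.Cell → Y) :
    extend (QRAM.regAndCell a) d z none = d 0 ∧ extend (QRAM.regAndCell a) d z (some a) = d 1 ∧
      ∀ n, n ≠ a → extend (QRAM.regAndCell a) d z (some n) = z (some n) := by
  refine ⟨(QRAM.regAndCell a).injective.extend_apply d z 0,
    (QRAM.regAndCell a).injective.extend_apply d z 1, fun n hn => extend_apply' _ _ _ ?_⟩
  rintro ⟨i, hi⟩
  fin_cases i
  · exact absurd hi.symm (Option.some_ne_none n)
  · exact hn (Option.some.inj hi).symm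

theorem pack_comp (a : ℕ) (z : F.Pos → F.Γ) :
    pack z ∘ QRAM.regAndCell a = F.regCell (z ∘ here a) := by
  funext i
  fin_cases i <;> rfl

theorem packParked_comp (y : F.Y) (a : ℕ) (z : F.Pos → F.Γ) :
    packParked y a z ∘ QRAM.regAndCell a = F.parkedCell y (z ∘ here a) := by
  funext i
  fin_cases i
  · rfl
  · change F.cellY _ (if a = a then _ else _) = F.cellY _ _
    rw [if_pos rfl]
    rfl

theorem packParked_extend (y : F.Y) (a : ℕ) (z : F.Pos → F.Γ) (d : Option F.Reg → F.Γ) :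
    packParked y a (extend (here a) d z) =
      extend (QRAM.regAndCell a) (F.parkedCell y d) (pack z) := by
  obtain ⟨h1, h2, h3⟩ := extend_here a d z
  obtain ⟨g1, g2, g3⟩ := extend_regAndCell a (F.parkedCell y d) (pack z)
  funext v
  rcases v with _ | n
  · exact g1.symm
  · by_cases hn : n = a
    · subst hn
      rw [g2, packParked, h2, if_pos rfl]
      simp only [h1]
      rfl
    · rw [g3 n hn, packParked, h3 n hn, if_neg hn]
      rfl

theorem pack_extend (y : F.Y) (a : ℕ) (z : F.Pos → F.Γ) (d : Option F.Reg → F.Γ) :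
    pack (extend (here a) d z) =
      extend (QRAM.regAndCell a) (F.regCell d) (packParked y a z) := by
  obtain ⟨h1, h2, h3⟩ := extend_here a d z
  obtain ⟨g1, g2, g3⟩ := extend_regAndCell a (F.regCell d) (packParked y a z)
  funext v
  rcases v with _ | n
  · rw [g1, pack]
    simp only [h1]
    rfl
  · by_cases hn : n = a
    · subst hn
      rw [g2, pack, h2]
      rfl
    · rw [g3 n hn, pack, packParked, h3 n hn, if_neg hn]

/-- `Outcome` for the simulating machine. -/
abbrev SimOutcome (c : F.simulator.Cfg) (q : ℝ) (t : ℕ) : Prop := QRAM.Outcome c q t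

theorem outcome_unpark {o : Job F.S F.Γ F.numAncilla F.maxArity} {y : F.Y}
    {e : F.simCore.Cfg} (he : e.state = .unpark o y) {Φ : QState F.Pos F.Γ} {q : ℝ} {t : ℕ}
    (ho : SimOutcome ⟨e.goto (F.afterJob y o), Finsupp.mapDomain pack Φ⟩ q t) :
    SimOutcome ⟨e, Finsupp.mapDomain (packParked y e.address) Φ⟩ q (t + 1) := by
  have hp : F.simulator.prog e.state = .quantum (F.unparkOp y) (F.afterJob y o) := by rw [he]
  have := QRAM.next_of_transfer hp (packParked_comp y e.address)
    (fun _ => pack_extend y e.address) (Φ := Φ) (q := fun _ => q) (t := t) fun i => by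
      rw [show (idOp F.Γ).K i = 1 from rfl, applyAt_one]
      exact ho
  rwa [show ∑ _ : Fin (idOp F.Γ).r, q = q from Fintype.sum_unique (ι := Fin 1) _] at this

/-- All basis states have the same symbol `y` in `R_Q`, so every other outcome has weight zero and
the state is not disturbed. -/
theorem outcome_measure {o : Job F.S F.Γ F.numAncilla F.maxArity} (y : F.Y)
    {e : F.simCore.Cfg} (he : e.state = .measure o) {Φ : QState F.Pos F.Γ} {q : ℝ} {t : ℕ}
    (ho : SimOutcome ⟨e.goto (F.afterJob y o), Finsupp.mapDomain pack Φ⟩ q t) :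
    SimOutcome ⟨e, Finsupp.mapDomain (packParked y e.address) Φ⟩ q (t + 2) := by
  have hp : F.simulator.prog e.state = .measure fun y => .unpark o y := by rw [he]
  refine Outcome.of_next_single F.simulator.persistent
    (QRAM.Cfg.next_of_measure (c := ⟨e, Finsupp.mapDomain (packParked y e.address) Φ⟩) hp) y
    ?_ fun y' hy => ?_
  · dsimp only
    have hf : Finsupp.filter (fun z => packParked y e.address z none = y) Φ = Φ :=
      (Finsupp.filter_eq_self_iff _ _).mpr fun _ _ => rfl
    rw [filter_mapDomain, hf]
    exact outcome_unpark (e := e.goto (.unpark o y)) rfl ho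
  · rw [QRAM.Cfg.weight_eq_zero]
    dsimp only
    rw [filter_mapDomain, Finsupp.filter_eq_zero_iff _ _ |>.mpr, Finsupp.mapDomain_zero]
    intro z hz
    exact absurd hz hy.symm

/-- The three steps are: operate and park, measure, unpark. -/
theorem outcome_apply {o : Job F.S F.Γ F.numAncilla F.maxArity}
    {e : F.simCore.Cfg} (he : e.state = .apply o) {Φ : QState F.Pos F.Γ}
    {q : Fin (F.localJob o).U.r → ℝ} {t : ℕ}
    (ho : ∀ i, SimOutcome ⟨e.goto (F.afterJob ((F.localJob o).out i) o), Finsupp.mapDomain pack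
      (applyAt ((F.localJob o).U.K i) ((F.localJob o).cells.trans (here e.address)) Φ)⟩ (q i) t) :
    SimOutcome ⟨e, Finsupp.mapDomain pack Φ⟩ (∑ i, q i) (t + 3) := by
  have hp : F.simulator.prog e.state = .quantum (F.jobOp o) (.measure o) := by rw [he]
  refine QRAM.next_of_transfer hp (pack_comp e.address)
    (fun i => packParked_extend ((F.localJob o).out i) e.address) fun i => ?_
  exact outcome_measure _ (e := e.goto (.measure o)) rfl (ho i)

end CircuitFamily

/-! ### The three kinds of jobs -/

namespace CircuitFamily

variable {σ : Type} {F : CircuitFamily σ}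

theorem localJob_gate {s₀ s : F.S} {k : ℕ} {U : QOp F.Γ k} {f : Fin U.r → F.S}
    (h : F.prog s = .emit k U f) : F.localJob (.gate s₀ s) =
      ⟨k, U, F.slots (F.le_maxArity h), fun i => { F.blankY with out := f i }⟩ := by
  have key : ∀ g, (h' : F.prog s = g) → g = .emit k U f → F.localJob (.gate s₀ s) =
      ⟨k, U, F.slots (F.le_maxArity h), fun i => { F.blankY with out := f i }⟩ := by
    intro g h' hg
    simp only [localJob]
    split
    · rename_i k' U' f' h''
      rw [h] at h''
      cases h''
      rfl
    · rename_i hne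
      exact absurd h (hne k U f)
  exact key _ rfl h

variable {e : F.simCore.Cfg} {Φ : QState F.Pos F.Γ} {q : ℝ} {t : ℕ}

theorem outcome_gate {s₀ s : F.S} {k : ℕ} {U : QOp F.Γ k} {f : Fin U.r → F.S}
    (h : F.prog s = .emit k U f) (he : e.state = .apply (.gate s₀ s)) {q : Fin U.r → ℝ}
    (ho : ∀ i, SimOutcome ⟨e.goto (.mark s₀ (f i)), Finsupp.mapDomain pack
      (applyAt (U.K i) ((F.slots (F.le_maxArity h)).trans (here e.address)) Φ)⟩ (q i) t) :
    SimOutcome ⟨e, Finsupp.mapDomain pack Φ⟩ (∑ i, q i) (t + 3) := by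
  have key : ∀ L : F.LocalJob, F.localJob (.gate s₀ s) = L → ∀ q : Fin L.U.r → ℝ,
      (∀ i, SimOutcome ⟨e.goto (F.afterJob (L.out i) (.gate s₀ s)), Finsupp.mapDomain pack
        (applyAt (L.U.K i) (L.cells.trans (here e.address)) Φ)⟩ (q i) t) →
      SimOutcome ⟨e, Finsupp.mapDomain pack Φ⟩ (∑ i, q i) (t + 3) := by
    rintro L rfl q ho
    exact outcome_apply he ho
  exact key _ (localJob_gate h) q ho

theorem extend_swapPerm {W Γ : Type} [DecidableEq W] (w : Fin 2 ↪ W) (z : W → Γ) :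
    extend w (swapPerm Γ (z ∘ w)) z = z ∘ Equiv.swap (w 0) (w 1) := by
  funext v
  by_cases hv : ∃ i, w i = v
  · obtain ⟨i, rfl⟩ := hv
    rw [w.injective.extend_apply]
    have : ∀ j, swapPerm Γ (z ∘ w) j = z (w (Equiv.swap 0 1 j)) := fun j => by
      simp [swapPerm, Equiv.arrowCongr]
    rw [this]
    fin_cases i <;> simp
  · rw [extend_apply' _ _ _ hv, comp_apply, Equiv.swap_apply_of_ne_of_ne]
    · exact fun h => hv ⟨0, h.symm⟩
    · exact fun h => hv ⟨1, h.symm⟩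

/-- The position of the operand `p` when the address is `a`. -/
def target (a : ℕ) (p : Option (Fin F.numAncilla)) : F.Pos := p.elim (.inr a) fun i => .inl (.inl i)

theorem outcome_swap {p : Option (Fin F.numAncilla)} {i : Fin F.maxArity}
    {x : Pass F.S F.maxArity} (he : e.state = .apply (.swap p i x))
    (ho : SimOutcome ⟨e.goto (.run x), Finsupp.mapDomain pack (Finsupp.mapDomain
      (fun z => z ∘ Equiv.swap (.inl (.inr i)) (target e.address p)) Φ)⟩ q t) :
    SimOutcome ⟨e, Finsupp.mapDomain pack Φ⟩ q (t + 3) := by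
  have := outcome_apply he (Φ := Φ) (q := fun _ => q) (t := t) fun j => by
    refine (congrArg (fun Ψ => SimOutcome ⟨e.goto (.run x), Finsupp.mapDomain pack Ψ⟩ q t) ?_).mpr
      ho
    refine (QOp.applyAt_instrument _ _ _ _ _).trans ?_
    rw [(Finsupp.filter_eq_self_iff _ _).mpr fun _ _ => rfl]
    refine congrArg (fun g => Finsupp.mapDomain g Φ) (funext fun z => ?_)
    refine (extend_swapPerm _ z).trans ?_
    cases p <;> rfl
  have hs : ∑ _ : Fin (F.localJob (.swap p i x)).U.r, q = q := by
    have key : ∀ n, n = 1 → ∑ _ : Fin n, q = q := by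
      rintro _ rfl
      simp
    exact key _ Fintype.card_unit
  rwa [hs] at this

/-- By `hΦ` the letter found is the same in all basis states, so the measurement has one live
outcome and leaves superpositions of the other wires intact. -/
theorem outcome_probe {v a : F.Γ} {x : Pass F.S F.maxArity} (he : e.state = .apply (.probe v x))
    (hΦ : ∀ z ∈ Φ.support, Equiv.swap F.blank v (z (.inr e.address)) = a)
    (ho : SimOutcome ⟨e.goto (.store a x), Finsupp.mapDomain pack (Finsupp.mapDomain
      (fun z => update z (.inr e.address) (Equiv.swap F.blank v (z (.inr e.address)))) Φ)⟩ q t) :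
    SimOutcome ⟨e, Finsupp.mapDomain pack Φ⟩ q (t + 3) := by
  set φ : (Fin 1 → F.Γ) → F.Γ := fun z => Equiv.swap F.blank v (z 0)
  set w : Fin 1 ↪ F.Pos :=
    (⟨![none], injective_of_subsingleton _⟩ : Fin 1 ↪ Option F.Reg).trans (here e.address)
  have := outcome_apply he (Φ := Φ) (t := t)
    (q := fun i => if QOp.instrumentOutcome (cellPerm (Equiv.swap F.blank v)) φ i = a
      then q else 0) fun j => by
    have hj : applyAt ((F.localJob (.probe v x)).U.K j)
        ((F.localJob (.probe v x)).cells.trans (here e.address)) Φ = _ :=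
      QOp.applyAt_instrument (cellPerm (Equiv.swap F.blank v)) φ j w Φ
    rw [hj]
    split_ifs with hja
    · have hf : Finsupp.filter (fun z => φ (z ∘ w) = a) Φ = Φ :=
        (Finsupp.filter_eq_self_iff _ _).mpr fun z hz => hΦ z (Finsupp.mem_support_iff.mpr hz)
      rw [hja, hf]
      have hs : F.afterJob ((F.localJob (.probe v x)).out j) (.probe v x) = .store a x :=
        congrArg (fun b => SimState.store b x) hja
      rw [hs]
      refine (congrArg (fun g => SimOutcome ⟨e.goto (.store a x), Finsupp.mapDomain pack
        (Finsupp.mapDomain g Φ)⟩ q t) (funext fun z => ?_)).mpr ho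
      exact QRAM.extend_singleton _ _ z
    · have hf : Finsupp.filter (fun z => φ (z ∘ w) =
          QOp.instrumentOutcome (cellPerm (Equiv.swap F.blank v)) φ j) Φ = 0 := by
        refine (Finsupp.filter_eq_zero_iff _ _).mpr fun z hz => ?_
        by_contra hne
        exact hja (hz.symm.trans (hΦ z (Finsupp.mem_support_iff.mpr hne)))
      rw [hf, Finsupp.mapDomain_zero, Finsupp.mapDomain_zero]
      exact Outcome.of_weight_zero F.simulator.persistent
        (QRAM.Cfg.weight_eq_zero (M := F.simulator).mpr rfl) t
  have hs : ∑ i, (if QOp.instrumentOutcome (cellPerm (Equiv.swap F.blank v)) φ i = a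
      then q else 0) = q := by
    refine (Equiv.sum_comp (Fintype.equivFin F.Γ).symm fun b => if b = a then q else 0).trans ?_
    simp
  exact (congrArg (fun r => SimOutcome ⟨e, Finsupp.mapDomain pack Φ⟩ r (t + 3)) hs).mp this

end CircuitFamily

/-! ### Encoding the wires and gathering operands in the slots -/

namespace CircuitFamily

variable {σ : Type} {F : CircuitFamily σ}

/-- The position of a wire. -/
def pos : F.Wire → F.Pos
  | .inl i => .inl (.inl i)
  | .inr a => .inr a

theorem pos_injective : Injective (pos (F := F)) := by
  rintro (i | a) (j | b) h <;> simp_all [pos]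

theorem pos_ne_slot (w : F.Wire) (i : Fin F.maxArity) : pos w ≠ .inl (.inr i) := by
  rcases w with j | a <;> simp [pos]

/-- An unknown cell of `T_Q` still lacks the symbol that is on `T_C`. -/
def cellCode (tC : ℕ → F.Y) (a : ℕ) : Equiv.Perm F.Γ :=
  if (tC a).flag₁ then 1 else Equiv.swap F.blank (tC a).main

/-- The contents of the positions when all wires are in their places. -/
def lay (tC : ℕ → F.Y) (w : F.Wire → F.Γ) : F.Pos → F.Γ
  | .inl (.inl i) => w (.inl i)
  | .inl (.inr _) => F.blank
  | .inr a => cellCode tC a (w (.inr a))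

/-- The contents of the positions when they have been permuted by `ρ`. -/
def spread (tC : ℕ → F.Y) (ρ : Equiv.Perm F.Pos) (w : F.Wire → F.Γ) : F.Pos → F.Γ :=
  lay tC w ∘ ρ

theorem spread_injective (tC : ℕ → F.Y) (ρ : Equiv.Perm F.Pos) : Injective (spread tC ρ) := by
  intro w w' h
  have h' : lay tC w = lay tC w' := by
    funext p
    simpa [spread] using congrFun h (ρ.symm p)
  funext v
  rcases v with i | a
  · exact congrFun h' (.inl (.inl i))
  · exact (cellCode tC a).injective (congrFun h' (.inr a))

/-- The quantum memory of the simulating machine when the wires are in state `φ`. -/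
def simPsi (tC : ℕ → F.Y) (ρ : Equiv.Perm F.Pos) (φ : QState F.Wire F.Γ) :
    QState QRAM.Cell F.Y :=
  Finsupp.mapDomain pack (Finsupp.mapDomain (spread tC ρ) φ)

theorem weight_simPsi (tC : ℕ → F.Y) (ρ : Equiv.Perm F.Pos) (φ : QState F.Wire F.Γ) :
    (simPsi tC ρ φ).weight = φ.weight := by
  rw [simPsi, QState.weight_mapDomain pack_injective,
    QState.weight_mapDomain (spread_injective tC ρ)]

theorem simPsi_congr {tC tC' : ℕ → F.Y} (h : ∀ n, cellCode tC n = cellCode tC' n)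
    (ρ : Equiv.Perm F.Pos) (φ : QState F.Wire F.Γ) : simPsi tC ρ φ = simPsi tC' ρ φ := by
  have : cellCode tC = cellCode tC' := funext h
  have h' : spread tC ρ = spread tC' ρ := by
    funext w p
    simp only [spread, comp_apply]
    rcases ρ p with (i | i) | a
    · rfl
    · rfl
    · simp only [lay, this]
  rw [simPsi, simPsi, h']

/-- The permutation of the positions by the exchange of the operands with the slots; the list of
operands is reversed. -/
def gatherRev : List F.Wire → Equiv.Perm F.Pos
  | [] => 1
  | w :: ws => if h : ws.length < F.maxArity then
      gatherRev ws * Equiv.swap (.inl (.inr ⟨ws.length, h⟩)) (pos w) else gatherRev ws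

theorem gatherRev_slot (ws : List F.Wire) {i : Fin F.maxArity} (hi : ws.length ≤ i) :
    gatherRev ws (.inl (.inr i)) = .inl (.inr i) := by
  induction ws with
  | nil => rfl
  | cons w ws ih =>
    have hlt : ws.length < i := hi
    rw [gatherRev, dif_pos (hlt.trans i.isLt), Equiv.Perm.mul_apply,
      Equiv.swap_apply_of_ne_of_ne _ (pos_ne_slot w i).symm, ih hlt.le]
    intro h
    have := congrArg Fin.val (Sum.inr.inj (Sum.inl.inj h))
    simp at this
    lia

theorem gatherRev_pos {ws : List F.Wire} {v : F.Wire} (hv : v ∉ ws) :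
    gatherRev ws (pos v) = pos v := by
  induction ws with
  | nil => rfl
  | cons w ws ih =>
    rw [List.mem_cons, not_or] at hv
    rw [gatherRev]
    split_ifs
    · rw [Equiv.Perm.mul_apply, Equiv.swap_apply_of_ne_of_ne (pos_ne_slot v _)
        (fun h => hv.1 (pos_injective h)), ih hv.2]
    · exact ih hv.2

/-- Distinctness ensures that an operand is still in its place when its turn comes; later swaps
involve later slots. -/
theorem gatherRev_operand {ws : List F.Wire} (hn : ws.Nodup) {i : Fin F.maxArity} {v : F.Wire}
    (hv : ws.reverse[(i : ℕ)]? = some v) : gatherRev ws (.inl (.inr i)) = pos v := by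
  induction ws with
  | nil => simp at hv
  | cons w ws ih =>
    rw [List.nodup_cons] at hn
    rw [List.reverse_cons, List.getElem?_append, List.length_reverse] at hv
    split_ifs at hv with hi
    · rw [gatherRev]
      split_ifs with h
      · rw [Equiv.Perm.mul_apply, Equiv.swap_apply_of_ne_of_ne _ (pos_ne_slot w i).symm,
          ih hn.2 hv]
        intro h'
        have := congrArg Fin.val (Sum.inr.inj (Sum.inl.inj h'))
        simp at this
        lia
      · exact ih hn.2 hv
    · have hi' : (i : ℕ) = ws.length := by
        by_contra hne
        rw [List.getElem?_eq_none (by simp; lia)] at hv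
        exact absurd hv (by simp)
      have hlt : ws.length < F.maxArity := hi' ▸ i.isLt
      obtain rfl : i = ⟨ws.length, hlt⟩ := Fin.ext hi'
      simp only [Nat.sub_self, List.getElem?_cons_zero, Option.some.injEq] at hv
      subst hv
      rw [gatherRev, dif_pos hlt, Equiv.Perm.mul_apply, Equiv.swap_apply_left,
        gatherRev_pos hn.1]

/-- For distinct operands the transpositions are disjoint, hence commute, and their product is an
involution. So naming the same operands again returns them all. -/
theorem gatherRev_mul_self {ws : List F.Wire} (hn : ws.Nodup) :
    gatherRev ws * gatherRev ws = 1 := by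
  induction ws with
  | nil => rfl
  | cons w ws ih =>
    rw [List.nodup_cons] at hn
    rw [gatherRev]
    split_ifs with h
    · have hc := Equiv.mul_swap_eq_swap_mul (gatherRev ws)
        (.inl (.inr ⟨ws.length, h⟩)) (pos w)
      rw [gatherRev_slot ws le_rfl, gatherRev_pos hn.1] at hc
      rw [mul_assoc, ← mul_assoc (Equiv.swap _ _), ← hc, mul_assoc, Equiv.swap_mul_self, mul_one,
        ih hn.2]
    · exact ih hn.2

/-- The permutation of the positions by the exchange of the operands with the slots. -/
def gather (ops : List F.Wire) : Equiv.Perm F.Pos := gatherRev ops.reverse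

theorem gather_nil : gather (F := F) [] = 1 := rfl

theorem gather_append (ops : List F.Wire) (w : F.Wire) :
    gather (ops ++ [w]) = if h : ops.length < F.maxArity then
      gather ops * Equiv.swap (.inl (.inr ⟨ops.length, h⟩)) (pos w) else gather ops := by
  simp [gather, gatherRev]

theorem gather_mul_self {ops : List F.Wire} (hn : ops.Nodup) : gather ops * gather ops = 1 :=
  gatherRev_mul_self (List.nodup_reverse.mpr hn)

theorem gather_pos {ops : List F.Wire} {v : F.Wire} (hv : v ∉ ops) :
    gather ops (pos v) = pos v := gatherRev_pos (by simpa using hv)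

theorem gather_operand {ops : List F.Wire} (hn : ops.Nodup) {i : Fin F.maxArity} {v : F.Wire}
    (hv : ops[(i : ℕ)]? = some v) : gather ops (.inl (.inr i)) = pos v :=
  gatherRev_operand (List.nodup_reverse.mpr hn) (by simpa using hv)

theorem lay_pos {tC : ℕ → F.Y} {v : F.Wire} (hv : ∀ a, v = .inr a → (tC a).flag₁ = true)
    (z : F.Wire → F.Γ) : lay tC z (pos v) = z v := by
  rcases v with i | a
  · rfl
  · simp [pos, lay, cellCode, hv a rfl]

theorem lay_congr (tC : ℕ → F.Y) {z z' : F.Wire → F.Γ} {p : F.Pos}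
    (h : ∀ v, p = pos v → z v = z' v) : lay tC z p = lay tC z' p := by
  rcases p with (i | i) | a
  · exact h (.inl i) rfl
  · rfl
  · simp only [lay]
    rw [h (.inr a) rfl]

/-- Slot `i` holds operand `i` by `gather_operand`, and without the exchange of symbols, because the
operands are known cells. So the gate on the slots is the gate on the wires, whatever the current
address `a` is. -/
theorem applyAt_spread {tC : ℕ → F.Y} {k : ℕ} (hk : k ≤ F.maxArity) (w : Fin k ↪ F.Wire) (a : ℕ)
    (hw : ∀ i b, w i = .inr b → (tC b).flag₁ = true)
    (K : Matrix (Fin k → F.Γ) (Fin k → F.Γ) ℂ) (φ : QState F.Wire F.Γ) :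
    applyAt K ((F.slots hk).trans (here a))
        (Finsupp.mapDomain (spread tC (gather (List.ofFn w))) φ) =
      Finsupp.mapDomain (spread tC (gather (List.ofFn w))) (applyAt K w φ) := by
  have hg : ∀ i, gather (List.ofFn w) (((F.slots hk).trans (here a)) i) = pos (w i) := fun i =>
    gather_operand (List.nodup_ofFn.mpr w.injective) (by simp)
  refine applyAt_mapDomain _ _ _ _ (fun z => funext fun i => ?_) (fun z t => funext fun p => ?_) _
  · rw [comp_apply, spread, comp_apply, hg]
    exact lay_pos (hw i) z
  · by_cases hp : ∃ i, ((F.slots hk).trans (here a)) i = p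
    · obtain ⟨i, rfl⟩ := hp
      rw [Embedding.injective _ |>.extend_apply, spread, comp_apply, hg, lay_pos (hw i),
        w.injective.extend_apply]
    · rw [extend_apply' _ _ _ hp, spread, spread, comp_apply, comp_apply]
      refine lay_congr tC fun v hv => extend_apply' _ _ _ ?_
      rintro ⟨i, rfl⟩
      exact hp ⟨i, (gather (List.ofFn w)).injective ((hg i).trans hv.symm)⟩

end CircuitFamily

namespace CircuitFamily

variable {σ : Type} {F : CircuitFamily σ}

/-! ### Single steps of the generator and of the simulating machine -/

/-- The generator goes on without emitting a gate or halting. -/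
def Running (F : CircuitFamily σ) (s : F.S) : Prop :=
  (∀ k U f, F.prog s ≠ .emit k U f) ∧ ∀ b, F.prog s ≠ .halt b

/-- The wire named by the operand `p` when the address is `a`. -/
def wireOf (a : ℕ) (p : Option (Fin F.numAncilla)) : F.Wire := p.elim (.inr a) .inl

theorem pos_wireOf (a : ℕ) (p : Option (Fin F.numAncilla)) : pos (wireOf a p) = target a p := by
  cases p <;> rfl

/-- One step of the generator that does not emit a gate. -/
def genStep (g : F.toCore.Cfg × List F.Wire) : F.toCore.Cfg × List F.Wire :=
  (g.1.act (F.action g.1.state g.1.readA g.1.readC),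
    g.2 ++ ((F.operandOf g.1.state).map (wireOf g.1.address)).toList)

theorem next_of_running {d : F.toCore.Cfg} (h : F.Running d.state) (ops : List F.Wire)
    (C : Circuit F.Wire F.Γ) (k : ℕ) :
    Cfg.next (F := F) ⟨d, ops, C, k⟩ =
      {⟨(genStep (d, ops)).1, (genStep (d, ops)).2, C, k + 1⟩} := by
  cases hp : F.prog d.state with
  | classical δ =>
    rw [Cfg.next_of_classical (c := ⟨d, ops, C, k⟩) hp]
    simp [genStep, action, operandOf, hp]
  | ancilla i s =>
    rw [Cfg.next_of_ancilla (c := ⟨d, ops, C, k⟩) hp]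
    simp [genStep, action, operandOf, hp, wireOf, Core.Cfg.act_stay]
  | wire s =>
    rw [Cfg.next_of_wire (c := ⟨d, ops, C, k⟩) hp]
    simp [genStep, action, operandOf, hp, wireOf, Core.Cfg.act_stay]
  | emit k U f => exact absurd hp (h.1 k U f)
  | halt b => exact absurd hp (h.2 b)

/-- The number of operands up to the number of slots. -/
def count (ops : List F.Wire) : Fin (F.maxArity + 1) := ⟨min ops.length F.maxArity, by lia⟩

theorem count_nil : count (F := F) [] = 0 := by
  simp [count]

variable {e : F.simCore.Cfg} {φ : QState F.Wire F.Γ} {ρ : Equiv.Perm F.Pos} {q : ℝ} {t : ℕ}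

theorem outcome_of_pure {psi : QState QRAM.Cell F.Y} {g : F.Y → F.Y → F.simCore.Action}
    (h : F.simulator.prog e.state = .classical fun u v => PMF.pure (g u v))
    (ho : SimOutcome ⟨e.act (g e.readA e.readC), psi⟩ q t) : SimOutcome ⟨e, psi⟩ q (t + 1) :=
  QRAM.next_of_pure (M := F.simulator) (c := ⟨e, psi⟩) h ho

theorem outcome_swap_simPsi {tC : ℕ → F.Y} {p : Option (Fin F.numAncilla)} {i : Fin F.maxArity}
    {x : Pass F.S F.maxArity} (he : e.state = .apply (.swap p i x))
    (ho : SimOutcome ⟨e.goto (.run x),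
      simPsi tC (ρ * Equiv.swap (.inl (.inr i)) (target e.address p)) φ⟩ q t) :
    SimOutcome ⟨e, simPsi tC ρ φ⟩ q (t + 3) := by
  refine outcome_swap he ?_
  rw [← Finsupp.mapDomain_comp (f := spread tC ρ)]
  exact ho

theorem act_readC {σ : Type} {P : Core σ} (c : P.Cfg) (s : P.S) (u : P.Γ) (d : Dir) :
    c.act (s, u, c.readC, d) = ⟨s, update c.tA c.head u, d.move c.head, c.tC⟩ := by
  simp [Core.Cfg.act, Core.Cfg.readC]

/-- An unknown cell is probed before the generator reads it. -/
theorem outcome_of_unknown {x : Pass F.S F.maxArity} (he : e.state = .run x)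
    (hk : e.readC.flag₁ = false) (hρ : ρ (.inr e.address) = .inr e.address) {b : F.Γ}
    (hφ : ∀ w ∈ φ.support, w (.inr e.address) = b) {tC : ℕ → F.Y}
    (htC : tC = update e.tC e.address { e.readC with
      main := if b = F.blank then F.blank else F.tally, flag₁ := true })
    (ho : SimOutcome ⟨{ e with tC := tC }, simPsi tC ρ φ⟩ q t) :
    SimOutcome ⟨e, simPsi e.tC ρ φ⟩ q (t + 5) := by
  have hp : F.simulator.prog e.state = .classical fun u v => PMF.pure (F.runAction x u v) := by
    rw [he]
  refine outcome_of_pure hp ?_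
  have hr : F.runAction x e.readA e.readC =
      (.apply (.probe e.readC.main x), e.readA, e.readC, .stay) := by
    simp [runAction, hk]
  change SimOutcome ⟨e.act (F.runAction x e.readA e.readC), _⟩ q _
  rw [hr, Core.Cfg.act_stay]
  have hcode : cellCode e.tC e.address = Equiv.swap F.blank e.readC.main := by
    rw [cellCode, ← Core.Cfg.readC, if_neg (by simp [hk])]
  -- The cell holds the wire symbol with the blank and the symbol of `T_C` exchanged; the probe
  -- exchanges them once more.
  have hval : ∀ w, spread e.tC ρ w (.inr e.address) =
      Equiv.swap F.blank e.readC.main (w (.inr e.address)) := by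
    intro w
    rw [spread, comp_apply, hρ, lay, hcode]
  refine outcome_probe (a := b) rfl (fun z hz => ?_) ?_
  · classical
    obtain ⟨w, hw, rfl⟩ := Finset.mem_image.mp (Finsupp.mapDomain_support hz)
    change Equiv.swap F.blank e.readC.main (spread e.tC ρ w (.inr e.address)) = b
    rw [hval, Equiv.swap_apply_self, hφ w hw]
  · have hs : simPsi tC ρ φ = Finsupp.mapDomain pack (Finsupp.mapDomain (fun z =>
        update z (.inr e.address) (Equiv.swap F.blank e.readC.main (z (.inr e.address))))
          (Finsupp.mapDomain (spread e.tC ρ) φ)) := by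
      rw [simPsi, ← Finsupp.mapDomain_comp (f := spread e.tC ρ)]
      congr 2
      funext w p
      rw [comp_apply]
      by_cases hpa : p = .inr e.address
      · subst hpa
        rw [update_self, hval, Equiv.swap_apply_self, spread, comp_apply, hρ, lay, cellCode, htC]
        simp
      · rw [update_of_ne hpa, spread, spread, comp_apply, comp_apply]
        have hne : ρ p ≠ .inr e.address := fun h => hpa (ρ.injective (h.trans hρ.symm))
        rcases hρp : ρ p with (i | i) | n
        · rfl
        · rfl
        · rw [hρp] at hne
          have hn : n ≠ e.address := fun h => hne (h ▸ rfl)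
          simp only [lay, cellCode, htC, update_of_ne hn]
    refine outcome_of_pure (g := fun u v => (.run x, u,
      { v with main := if b = F.blank then F.blank else F.tally, flag₁ := true }, .stay)) rfl ?_
    have hcfg : (Core.Cfg.act (P := F.simCore) ((e.goto (.apply (.probe e.readC.main x))).goto
        (.store b x)) (.run x, e.readA, { e.readC with
          main := if b = F.blank then F.blank else F.tally, flag₁ := true }, .stay)) =
        { e with tC := tC } := by
      rw [htC, Core.Cfg.act]
      congr 1
      · exact he.symm
      · exact update_eq_self _ _
    refine (congrArg₂ (fun a b => SimOutcome (F := F) ⟨a, b⟩ q t) hcfg hs.symm).mpr ho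

/-- A step of the generator, in either pass. -/
theorem outcome_of_running {redo : Bool} {aux s : F.S} {ops : List F.Wire}
    (he : e.state = .run (redo, aux, s, count ops)) (hk : e.readC.flag₁ = true)
    (hs : F.Running s) {a : F.toCore.Action}
    (ha : a = F.action s e.readA.main (F.readWork redo e.readC)) {ops' : List F.Wire}
    (hops : ops' = ops ++ ((F.operandOf s).map (wireOf e.address)).toList)
    {e' : F.simCore.Cfg} (he' : e' = ⟨.run (redo, aux, a.1, count ops'),
      update e.tA e.head (F.writeA redo e.readA a.2.1), a.2.2.2.move e.head,
      update e.tC e.address (F.writeWork redo e.readC a.2.2.1)⟩)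
    (ho : SimOutcome ⟨e', simPsi e'.tC (ρ * gather ops') φ⟩ q t) :
    SimOutcome ⟨e, simPsi e.tC (ρ * gather ops) φ⟩ q (t + 4) := by
  have hp : F.simulator.prog e.state = .classical fun u v =>
      PMF.pure (F.runAction (redo, aux, s, count ops) u v) := by
    rw [he]
  have hw : (F.writeWork redo e.readC a.2.2.1).flag₁ = true := by
    cases redo <;> simpa [writeWork] using hk
  -- The encoding depends on `T_C` only through unknown cells, and the step writes in a known one.
  have hcode : simPsi e.tC (ρ * gather ops) φ = simPsi e'.tC (ρ * gather ops) φ := by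
    refine simPsi_congr (fun n => ?_) _ _
    rw [he']
    by_cases hn : n = e.address
    · subst hn
      simp only [cellCode, update_self, hw]
      rw [← Core.Cfg.readC, hk]
      rfl
    · simp only [cellCode, update_of_ne hn]
  have hr : F.runAction (redo, aux, s, count ops) e.readA e.readC =
      (F.afterStep (redo, aux, s, count ops) a.1, F.writeA redo e.readA a.2.1,
        F.writeWork redo e.readC a.2.2.1, a.2.2.2) := by
    rw [runAction, if_pos hk, ha]
    dsimp only
    cases hp : F.prog s with
    | emit k U f => exact absurd hp (hs.1 k U f)
    | halt b => exact absurd hp (hs.2 b)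
    | _ => rfl
  rw [hcode]
  refine outcome_of_pure (t := t + 3) hp ?_
  rw [hr]
  have hact : ∀ S, Core.Cfg.act (P := F.simCore) e (S, F.writeA redo e.readA a.2.1,
      F.writeWork redo e.readC a.2.2.1, a.2.2.2) = e'.goto S := by
    intro S
    rw [he']
    rfl
  rw [hact]
  have hgoto : e'.goto (.run (redo, aux, a.1, count ops')) = e' := by
    rw [he']
    rfl
  rw [afterStep]
  cases hop : F.operandOf s with
  | none =>
    obtain rfl : ops' = ops := by rw [hops, hop]; simp
    dsimp only
    rw [hgoto]
    exact ho.mono F.simulator.persistent (by lia)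
  | some p =>
    have hops' : ops' = ops ++ [wireOf e.address p] := by rw [hops, hop]; simp
    rw [hops', gather_append] at ho
    dsimp only
    by_cases hlt : ops.length < F.maxArity
    · have hc : (count ops : ℕ) = ops.length := min_eq_left hlt.le
      have hc' : (⟨(count ops : ℕ) + 1, by lia⟩ : Fin (F.maxArity + 1)) = count ops' := by
        ext
        rw [hops']
        simp only [count, List.length_append, List.length_singleton]
        lia
      rw [dif_pos (hc ▸ hlt)]
      rw [dif_pos hlt] at ho
      refine outcome_swap_simPsi rfl ?_
      have ht : target (e'.goto (SimState.apply (.swap p ⟨count ops, hc ▸ hlt⟩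
          (redo, aux, a.1, ⟨(count ops : ℕ) + 1, by lia⟩)) : F.SimS)).address p =
          pos (wireOf e.address p) := by
        rw [pos_wireOf]
        cases p with
        | some i => rfl
        | none =>
          -- The swap comes after the step, but naming a wire rewrites the symbols read, so the
          -- address is still that of the operand.
          have ha' : a = (a.1, e.readA.main, F.readWork redo e.readC, .stay) := by
            rw [ha]
            cases hp : F.prog s with
            | wire s' => simp [action, hp]
            | _ => simp [operandOf, hp] at hop
          change Sum.inr e'.address = Sum.inr e.address
          rw [Core.Cfg.address, Core.Cfg.address, he']
          congr 2
          funext n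
          by_cases hn : n = e.head
          · subst hn
            simp only [update_self]
            have : (F.writeA redo e.readA a.2.1).main = (e.tA e.head).main := by
              rw [ha']
              cases redo <;> rfl
            rw [this]
          · simp only [update_of_ne hn]
      rw [ht]
      change SimOutcome ⟨e'.goto (.run (redo, aux, a.1, ⟨(count ops : ℕ) + 1, by lia⟩)), _⟩ q t
      rw [hc', hgoto]
      have hcf : (⟨(count ops : ℕ), hc ▸ hlt⟩ : Fin F.maxArity) = ⟨ops.length, hlt⟩ := Fin.ext hc
      rw [hcf, mul_assoc]
      exact ho
    · have hc' : count ops' = count ops := by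
        ext
        rw [hops']
        simp only [count, List.length_append, List.length_singleton]
        lia
      have hc : ¬ (count ops : ℕ) < F.maxArity := by
        simp only [count]
        lia
      rw [dif_neg hc, ← hc', hgoto]
      rw [dif_neg hlt] at ho
      exact ho.mono F.simulator.persistent (by lia)

end CircuitFamily

namespace CircuitFamily

variable {σ : Type} {F : CircuitFamily σ}

/-! ### The two passes -/

theorem address_eq_of_main {e : F.simCore.Cfg} {d : F.toCore.Cfg}
    (h : ∀ n, (e.tA n).main = d.tA n) : e.address = d.address := by
  rw [Core.Cfg.address, Core.Cfg.address]
  congr 1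
  funext n
  rw [← h]

/-- The address tape in the first pass, which has led the generator from `d₀` to `d` in `i` steps:
the visited cells are an interval, and their old contents are kept. -/
structure FirstA (d₀ d : F.toCore.Cfg) (i : ℕ) (e : F.simCore.Cfg) : Prop where
  head : e.head = d.head
  cur : ∀ n, (e.tA n).main = d.tA n
  orig : ∀ n, (e.tA n).flag₁ = true → (e.tA n).alt = d₀.tA n
  same : ∀ n, (e.tA n).flag₁ = false → d.tA n = d₀.tA n
  mark : ∀ n, (e.tA n).flag₂ = true ↔ n = d₀.head
  visited : ∃ lo hi, (∀ n, (e.tA n).flag₁ = true ↔ lo ≤ n ∧ n < hi) ∧ lo ≤ d₀.head ∧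
    d₀.head < hi ∧ lo ≤ e.head + 1 ∧ e.head ≤ hi ∧ hi ≤ lo + i + 1

theorem FirstA.step {d₀ d : F.toCore.Cfg} {i : ℕ} {e e' : F.simCore.Cfg} (h : FirstA d₀ d i e)
    {a : F.toCore.Action} (hA : e'.tA = update e.tA e.head (F.writeA false e.readA a.2.1))
    (hh : e'.head = a.2.2.2.move e.head) : FirstA d₀ (d.act a) (i + 1) e' where
  head := by rw [hh, h.head]; rfl
  cur n := by
    change _ = update d.tA d.head a.2.1 n
    rw [hA, ← h.head]
    by_cases hn : n = e.head
    · subst hn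
      simp [writeA]
    · rw [update_of_ne hn, update_of_ne hn, h.cur]
  orig n hv := by
    rw [hA] at hv ⊢
    by_cases hn : n = e.head
    · subst hn
      simp only [update_self, writeA, Bool.false_eq_true, if_false]
      by_cases hf : e.readA.flag₁ = true
      · rw [if_pos hf]
        exact h.orig _ hf
      · rw [if_neg hf, Core.Cfg.readA, h.cur, h.same _ (Bool.eq_false_of_not_eq_true hf)]
    · rw [update_of_ne hn] at hv ⊢
      exact h.orig n hv
  same n hv := by
    change update d.tA d.head a.2.1 n = _
    rw [hA] at hv
    rw [← h.head]
    by_cases hn : n = e.head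
    · subst hn
      simp [writeA] at hv
    · rw [update_of_ne hn] at hv ⊢
      exact h.same n hv
  mark n := by
    rw [← h.mark n, hA]
    by_cases hn : n = e.head
    · subst hn
      simp [writeA, Core.Cfg.readA]
    · rw [update_of_ne hn]
  visited := by
    obtain ⟨lo, hi, hv, h1, h2, h3, h4, h5⟩ := h.visited
    have hm : e'.head ≤ e.head + 1 ∧ e.head ≤ e'.head + 1 := by
      rw [hh]
      cases a.2.2.2 <;> simp only [Dir.move] <;> lia
    -- The head is at most one cell outside the interval, so a visit extends it by at most one cell
    -- and leaves it an interval.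
    refine ⟨min lo e.head, max hi (e.head + 1), fun n => ?_, by lia, by lia, by lia, by lia, by lia⟩
    rw [hA]
    by_cases hn : n = e.head
    · subst hn
      simp [writeA]
    · rw [update_of_ne hn, hv]
      lia

/-- The contents of an unknown cell of `T_C`. -/
def tallyTape (F : CircuitFamily σ) (x : List σ) (n : ℕ) : F.Γ :=
  if F.wordTape x n = F.blank then F.blank else F.tally

/-- The classical tape in the first pass: the old contents are kept. -/
structure FirstC (x : List σ) (d₀ d : F.toCore.Cfg) (e : F.simCore.Cfg) : Prop where
  orig : ∀ n, (e.tC n).flag₁ = true → (e.tC n).main = d₀.tC n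
  cur : ∀ n, (e.tC n).flag₁ = true → F.readWork false (e.tC n) = d.tC n
  unknown : ∀ n, (e.tC n).flag₁ = false →
    (e.tC n).flag₂ = false ∧ d₀.tC n = F.tallyTape x n ∧ d.tC n = F.tallyTape x n

theorem FirstC.probe {x : List σ} {d₀ d : F.toCore.Cfg} {e e' : F.simCore.Cfg}
    (h : FirstC x d₀ d e) {n₀ : ℕ} (hk : (e.tC n₀).flag₁ = false)
    (he' : e'.tC = update e.tC n₀ { e.tC n₀ with main := F.tallyTape x n₀, flag₁ := true }) :
    FirstC x d₀ d e' := by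
  obtain ⟨h1, h2, h3⟩ := h.unknown n₀ hk
  constructor <;> intro n <;> rw [he'] <;> by_cases hn : n = n₀
  · subst hn
    simp [h2]
  · rw [update_of_ne hn]
    exact h.orig n
  · subst hn
    simp [readWork, h1, h3]
  · rw [update_of_ne hn]
    exact h.cur n
  · subst hn
    simp
  · rw [update_of_ne hn]
    exact h.unknown n

theorem FirstC.step {x : List σ} {d₀ d : F.toCore.Cfg} {e e' : F.simCore.Cfg}
    (h : FirstC x d₀ d e) {a : F.toCore.Action} (hk : e.readC.flag₁ = true)
    (haddr : e.address = d.address)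
    (he' : e'.tC = update e.tC e.address (F.writeWork false e.readC a.2.2.1)) :
    FirstC x d₀ (d.act a) e' := by
  have hd : (d.act a).tC = update d.tC e.address a.2.2.1 := by rw [haddr]; rfl
  constructor <;> intro n <;> rw [he'] <;> by_cases hn : n = e.address
  · subst hn
    intro _
    simpa [writeWork, Core.Cfg.readC] using h.orig _ hk
  · rw [update_of_ne hn]
    exact h.orig n
  · subst hn
    intro _
    simp [writeWork, readWork, hd]
  · rw [update_of_ne hn, hd, update_of_ne hn]
    exact h.cur n
  · subst hn
    intro hf
    simp [writeWork, hk] at hf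
  · rw [update_of_ne hn, hd, update_of_ne hn]
    exact h.unknown n

/-- The address tape in the second pass. -/
structure SecondA (d : F.toCore.Cfg) (e : F.simCore.Cfg) : Prop where
  head : e.head = d.head
  cur : ∀ n, (e.tA n).main = d.tA n
  fresh : ∀ n, (e.tA n).flag₁ = false
  unmarked : ∀ n, (e.tA n).flag₂ = false

theorem SecondA.step {d : F.toCore.Cfg} {e e' : F.simCore.Cfg} (h : SecondA d e)
    {a : F.toCore.Action} (hA : e'.tA = update e.tA e.head (F.writeA true e.readA a.2.1))
    (hh : e'.head = a.2.2.2.move e.head) : SecondA (d.act a) e' := by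
  refine ⟨by rw [hh, h.head]; rfl, fun n => ?_, fun n => ?_, fun n => ?_⟩
  · change _ = update d.tA d.head a.2.1 n
    rw [hA, ← h.head]
    by_cases hn : n = e.head
    · subst hn
      simp [writeA]
    · rw [update_of_ne hn, update_of_ne hn, h.cur]
  · rw [hA]
    by_cases hn : n = e.head
    · subst hn
      simpa [writeA, Core.Cfg.readA] using h.fresh _
    · rw [update_of_ne hn, h.fresh]
  · rw [hA]
    by_cases hn : n = e.head
    · subst hn
      simpa [writeA, Core.Cfg.readA] using h.unmarked _
    · rw [update_of_ne hn, h.unmarked]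

/-- The classical tape in the second pass. -/
structure SecondC (x : List σ) (d : F.toCore.Cfg) (e : F.simCore.Cfg) : Prop where
  cur : ∀ n, (e.tC n).flag₁ = true → (e.tC n).main = d.tC n
  unknown : ∀ n, (e.tC n).flag₁ = false → (e.tC n).flag₂ = false ∧ d.tC n = F.tallyTape x n

theorem SecondC.step {x : List σ} {d : F.toCore.Cfg} {e e' : F.simCore.Cfg}
    (h : SecondC x d e) {a : F.toCore.Action} (hk : e.readC.flag₁ = true)
    (haddr : e.address = d.address)
    (he' : e'.tC = update e.tC e.address (F.writeWork true e.readC a.2.2.1)) :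
    SecondC x (d.act a) e' := by
  have hd : (d.act a).tC = update d.tC e.address a.2.2.1 := by rw [haddr]; rfl
  constructor <;> intro n <;> rw [he'] <;> by_cases hn : n = e.address
  · subst hn
    intro _
    simp [writeWork, hd]
  · rw [update_of_ne hn, hd, update_of_ne hn]
    exact h.cur n
  · subst hn
    intro hf
    simp [writeWork, hk] at hf
  · rw [update_of_ne hn, hd, update_of_ne hn]
    exact h.unknown n

/-- The generator `i` steps after `d₀`, with the operands named since then. -/
def trace (d₀ : F.toCore.Cfg) (i : ℕ) : F.toCore.Cfg × List F.Wire := genStep^[i] (d₀, [])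

theorem trace_succ (d₀ : F.toCore.Cfg) (i : ℕ) : trace d₀ (i + 1) = genStep (trace d₀ i) :=
  iterate_succ_apply' _ _ _

/-- The simulating machine after `i` steps of the first pass. -/
structure First (x : List σ) (φ : QState F.Wire F.Γ) (d₀ : F.toCore.Cfg) (i : ℕ)
    (e : F.simCore.Cfg) : Prop where
  state : e.state = .run (false, d₀.state, (trace d₀ i).1.state, count (trace d₀ i).2)
  tapeA : FirstA d₀ (trace d₀ i).1 i e
  tapeC : FirstC x d₀ (trace d₀ i).1 e
  dirty : ∀ n, (e.tC n).flag₂ = true → ∃ j < i, (trace d₀ j).1.address = n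
  known : ∀ j < i, (e.tC (trace d₀ j).1.address).flag₁ = true
  operands : ∀ n, .inr n ∈ (trace d₀ i).2 → (e.tC n).flag₁ = true
  input : ∀ n, (e.tC n).flag₁ = false → ∀ w ∈ φ.support, w (.inr n) = F.wordTape x n

variable {x : List σ} {φ : QState F.Wire F.Γ} {d₀ : F.toCore.Cfg} {i : ℕ} {e : F.simCore.Cfg}

theorem First.address (h : First x φ d₀ i e) : e.address = (trace d₀ i).1.address :=
  address_eq_of_main h.tapeA.cur

/-- Operands are known cells, so an unknown cell has not been swapped away, and by `input` its wire
still carries the input letter. -/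
theorem First.probe (h : First x φ d₀ i e) :
    ∃ e', First x φ d₀ i e' ∧ e'.readC.flag₁ = true ∧ ∀ q t,
      SimOutcome ⟨e', simPsi e'.tC (gather (trace d₀ i).2) φ⟩ q t →
        SimOutcome ⟨e, simPsi e.tC (gather (trace d₀ i).2) φ⟩ q (t + 5) := by
  by_cases hk : e.readC.flag₁ = true
  · exact ⟨e, h, hk, fun q t ho => ho.mono F.simulator.persistent (by lia)⟩
  · rw [Bool.not_eq_true] at hk
    set tC := update e.tC e.address { e.readC with
      main := F.tallyTape x e.address, flag₁ := true } with htC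
    have hmono : ∀ n, (e.tC n).flag₁ = true → (tC n).flag₁ = true := by
      intro n hn
      by_cases hne : n = e.address
      · rw [htC, hne, update_self]
      · rwa [htC, update_of_ne hne]
    refine ⟨{ e with tC := tC }, ⟨h.state, ⟨h.tapeA.head, h.tapeA.cur, h.tapeA.orig, h.tapeA.same,
      h.tapeA.mark, h.tapeA.visited⟩, h.tapeC.probe hk rfl, fun n hn => ?_,
      fun j hj => hmono _ (h.known j hj), fun n hn => hmono _ (h.operands n hn), fun n hn => ?_⟩,
      ?_, fun q t ho => ?_⟩
    · refine h.dirty n ?_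
      by_cases hne : n = e.address
      · subst hne
        simpa [htC, Core.Cfg.readC] using hn
      · simpa only [htC, update_of_ne hne] using hn
    · refine h.input n ?_
      by_contra hf
      rw [Bool.not_eq_false] at hf
      exact absurd ((hmono n hf).symm.trans hn) (by simp)
    · change (tC e.address).flag₁ = true
      rw [htC, update_self]
    · refine outcome_of_unknown h.state hk ?_ (h.input _ hk) (tC := tC) rfl ho
      refine gather_pos (v := .inr e.address) fun hmem => ?_
      have := h.operands _ hmem
      rw [← Core.Cfg.readC, hk] at this
      exact absurd this (by simp)

theorem First.step (h : First x φ d₀ i e) (hk : e.readC.flag₁ = true)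
    (hr : F.Running (trace d₀ i).1.state) :
    ∃ e', First x φ d₀ (i + 1) e' ∧ ∀ q t,
      SimOutcome ⟨e', simPsi e'.tC (gather (trace d₀ (i + 1)).2) φ⟩ q t →
        SimOutcome ⟨e, simPsi e.tC (gather (trace d₀ i).2) φ⟩ q (t + 4) := by
  have haddr := h.address
  have hu : e.readA.main = (trace d₀ i).1.readA := by
    rw [Core.Cfg.readA, Core.Cfg.readA, h.tapeA.cur, h.tapeA.head]
  have hv : F.readWork false e.readC = (trace d₀ i).1.readC := by
    rw [Core.Cfg.readC, Core.Cfg.readC, ← haddr]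
    exact h.tapeC.cur _ hk
  set a := F.action (trace d₀ i).1.state e.readA.main (F.readWork false e.readC) with ha
  have h1 : (trace d₀ (i + 1)).1 = (trace d₀ i).1.act a := by
    rw [trace_succ, ha, hu, hv]
    rfl
  have h2 : (trace d₀ (i + 1)).2 = (trace d₀ i).2 ++
      ((F.operandOf (trace d₀ i).1.state).map (wireOf e.address)).toList := by
    rw [trace_succ, haddr]
    rfl
  set e' : F.simCore.Cfg := ⟨.run (false, d₀.state, a.1, count (trace d₀ (i + 1)).2),
      update e.tA e.head (F.writeA false e.readA a.2.1), a.2.2.2.move e.head,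
      update e.tC e.address (F.writeWork false e.readC a.2.2.1)⟩ with he'
  have hflag : ∀ n, (e'.tC n).flag₁ = (e.tC n).flag₁ := by
    intro n
    by_cases hne : n = e.address
    · subst hne
      simp [he', writeWork, Core.Cfg.readC]
    · simp only [he', update_of_ne hne]
  refine ⟨e', ⟨?_, ?_, ?_, fun n hn => ?_, fun j hj => ?_, fun n hn => ?_, fun n hn => ?_⟩,
    fun q t ho => ?_⟩
  · rw [h1]
    rfl
  · rw [h1]
    exact h.tapeA.step rfl rfl
  · rw [h1]
    exact h.tapeC.step hk haddr rfl
  · by_cases hne : n = e.address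
    · exact ⟨i, by lia, by rw [hne, haddr]⟩
    · have : (e.tC n).flag₂ = true := by simpa only [he', update_of_ne hne] using hn
      obtain ⟨j, hj, hj'⟩ := h.dirty n this
      exact ⟨j, by lia, hj'⟩
  · rw [hflag]
    rcases Nat.lt_succ_iff_lt_or_eq.mp hj with hj | rfl
    · exact h.known j hj
    · rw [← haddr]
      exact hk
  · rw [hflag]
    rw [h2, List.mem_append] at hn
    rcases hn with hn | hn
    · exact h.operands n hn
    · obtain ⟨p, -, hp⟩ := by simpa using hn
      rcases p with _ | p
      · obtain rfl : e.address = n := Sum.inr.inj hp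
        exact hk
      · exact absurd hp Sum.inl_ne_inr
  · rw [hflag] at hn
    exact h.input n hn
  · have := outcome_of_running (ρ := 1) (φ := φ) (q := q) (t := t) h.state hk hr ha h2 he'
    rw [one_mul, one_mul] at this
    exact this ho

/-- Each step costs at most four, and the probe after it five; a further probe precedes the first
step. The final probe makes the cell known at which the gate is emitted or the generator halts. -/
theorem First.pass (h : First x φ d₀ 0 e) (hr : ∀ j < i, F.Running (trace d₀ j).1.state) :
    ∃ e', First x φ d₀ i e' ∧ e'.readC.flag₁ = true ∧ ∀ q t,
      SimOutcome ⟨e', simPsi e'.tC (gather (trace d₀ i).2) φ⟩ q t →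
        SimOutcome ⟨e, simPsi e.tC 1 φ⟩ q (t + 9 * i + 5) := by
  induction i with
  | zero => exact h.probe
  | succ i ih =>
    obtain ⟨e₁, h₁, hk₁, ho₁⟩ := ih fun j hj => hr j (by lia)
    obtain ⟨e₂, h₂, ho₂⟩ := h₁.step hk₁ (hr i (by lia))
    obtain ⟨e₃, h₃, hk₃, ho₃⟩ := h₂.probe
    refine ⟨e₃, h₃, hk₃, fun q t ho => ?_⟩
    exact (ho₁ _ _ (ho₂ _ _ (ho₃ _ _ ho))).mono F.simulator.persistent (by lia)

/-- The simulating machine after `i` of the `l` steps of the second pass. -/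
structure Second (x : List σ) (d₀ : F.toCore.Cfg) (s : F.S) (l i : ℕ) (e : F.simCore.Cfg) :
    Prop where
  state : e.state = .run (true, s, (trace d₀ i).1.state, count (trace d₀ i).2)
  tapeA : SecondA (trace d₀ i).1 e
  tapeC : SecondC x (trace d₀ i).1 e
  -- A flagged cell will be visited again by one of the remaining steps, so none is left when `i =
  -- l`.
  dirty : ∀ n, (e.tC n).flag₂ = true → ∃ j < l, i ≤ j ∧ (trace d₀ j).1.address = n
  known : ∀ j ≤ l, (e.tC (trace d₀ j).1.address).flag₁ = true

/-- The addresses are those of the first pass, so all cells are known and no probes are needed. -/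
theorem Second.step {s : F.S} {l : ℕ} (h : Second x d₀ s l i e) (hi : i < l)
    (hr : F.Running (trace d₀ i).1.state) (ρ : Equiv.Perm F.Pos) :
    ∃ e', Second x d₀ s l (i + 1) e' ∧ (∀ n, (e'.tC n).flag₁ = (e.tC n).flag₁) ∧ ∀ q t,
      SimOutcome ⟨e', simPsi e'.tC (ρ * gather (trace d₀ (i + 1)).2) φ⟩ q t →
        SimOutcome ⟨e, simPsi e.tC (ρ * gather (trace d₀ i).2) φ⟩ q (t + 4) := by
  have haddr : e.address = (trace d₀ i).1.address := address_eq_of_main h.tapeA.cur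
  have hk : e.readC.flag₁ = true := by
    rw [Core.Cfg.readC, haddr]
    exact h.known i hi.le
  have hu : e.readA.main = (trace d₀ i).1.readA := by
    rw [Core.Cfg.readA, Core.Cfg.readA, h.tapeA.cur, h.tapeA.head]
  have hv : F.readWork true e.readC = (trace d₀ i).1.readC := by
    rw [Core.Cfg.readC, Core.Cfg.readC, ← haddr]
    exact h.tapeC.cur _ hk
  set a := F.action (trace d₀ i).1.state e.readA.main (F.readWork true e.readC) with ha
  have h1 : (trace d₀ (i + 1)).1 = (trace d₀ i).1.act a := by
    rw [trace_succ, ha, hu, hv]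
    rfl
  have h2 : (trace d₀ (i + 1)).2 = (trace d₀ i).2 ++
      ((F.operandOf (trace d₀ i).1.state).map (wireOf e.address)).toList := by
    rw [trace_succ, haddr]
    rfl
  set e' : F.simCore.Cfg := ⟨.run (true, s, a.1, count (trace d₀ (i + 1)).2),
      update e.tA e.head (F.writeA true e.readA a.2.1), a.2.2.2.move e.head,
      update e.tC e.address (F.writeWork true e.readC a.2.2.1)⟩ with he'
  have hflag : ∀ n, (e'.tC n).flag₁ = (e.tC n).flag₁ := by
    intro n
    by_cases hne : n = e.address
    · subst hne
      simp [he', writeWork, Core.Cfg.readC]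
    · simp only [he', update_of_ne hne]
  refine ⟨e', ⟨?_, ?_, ?_, fun n hn => ?_, fun j hj => (hflag _).trans (h.known j hj)⟩, hflag,
    fun q t ho => outcome_of_running h.state hk hr ha h2 he' ho⟩
  · rw [h1]
    rfl
  · rw [h1]
    exact h.tapeA.step rfl rfl
  · rw [h1]
    exact h.tapeC.step hk haddr rfl
  · by_cases hne : n = e.address
    · subst hne
      simp [he', writeWork] at hn
    · have : (e.tC n).flag₂ = true := by simpa only [he', update_of_ne hne] using hn
      obtain ⟨j, hj, hij, hj'⟩ := h.dirty n this
      refine ⟨j, hj, ?_, hj'⟩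
      rcases hij.lt_or_eq with hlt | rfl
      · exact hlt
      · exact absurd (hj'.symm.trans haddr.symm) hne

theorem Second.pass {s : F.S} {l : ℕ} (h : Second x d₀ s l 0 e)
    (hr : ∀ j < l, F.Running (trace d₀ j).1.state) (ρ : Equiv.Perm F.Pos) :
    ∀ i ≤ l, ∃ e', Second x d₀ s l i e' ∧ (∀ n, (e'.tC n).flag₁ = (e.tC n).flag₁) ∧ ∀ q t,
      SimOutcome ⟨e', simPsi e'.tC (ρ * gather (trace d₀ i).2) φ⟩ q t →
        SimOutcome ⟨e, simPsi e.tC ρ φ⟩ q (t + 4 * i) := by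
  intro i
  induction i with
  | zero =>
    refine fun _ => ⟨e, h, fun _ => rfl, fun q t ho => ?_⟩
    rwa [show (trace d₀ 0).2 = [] from rfl, gather_nil, mul_one] at ho
  | succ i ih =>
    intro hi
    obtain ⟨e₁, h₁, hf₁, ho₁⟩ := ih (by lia)
    obtain ⟨e₂, h₂, hf₂, ho₂⟩ := h₁.step (φ := φ) (by lia) (hr i (by lia)) ρ
    refine ⟨e₂, h₂, fun n => (hf₂ n).trans (hf₁ n), fun q t ho => ?_⟩
    exact (ho₁ _ _ (ho₂ _ _ ho)).mono F.simulator.persistent (by lia)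

end CircuitFamily

namespace CircuitFamily

variable {σ : Type} {F : CircuitFamily σ}

/-! ### The way back to the last gate -/

/-- The address tape is to be restored to that of `d₀` in the cells `lo, …, hi - 1`. -/
structure Undo (d₀ : F.toCore.Cfg) (lo hi : ℕ) (tA : ℕ → F.Y) : Prop where
  visited : ∀ n, (tA n).flag₁ = true ↔ lo ≤ n ∧ n < hi
  orig : ∀ n, (tA n).flag₁ = true → (tA n).alt = d₀.tA n
  same : ∀ n, (tA n).flag₁ = false → (tA n).main = d₀.tA n
  mark : ∀ n, (tA n).flag₂ = true ↔ n = d₀.head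

/-- Before the sweeps, `mark` makes the current cell count as visited, so that the head lies in the
interval; this accounts for the increase of the bound from `l + 1` to `l + 2`. -/
theorem FirstA.undo {d₀ d : F.toCore.Cfg} {l : ℕ} {e : F.simCore.Cfg} (h : FirstA d₀ d l e) :
    ∃ lo hi, lo ≤ e.head ∧ e.head < hi ∧ lo ≤ d₀.head ∧ d₀.head < hi ∧ hi ≤ lo + l + 2 ∧
      Undo d₀ lo hi (update e.tA e.head { e.readA with
        alt := if e.readA.flag₁ then e.readA.alt else e.readA.main, flag₁ := true }) := by
  obtain ⟨lo, hi, hv, h1, h2, h3, h4, h5⟩ := h.visited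
  refine ⟨min lo e.head, max hi (e.head + 1), by lia, by lia, by lia, by lia, by lia,
    fun n => ?_, fun n => ?_, fun n => ?_, fun n => ?_⟩ <;> by_cases hn : n = e.head
  · subst hn
    simp
  · rw [update_of_ne hn, hv]
    lia
  · subst hn
    intro _
    rw [update_self]
    by_cases hf : e.readA.flag₁ = true
    · exact (if_pos hf).trans (h.orig _ hf)
    · exact (if_neg hf).trans ((h.cur _).trans (h.same _ (Bool.eq_false_of_not_eq_true hf)))
  · rw [update_of_ne hn]
    exact h.orig n
  · subst hn
    simp
  · rw [update_of_ne hn]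
    exact fun hf => (h.cur n).trans (h.same n hf)
  · subst hn
    rw [update_self]
    exact h.mark _
  · rw [update_of_ne hn]
    exact h.mark n

theorem Undo.step {d₀ : F.toCore.Cfg} {lo n : ℕ} {tA : ℕ → F.Y} (h : Undo d₀ lo (lo + n + 1) tA) :
    Undo d₀ lo (lo + n) (update tA (lo + n)
      { tA (lo + n) with main := (tA (lo + n)).alt, flag₁ := false }) := by
  have hf : (tA (lo + n)).flag₁ = true := (h.visited _).mpr (by lia)
  constructor <;> intro m <;> by_cases hm : m = lo + n
  · subst hm
    simp
  · rw [update_of_ne hm, h.visited]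
    lia
  · subst hm
    simp
  · rw [update_of_ne hm]
    exact h.orig m
  · subst hm
    rw [update_self]
    exact fun _ => h.orig _ hf
  · rw [update_of_ne hm]
    exact h.same m
  · subst hm
    rw [update_self]
    exact h.mark _
  · rw [update_of_ne hm]
    exact h.mark m

variable {d₀ : F.toCore.Cfg} {s₀ s₁ : F.S} {psi : QState QRAM.Cell F.Y} {q : ℝ} {t : ℕ}

/-- The interval still to be restored is empty, and the head moves right until it meets the mark,
which it removes. -/
theorem outcome_find {lo : ℕ} (m : ℕ) : ∀ {e : F.simCore.Cfg}, e.state = .find s₀ s₁ →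
    Undo d₀ lo lo e.tA → e.head + m = d₀.head →
    (∀ e' : F.simCore.Cfg, e'.state = .run (true, s₁, s₀, 0) → SecondA d₀ e' → e'.tC = e.tC →
      SimOutcome ⟨e', psi⟩ q t) →
    SimOutcome ⟨e, psi⟩ q (t + m + 1) := by
  induction m with
  | zero =>
    intro e he h hm ho
    have hf : e.readA.flag₂ = true := (h.mark _).mpr hm
    have hv : ∀ n, (e.tA n).flag₁ = false := fun n => by
      rw [← Bool.not_eq_true, h.visited]
      lia
    refine outcome_of_pure (g := fun u v => if u.flag₂ then
        (.run (true, s₁, s₀, 0), { u with flag₂ := false }, v, .stay)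
        else (.find s₀ s₁, u, v, .right)) (by rw [he]) ?_
    rw [if_pos hf, act_readC]
    refine ho _ rfl ⟨hm, fun n => ?_, fun n => ?_, fun n => ?_⟩ rfl
    · change (update e.tA e.head _ n).main = _
      by_cases hn : n = e.head
      · subst hn
        rw [update_self]
        exact h.same _ (hv _)
      · rw [update_of_ne hn]
        exact h.same _ (hv _)
    · change (update e.tA e.head _ n).flag₁ = _
      by_cases hn : n = e.head
      · subst hn
        rw [update_self]
        exact hv _
      · rw [update_of_ne hn]
        exact hv _
    · change (update e.tA e.head _ n).flag₂ = _
      by_cases hn : n = e.head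
      · subst hn
        rw [update_self]
      · rw [update_of_ne hn, ← Bool.not_eq_true, h.mark]
        exact fun h' => hn (h'.trans hm.symm)
  | succ m ih =>
    intro e he h hm ho
    have hf : ¬ e.readA.flag₂ = true := fun hf => by
      have := (h.mark _).mp hf
      lia
    refine outcome_of_pure (g := fun u v => if u.flag₂ then
        (.run (true, s₁, s₀, 0), { u with flag₂ := false }, v, .stay)
        else (.find s₀ s₁, u, v, .right)) (by rw [he]) ?_
    rw [if_neg hf, act_readC]
    have hA : update e.tA e.head e.readA = e.tA := update_eq_self _ _
    refine ih rfl (hA.symm.subst (motive := Undo d₀ lo lo) h) ?_ ho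
    simp only [Dir.move]
    lia

/-- The sweep ends at the first cell that is not flagged. The truncated difference `lo + n - 1` fits
a head that stays put at the end of the tape: if `lo = 0`, the last left move stays in cell `0`,
whose flag has just been cleared. -/
theorem outcome_left {lo : ℕ} (n : ℕ) : ∀ {e : F.simCore.Cfg}, e.state = .left s₀ s₁ →
    Undo d₀ lo (lo + n) e.tA → e.head = lo + n - 1 → lo ≤ d₀.head →
    (∀ e' : F.simCore.Cfg, e'.state = .run (true, s₁, s₀, 0) → SecondA d₀ e' → e'.tC = e.tC →
      SimOutcome ⟨e', psi⟩ q t) →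
    SimOutcome ⟨e, psi⟩ q (t + (d₀.head + 1 - lo) + n + 2) := by
  induction n with
  | zero =>
    intro e he h hh hlo ho
    have hf : ¬ e.readA.flag₁ = true := fun hf => by
      have := (h.visited _).mp hf
      lia
    have key : SimOutcome ⟨e, psi⟩ q (t + (d₀.head - e.head) + 1 + 1) := by
      refine outcome_of_pure (g := fun u v => if u.flag₁ then
        (.left s₀ s₁, { u with main := u.alt, flag₁ := false }, v, .left)
        else (.find s₀ s₁, u, v, .stay)) (by rw [he]) ?_
      rw [if_neg hf, Core.Cfg.act_stay]
      exact outcome_find (d₀.head - e.head) rfl h (by change e.head + _ = _; lia) ho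
    exact key.mono F.simulator.persistent (by lia)
  | succ n ih =>
    intro e he h hh hlo ho
    have hh' : e.head = lo + n := hh
    have hf : e.readA.flag₁ = true := (h.visited _).mpr (by lia)
    refine outcome_of_pure (g := fun u v => if u.flag₁ then
        (.left s₀ s₁, { u with main := u.alt, flag₁ := false }, v, .left)
        else (.find s₀ s₁, u, v, .stay)) (by rw [he]) ?_
    rw [if_pos hf, act_readC]
    refine ih rfl ?_ (congrArg (· - 1) hh') hlo ho
    have := h.step
    rw [← hh'] at this
    exact hh' ▸ this

/-- The interval may extend to both sides of the head, so the head goes to its right end before the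
restoring sweep. -/
theorem outcome_right {lo hi : ℕ} (m : ℕ) : ∀ {e : F.simCore.Cfg}, e.state = .right s₀ s₁ →
    Undo d₀ lo hi e.tA → e.head + m = hi → lo ≤ e.head → lo ≤ d₀.head →
    (∀ e' : F.simCore.Cfg, e'.state = .run (true, s₁, s₀, 0) → SecondA d₀ e' → e'.tC = e.tC →
      SimOutcome ⟨e', psi⟩ q t) →
    SimOutcome ⟨e, psi⟩ q (t + (d₀.head + 1 - lo) + (hi - lo) + m + 3) := by
  induction m with
  | zero =>
    intro e he h hh hlo hlo' ho
    have hf : ¬ e.readA.flag₁ = true := fun hf => by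
      have := (h.visited _).mp hf
      lia
    refine outcome_of_pure (g := fun u v => if u.flag₁ then (.right s₀ s₁, u, v, .right)
      else (.left s₀ s₁, u, v, .left)) (by rw [he]) ?_
    rw [if_neg hf, act_readC]
    have hA : update e.tA e.head e.readA = e.tA := update_eq_self _ _
    have hhi : lo + (hi - lo) = hi := by lia
    refine outcome_left (hi - lo) rfl (hhi.symm ▸ hA.symm.subst (motive := Undo d₀ lo hi) h) ?_ hlo' ho
    rw [hhi, ← hh]
    rfl
  | succ m ih =>
    intro e he h hh hlo hlo' ho
    have hf : e.readA.flag₁ = true := (h.visited _).mpr (by lia)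
    refine outcome_of_pure (g := fun u v => if u.flag₁ then (.right s₀ s₁, u, v, .right)
      else (.left s₀ s₁, u, v, .left)) (by rw [he]) ?_
    rw [if_pos hf, act_readC]
    have hA : update e.tA e.head e.readA = e.tA := update_eq_self _ _
    refine ih rfl (hA.symm.subst (motive := Undo d₀ lo hi) h) ?_ ?_ hlo' ho <;> simp only [Dir.move] <;> lia

/-- After a gate the simulating machine restores the address tape. -/
theorem outcome_mark {d : F.toCore.Cfg} {l : ℕ} {e : F.simCore.Cfg} (he : e.state = .mark s₀ s₁)
    (h : FirstA d₀ d l e)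
    (ho : ∀ e' : F.simCore.Cfg, e'.state = .run (true, s₁, s₀, 0) → SecondA d₀ e' →
      e'.tC = e.tC → SimOutcome ⟨e', psi⟩ q t) :
    SimOutcome ⟨e, psi⟩ q (t + 3 * l + 10) := by
  obtain ⟨lo, hi, h1, h2, h3, h4, h5, hU⟩ := h.undo
  -- Each of the three distances is at most `l + 2`, which gives `3 * (l + 2) + 4` in all.
  have key : SimOutcome ⟨e, psi⟩ q
      (t + (d₀.head + 1 - lo) + (hi - lo) + (hi - e.head) + 3 + 1) := by
    refine outcome_of_pure (g := fun u v => (.right s₀ s₁,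
      { u with alt := if u.flag₁ then u.alt else u.main, flag₁ := true }, v, .stay))
      (by rw [he]) ?_
    rw [act_readC]
    exact outcome_right (hi - e.head) rfl hU (by change e.head + _ = _; lia) h1 h3 ho
  exact key.mono F.simulator.persistent (by lia)

end CircuitFamily

namespace CircuitFamily

variable {σ : Type} {F : CircuitFamily σ} {x : List σ} {φ : QState F.Wire F.Γ}
  {d d₀ : F.toCore.Cfg} {e : F.simCore.Cfg} {l : ℕ} {t : ℕ}

/-! ### The simulation between two gates -/

/-- The simulating machine after a gate, when the generator is in configuration `d`. -/
structure Ready (x : List σ) (φ : QState F.Wire F.Γ) (d : F.toCore.Cfg) (e : F.simCore.Cfg) :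
    Prop where
  state : e.state = .begin d.state
  tapeA : SecondA d e
  tapeC : SecondC x d e
  clean : ∀ n, (e.tC n).flag₂ = false
  input : ∀ n, (e.tC n).flag₁ = false → ∀ w ∈ φ.support, w (.inr n) = F.wordTape x n

theorem Ready.first (h : Ready x φ d e) {e' : F.simCore.Cfg}
    (he' : e' = ⟨.run (false, d.state, d.state, 0), update e.tA e.head
      { e.readA with alt := e.readA.main, flag₁ := true, flag₂ := true }, e.head, e.tC⟩) :
    First x φ d 0 e' := by
  subst he'
  refine ⟨by rw [trace, iterate_zero_apply, count_nil], ⟨h.tapeA.head, fun n => ?_, fun n => ?_,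
    fun _ _ => rfl, fun n => ?_, e.head, e.head + 1, fun n => ?_, h.tapeA.head.le,
    Nat.lt_succ_of_le h.tapeA.head.ge, Nat.le_succ _, Nat.le_succ _, le_rfl⟩,
    ⟨h.tapeC.cur, fun n hn => ?_, fun n hn => ?_⟩, fun n hn => ?_, fun j hj => absurd hj (by simp),
    fun n hn => absurd hn (by simp [trace]), h.input⟩
  · change (update e.tA e.head _ n).main = _
    by_cases hn : n = e.head
    · subst hn
      rw [update_self]
      exact h.tapeA.cur _
    · rw [update_of_ne hn]
      exact h.tapeA.cur _
  · change (update e.tA e.head _ n).flag₁ = true → (update e.tA e.head _ n).alt = _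
    by_cases hn : n = e.head
    · subst hn
      rw [update_self]
      exact fun _ => h.tapeA.cur _
    · rw [update_of_ne hn, h.tapeA.fresh]
      exact fun hf => absurd hf (by simp)
  · change (update e.tA e.head _ n).flag₂ = true ↔ _
    rw [← h.tapeA.head]
    by_cases hn : n = e.head
    · subst hn
      simp
    · rw [update_of_ne hn, h.tapeA.unmarked]
      simp [hn]
  · change (update e.tA e.head _ n).flag₁ = true ↔ _
    by_cases hn : n = e.head
    · subst hn
      simp
    · rw [update_of_ne hn, h.tapeA.fresh]
      simp only [Bool.false_eq_true, false_iff]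
      lia
  · change (if (e.tC n).flag₂ then _ else _) = _
    rw [h.clean]
    exact h.tapeC.cur n hn
  · exact ⟨h.clean n, (h.tapeC.unknown n hn).2, (h.tapeC.unknown n hn).2⟩
  · exact absurd (hn.symm.trans (h.clean n)) (by simp)

theorem Ready.pass (h : Ready x φ d₀ e) (hr : ∀ j < l, F.Running (trace d₀ j).1.state) :
    ∃ e', First x φ d₀ l e' ∧ e'.readC.flag₁ = true ∧ ∀ q t,
      SimOutcome ⟨e', simPsi e'.tC (gather (trace d₀ l).2) φ⟩ q t →
        SimOutcome ⟨e, simPsi e.tC 1 φ⟩ q (t + 9 * l + 6) := by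
  obtain ⟨e', h', hk, ho'⟩ := (h.first rfl).pass hr
  refine ⟨e', h', hk, fun q t ho => ?_⟩
  refine outcome_of_pure (g := fun u v => (.run (false, d₀.state, d₀.state, 0),
    { u with alt := u.main, flag₁ := true, flag₂ := true }, v, .stay)) (by rw [h.state]) ?_
  rw [act_readC]
  exact ho' q t ho

/-- On `T_C` nothing has to be restored: `main` still holds the contents as of the last gate. -/
theorem First.second (h : First x φ d₀ l e) (hk : e.readC.flag₁ = true) {s : F.S}
    {e' : F.simCore.Cfg} (hs : e'.state = .run (true, s, d₀.state, 0)) (hA : SecondA d₀ e')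
    (hC : e'.tC = e.tC) : Second x d₀ s l 0 e' := by
  refine ⟨by rw [hs, trace, iterate_zero_apply, count_nil], hA, ⟨fun n => ?_, fun n hn => ?_⟩,
    fun n hn => ?_, fun j hj => ?_⟩
  · rw [hC]
    exact h.tapeC.orig n
  · rw [hC] at hn ⊢
    exact ⟨(h.tapeC.unknown n hn).1, (h.tapeC.unknown n hn).2.1⟩
  · rw [hC] at hn
    obtain ⟨j, hj, hj'⟩ := h.dirty n hn
    exact ⟨j, hj, Nat.zero_le j, hj'⟩
  · rw [hC]
    rcases hj.lt_or_eq with hj | rfl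
    · exact h.known j hj
    · rw [← h.address]
      exact hk

theorem Second.ready {s : F.S} (h : Second x d₀ s l l e)
    (hφ : ∀ n, (e.tC n).flag₁ = false → ∀ w ∈ φ.support, w (.inr n) = F.wordTape x n) :
    Ready x φ ((trace d₀ l).1.goto s) (e.goto (.begin s)) where
  state := rfl
  tapeA := ⟨h.tapeA.head, h.tapeA.cur, h.tapeA.fresh, h.tapeA.unmarked⟩
  tapeC := ⟨h.tapeC.cur, h.tapeC.unknown⟩
  clean n := by
    by_contra hn
    obtain ⟨j, hj, hj', -⟩ := h.dirty n (Bool.eq_true_of_not_eq_false hn)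
    lia
  input := hφ

/-- The simulation up to the end of the generation. -/
theorem Ready.outcome_halt (h : Ready x φ d₀ e) (hr : ∀ j < l, F.Running (trace d₀ j).1.state)
    {b : Bool} (hb : F.prog (trace d₀ l).1.state = .halt b) :
    SimOutcome ⟨e, simPsi e.tC 1 φ⟩ (if b then φ.weight else 0) (9 * l + 7) := by
  obtain ⟨e', h', hk, ho'⟩ := h.pass hr
  have key : SimOutcome ⟨e', simPsi e'.tC (gather (trace d₀ l).2) φ⟩
      (if b then φ.weight else 0) 1 := by
    refine outcome_of_pure (g := F.runAction (false, d₀.state, (trace d₀ l).1.state,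
      count (trace d₀ l).2)) (by rw [h'.state]) ?_
    have hact : F.runAction (false, d₀.state, (trace d₀ l).1.state, count (trace d₀ l).2)
        e'.readA e'.readC = (.halt b, e'.readA, e'.readC, .stay) := by
      simp [runAction, hk, hb]
    rw [hact, Core.Cfg.act_stay, ← weight_simPsi e'.tC (gather (trace d₀ l).2) φ]
    exact Outcome.of_halted (φ := fun _ => True) F.simulator.persistent
      (c := ⟨e'.goto (.halt b), simPsi e'.tC (gather (trace d₀ l).2) φ⟩) rfl trivial 0
  exact (ho' _ _ key).mono F.simulator.persistent (by lia)

/-- The simulation up to the next gate. -/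
theorem Ready.outcome_emit (h : Ready x φ d₀ e) (hr : ∀ j < l, F.Running (trace d₀ j).1.state)
    {k : ℕ} {U : QOp F.Γ k} {f : Fin U.r → F.S} (hp : F.prog (trace d₀ l).1.state = .emit k U f)
    {w : Fin k ↪ F.Wire} (hw : (trace d₀ l).2 = List.ofFn w) {q : Fin U.r → ℝ}
    (ho : ∀ i e', Ready x (applyAt (U.K i) w φ) ((trace d₀ l).1.goto (f i)) e' →
      SimOutcome ⟨e', simPsi e'.tC 1 (applyAt (U.K i) w φ)⟩ (q i) t) :
    SimOutcome ⟨e, simPsi e.tC 1 φ⟩ (∑ i, q i) (t + 16 * l + 21) := by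
  obtain ⟨e₁, h₁, hk, ho₁⟩ := h.pass hr
  have hnd : (trace d₀ l).2.Nodup := hw ▸ List.nodup_ofFn.mpr w.injective
  have hknown : ∀ i b, w i = .inr b → (e₁.tC b).flag₁ = true := fun i b hib =>
    h₁.operands b (by rw [hw, ← hib]; exact List.mem_ofFn.mpr ⟨i, rfl⟩)
  have back : ∀ i, SimOutcome ⟨(e₁.goto (.apply (.gate d₀.state (trace d₀ l).1.state))).goto
      (.mark d₀.state (f i)), simPsi e₁.tC (gather (trace d₀ l).2) (applyAt (U.K i) w φ)⟩ (q i)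
        (t + 7 * l + 11) := by
    intro i
    have hA : FirstA d₀ (trace d₀ l).1 l ((e₁.goto
        (.apply (.gate d₀.state (trace d₀ l).1.state))).goto (.mark d₀.state (f i))) :=
      ⟨h₁.tapeA.head, h₁.tapeA.cur, h₁.tapeA.orig, h₁.tapeA.same, h₁.tapeA.mark,
        h₁.tapeA.visited⟩
    refine (outcome_mark (t := t + 4 * l + 1) rfl hA fun e₂ hs hA₂ hC => ?_).mono
      F.simulator.persistent (by lia)
    replace hC : e₂.tC = e₁.tC := hC
    obtain ⟨e₃, h₃, hf, ho₃⟩ := (h₁.second hk hs hA₂ hC).pass (φ := applyAt (U.K i) w φ) hr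
      (gather (trace d₀ l).2) l le_rfl
    -- The second pass has returned all operands to their places.
    rw [gather_mul_self hnd] at ho₃
    rw [← hC]
    refine (ho₃ (q i) (t + 1) ?_).mono F.simulator.persistent (by lia)
    have hk₃ : e₃.readC.flag₁ = true := by
      rw [Core.Cfg.readC, address_eq_of_main h₃.tapeA.cur]
      exact h₃.known l le_rfl
    refine outcome_of_pure (g := F.runAction (true, f i, (trace d₀ l).1.state,
      count (trace d₀ l).2)) (by rw [h₃.state]) ?_
    have hact : F.runAction (true, f i, (trace d₀ l).1.state, count (trace d₀ l).2)
        e₃.readA e₃.readC = (.begin (f i), e₃.readA, e₃.readC, .stay) := by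
      simp [runAction, hk₃, hp]
    rw [hact, Core.Cfg.act_stay]
    refine ho i _ (h₃.ready fun n hn z hz => ?_)
    rw [hf, hC] at hn
    -- All operands are known wires, so the gate leaves the letters on unknown wires alone.
    obtain ⟨z₀, hz₀, y, rfl⟩ := mem_support_applyAt hz
    rw [extend_apply' _ _ _ ?_]
    · exact h₁.input n hn z₀ hz₀
    · rintro ⟨j, hj⟩
      exact absurd ((hknown j n hj).symm.trans hn) (by simp)
  have key : SimOutcome ⟨e₁, simPsi e₁.tC (gather (trace d₀ l).2) φ⟩ (∑ i, q i)
      (t + 7 * l + 11 + 3 + 1) := by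
    refine outcome_of_pure (g := F.runAction (false, d₀.state, (trace d₀ l).1.state,
      count (trace d₀ l).2)) (by rw [h₁.state]) ?_
    have hact : F.runAction (false, d₀.state, (trace d₀ l).1.state, count (trace d₀ l).2)
        e₁.readA e₁.readC =
          (.apply (.gate d₀.state (trace d₀ l).1.state), e₁.readA, e₁.readC, .stay) := by
      simp [runAction, hk, hp]
    rw [hact, Core.Cfg.act_stay]
    refine outcome_gate hp rfl fun i => ?_
    have := back i
    rw [simPsi, hw, ← applyAt_spread (F.le_maxArity hp) w _ hknown, ← hw] at this
    exact this
  exact (ho₁ _ _ key).mono F.simulator.persistent (by lia)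

/-- The generator goes on until it halts or is in a state that emits a gate. -/
theorem Outcome.exists_trace {P : F.Cfg → Prop} {q : ℝ} {C : Circuit F.Wire F.Γ} :
    ∀ {t k : ℕ} {g : F.toCore.Cfg × List F.Wire},
    Cfg.weight (F := F) x ⟨g.1, g.2, C, k⟩ ≠ 0 → Outcome (F := F) x P ⟨g.1, g.2, C, k⟩ q t →
    ∃ l ≤ t, (∀ j < l, F.Running (genStep^[j] g).1.state) ∧ ¬ F.Running (genStep^[l] g).1.state ∧
      Outcome (F := F) x P ⟨(genStep^[l] g).1, (genStep^[l] g).2, C, k + l⟩ q (t - l) := by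
  intro t
  induction t with
  | zero =>
    intro k g hw ho
    refine ⟨0, le_rfl, by simp, fun hr => ?_, ho⟩
    obtain ⟨b, hb⟩ := Option.ne_none_iff_exists'.mp (ho.1 _ (Multiset.mem_singleton_self _) hw).1
    exact hr.2 b (Cfg.answer_eq_some.mp hb)
  | succ t ih =>
    intro k g hw ho
    by_cases hr : F.Running g.1.state
    · obtain ⟨l, hl, h1, h2, h3⟩ := ih (k := k + 1) (g := genStep g) hw
        (ho.next_eq_inv (next_of_running hr g.2 C k))
      refine ⟨l + 1, by lia, fun j hj => ?_, h2, ?_⟩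
      · cases j with
        | zero => exact hr
        | succ j => exact h1 j (by lia)
      · rw [show k + (l + 1) = k + 1 + l by lia, Nat.add_sub_add_right]
        exact h3
    · exact ⟨0, Nat.zero_le _, by simp, hr, ho⟩

/-- The clock does not decrease, and a live branch always has a live successor, which leads to a
leaf where the bound holds. -/
theorem Outcome.clock_le {B : ℕ} : ∀ {t : ℕ} {c : F.Cfg} {q : ℝ}, c.weight x ≠ 0 →
    Outcome x (fun c' => c'.clock ≤ B) c q t → c.clock ≤ B := by
  intro t
  induction t with
  | zero => exact fun {c q} hw ho => (ho.1 c (Multiset.mem_singleton_self c) hw).2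
  | succ t ih =>
    intro c q hw ho
    by_cases hr : F.Running c.cl.state
    · exact (Nat.le_succ _).trans (ih (c := ⟨_, _, c.circuit, c.clock + 1⟩) hw
        (ho.next_eq_inv (next_of_running hr _ _ _)))
    · cases hp : F.prog c.cl.state with
      | halt b => exact (ho.fixed_inv (Cfg.next_of_halt hp) hw).1
      | emit m U f =>
        by_cases hc : c.operands.length = m ∧ c.operands.Nodup
        · obtain ⟨w, hwl⟩ := exists_embedding_of_nodup hc
          obtain ⟨q', hq', -⟩ := ho.next_inv (Cfg.next_of_emit hp w hwl)
          obtain ⟨i, hi⟩ := U.exists_applyAt_ne_zero w (fun h => hw (Cfg.weight_eq_zero.mpr h))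
          refine (Nat.le_succ _).trans (ih (fun h => hi ?_) (hq' i))
          rw [Cfg.weight_eq_zero, Cfg.psi, Circuit.run_append_singleton] at h
          exact h
        · exact (ho.fixed_inv (Cfg.next_of_emit_of_not hp hc) hw).1
      | _ => exact absurd ((⟨by simp [hp], by simp [hp]⟩ : F.Running _)) hr

/-- The simulating machine computes what the circuits do, in time linear in the number of steps of
the generator. -/
theorem Ready.outcome {B : ℕ} : ∀ {t : ℕ} {c : F.Cfg} {e : F.simCore.Cfg} {q : ℝ},
    Ready x (c.psi x) c.cl e → c.operands = [] → c.weight x ≠ 0 →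
    Outcome x (fun c' => c'.clock ≤ B) c q t →
    SimOutcome ⟨e, simPsi e.tC 1 (c.psi x)⟩ q (22 * (B - c.clock) + 22) := by
  intro t
  induction t using Nat.strong_induction_on with
  | _ t ih =>
    rintro ⟨d, ops, C, k⟩ e q h hops hw ho
    obtain rfl : ops = [] := hops
    obtain ⟨l, hlt, hr, hn, ho'⟩ := Outcome.exists_trace (g := (d, [])) hw ho
    change ¬ F.Running (trace d l).1.state at hn
    change Outcome (F := F) x _ ⟨(trace d l).1, (trace d l).2, C, k + l⟩ q (t - l) at ho'
    have hw' : Cfg.weight (F := F) x ⟨(trace d l).1, (trace d l).2, C, k + l⟩ ≠ 0 := hw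
    cases hp : F.prog (trace d l).1.state with
    | halt b =>
      obtain ⟨hB, b', hb', rfl⟩ := ho'.fixed_inv (Cfg.next_of_halt hp) hw'
      obtain rfl : b = b' := by
        have := hp.symm.trans (Cfg.answer_eq_some.mp hb')
        injection this
      exact (h.outcome_halt hr hp).mono F.simulator.persistent (by dsimp only at hB ⊢; lia)
    | emit m U f =>
      by_cases hc : (trace d l).2.length = m ∧ (trace d l).2.Nodup
      · obtain ⟨w, hwl⟩ := exists_embedding_of_nodup hc
        obtain ⟨t', ht'⟩ : ∃ t', t - l = t' + 1 := by
          refine Nat.exists_eq_succ_of_ne_zero fun h0 => ?_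
          rw [h0] at ho'
          obtain ⟨b, hb⟩ := Option.ne_none_iff_exists'.mp
            (ho'.1 _ (Multiset.mem_singleton_self _) hw').1
          have := (Cfg.answer_eq_some.mp hb).symm.trans hp
          contradiction
        rw [ht'] at ho'
        obtain ⟨q', hq', rfl⟩ := ho'.next_inv (Cfg.next_of_emit hp w hwl)
        have hpsi : ∀ i, Cfg.psi (F := F) x ⟨(trace d l).1.goto (f i), [],
            C ++ [⟨m, U, w, i⟩], k + l + 1⟩ = applyAt (U.K i) w (Cfg.psi (F := F) x ⟨d, [], C, k⟩) :=
          fun i => Circuit.run_append_singleton _ _ _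
        have hB : k + l + 1 ≤ B := by
          obtain ⟨i, hi⟩ := U.exists_applyAt_ne_zero w (fun h => hw (Cfg.weight_eq_zero.mpr h))
          refine Outcome.clock_le (fun h => hi ?_) (hq' i)
          rw [Cfg.weight_eq_zero, hpsi] at h
          exact h
        -- The clock advances by `l + 1` at a cost of `16 * l + 21 ≤ 22 * (l + 1)`; `hB` prevents
        -- truncation in the difference with `B`.
        refine (h.outcome_emit (t := 22 * (B - (k + l + 1)) + 22) hr hp hwl
          fun i e' he' => ?_).mono F.simulator.persistent (by dsimp only; lia)
        rw [← hpsi] at he' ⊢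
        by_cases h0 : Cfg.weight (F := F) x ⟨(trace d l).1.goto (f i), [],
            C ++ [⟨m, U, w, i⟩], k + l + 1⟩ = 0
        · rw [Outcome.eq_zero_of_weight (F.persistent x) h0 (hq' i)]
          refine Outcome.of_weight_zero F.simulator.persistent ?_ _
          rw [QRAM.Cfg.weight, weight_simPsi]
          exact h0
        · exact ih t' (by lia) he' rfl h0 (hq' i)
      · obtain ⟨-, b, hb, -⟩ := ho'.fixed_inv (Cfg.next_of_emit_of_not hp hc) hw'
        have := (Cfg.answer_eq_some.mp hb).symm.trans hp
        contradiction
    | _ => exact absurd ((⟨by simp [hp], by simp [hp]⟩ : F.Running _)) hn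

end CircuitFamily

namespace CircuitFamily

variable {σ : Type} (F : CircuitFamily σ)

/-! ### The whole simulation -/

theorem wordTape_simCore (x : List σ) (n : ℕ) :
    F.simCore.wordTape x n = { F.blankY with main := F.wordTape x n } := by
  rw [Core.wordTape, Core.wordTape]
  cases x[n]? <;> rfl

theorem init_tC (x : List σ) :
    (F.init x.length).cl.tC = F.tallyTape x := by
  funext n
  change (if n < x.length then F.tally else F.blank) = _
  rw [tallyTape, Core.wordTape]
  by_cases hn : n < x.length
  · rw [if_pos hn, List.getElem?_eq_getElem hn]
    exact (if_neg (F.letter_ne_blank _)).symm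
  · rw [if_neg hn, List.getElem?_eq_none (by lia)]
    exact (if_pos rfl).symm

theorem ready_init (tape : InputTape) (x : List σ) :
    Ready x (F.inputState x) (F.init x.length).cl (F.simulator.init tape x).cl := by
  have hC : ∀ n, ((F.simulator.init tape x).cl.tC n).flag₁ = false ∧
      ((F.simulator.init tape x).cl.tC n).flag₂ = false := by
    intro n
    rw [QRAM.init_eq]
    cases tape
    · change (F.simCore.wordTape x n).flag₁ = _ ∧ (F.simCore.wordTape x n).flag₂ = _
      rw [wordTape_simCore]
      exact ⟨rfl, rfl⟩
    · exact ⟨rfl, rfl⟩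
  refine ⟨by rw [QRAM.init_eq]; rfl, ⟨by rw [QRAM.init_eq]; rfl, fun n => by rw [QRAM.init_eq]; rfl,
    fun n => by rw [QRAM.init_eq], fun n => by rw [QRAM.init_eq]⟩, ⟨fun n hn => ?_, fun n _ => ?_⟩,
    fun n => (hC n).2, fun n _ w hw => ?_⟩
  · exact absurd (hn.symm.trans (hC n).1) (by simp)
  · exact ⟨(hC n).2, by rw [init_tC]⟩
  · rw [Finset.mem_singleton.mp (Finsupp.support_single_subset hw)]
    rfl

/-- With the input on `T_C`, exchanging the blank with the letter there turns the letter of the wire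
into the blank on `T_Q`. With the input on `T_Q`, the exchange of the blank with itself is trivial,
and `T_Q` holds the letter. -/
theorem simPsi_init (tape : InputTape) (x : List σ) :
    simPsi (F.simulator.init tape x).cl.tC 1 (F.inputState x) =
      (F.simulator.init tape x).psi := by
  rw [QRAM.init_eq, simPsi, inputState, Finsupp.mapDomain_single, Finsupp.mapDomain_single]
  congr 1
  funext v
  rcases v with _ | n
  · have h : ∀ p : F.Reg, spread (F.simulator.initWork tape x) 1
        (Sum.elim (fun _ => F.blank) (F.wordTape x)) (.inl p) = F.blank := by
      rintro (i | i) <;> rfl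
    simp only [pack, h]
    cases tape <;> rfl
  · change F.cellY (cellCode _ n (F.wordTape x n)) _ = _
    cases tape
    · have : cellCode (F.simulator.initWork .classical x) n (F.wordTape x n) = F.blank := by
        change (if (F.simCore.wordTape x n).flag₁ then 1
          else Equiv.swap F.blank (F.simCore.wordTape x n).main) _ = _
        rw [wordTape_simCore]
        exact Equiv.swap_apply_right _ _
      rw [this]
      rfl
    · have : cellCode (F.simulator.initWork .quantum x) n (F.wordTape x n) = F.wordTape x n := by
        change Equiv.swap F.blank F.blank _ = _
        rw [Equiv.swap_self]
        rfl
      rw [this]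
      exact (F.wordTape_simCore x n).symm

variable {F}

/-- The bound on the clock and the bound on the gates may be attained at different times; both
persist to the later one, where they combine. -/
theorem Uniform.simulator (hU : F.Uniform) {p : List σ → ℝ} {G : ℕ → ℕ}
    (h : F.ComputesWithGates p G) : ∃ κ : ℕ, ∀ tape,
      F.simulator.ComputesInTime tape p fun n => 22 * (κ * (G n + 1)) + 22 := by
  obtain ⟨κ, hκ⟩ := hU
  refine ⟨κ, fun tape => QRAM.computesInTime_iff.mpr fun x => ?_⟩
  obtain ⟨t₁, h₁⟩ := hκ x
  obtain ⟨t₂, h₂, hp⟩ := h x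
  have o₁ : Outcome x (fun c => c.clock ≤ κ * (c.circuit.length + 1)) (F.init x.length) _ t₁ :=
    ⟨h₁, rfl⟩
  have o₂ : Outcome x (fun c => c.circuit.length ≤ G x.length) (F.init x.length) (p x) t₂ :=
    ⟨h₂, hp⟩
  replace o₁ := o₁.mono (F.persistent x) (le_max_left t₁ t₂)
  replace o₂ := o₂.mono (F.persistent x) (le_max_right t₁ t₂)
  have o : Outcome x (fun c => c.clock ≤ κ * (G x.length + 1)) (F.init x.length) (p x)
      (max t₁ t₂) := by
    refine ⟨fun c hc hw => ⟨(o₁.1 c hc hw).1, (o₁.1 c hc hw).2.trans ?_⟩, o₂.2⟩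
    exact Nat.mul_le_mul_left κ (Nat.succ_le_succ (o₂.1 c hc hw).2)
  have hw : (F.init x.length).weight x ≠ 0 := by
    rw [Ne, Cfg.weight_eq_zero]
    exact Finsupp.single_ne_zero.mpr one_ne_zero
  have := Ready.outcome (F.ready_init tape x) rfl hw o
  change SimOutcome ⟨_, simPsi _ 1 (F.inputState x)⟩ _ _ at this
  rw [simPsi_init] at this
  exact this

end CircuitFamily

end QComp

end

theorem propositionp {σ : Type} [Finite σ] (tape : QComp.InputTape) (p : List σ → ℝ)
    (T : ℕ → ℕ) (hT : ∀ n, 0 < T n) :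
    (∃ F : QComp.CircuitFamily σ, F.Uniform ∧
      ∃ c : ℕ, F.ComputesWithGates p (fun n => c * T n)) ↔
    (∃ M : QComp.QRAM σ, ∃ c : ℕ, M.ComputesInTime tape p (fun n => c * T n)) := by
  constructor
  · rintro ⟨F, hU, c, hc⟩
    obtain ⟨κ, h⟩ := hU.simulator hc
    refine ⟨F.simulator, 22 * (κ * (c + 1)) + 22, QComp.QRAM.computesInTime_iff.mpr fun x =>
      (QComp.QRAM.computesInTime_iff.mp (h tape) x).mono F.simulator.persistent ?_⟩
    -- Since `T` is positive, the additive constants are absorbed into the factor.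
    have := hT x.length
    calc 22 * (κ * (c * T x.length + 1)) + 22
        ≤ 22 * (κ * (c * T x.length + T x.length)) + 22 * T x.length := by gcongr <;> lia
      _ = (22 * (κ * (c + 1)) + 22) * T x.length := by ring
  · rintro ⟨M, c, h⟩
    exact ⟨M.toFamily tape, h.toFamily.1, c, h.toFamily.2⟩
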